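/- Let $n\ge 3$ and $r>0$. Let $\Gamma\subset\mathbb R^n$ be a symmetric open convex cone with vertex at the origin, $\Gamma_n^+\subset\Gamma\subset\Gamma_1^+$, where $\Gamma_k^+=\{\lambda:\sigma_i(\lambda)>0,\ 1\le i\le k\}$ and $\sigma_i$ is the $i$-th elementary symmetric function. Let $F\in C^\infty(\Gamma)\cap C^0(\overline\Gamma)$ be a symmetric function, homogeneous of degree one, with $F(1,\dots,1)=1$ and $F=0$ on $\partial\Gamma$, satisfying in $\Gamma$: (S0) $F>0$; (S1) $F$ is concave; (S2) $\partial F/\partial\lambda_i>0$ for all $i$; (S3) $\partial F/\partial\lambda_i\ge\epsilon F/\sigma_1$ for all $i$, with a constant $\epsilon>0$. Let $\overline B_r^+=\{x\in\mathbb R^n: x_n\ge0,\ \sum_i x_i^2\le r^2\}$ and $\Sigma_r=\{x\in\overline B_r^+:x_n=0\}$. Let $g=dx^n dx^n+g_{\alpha\beta}\,dx^\alpha dx^\beta$ be a smooth flat Riemannian metric on $\overline B_r^+$ (so that $x$ are Fermi coordinates), for which $\Sigma_r$ is umbilic with principal curvatures $\mu$, that is, $L_{\alpha\beta}=g(\nabla_\alpha\partial_\beta,\mathbf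 n)=\mu g_{\alpha\beta}$ on $\Sigma_r$, where $\mathbf n=\partial_n$ is the inner unit normal. Let the coordinates be controlled by a constant $\Lambda$: $|\xi|^2\le\Lambda\, g(\xi,\xi)$, and the $g_{ij}$ and their partial derivatives of order at most $2$ are bounded by $\Lambda$ on $\overline B_r^+$. Let $f\in C^2(\overline B_r^+)$ with $\inf f>0$, and let $u\in C^4(\overline B_r^+)$ be an admissible solution of $$F\big(\nabla^2u+du\otimes du-\tfrac12|\nabla u|^2g\big)=f e^{-2u}\ \text{ in }\overline B_r^+,\qquad \frac{\partial u}{\partial \mathbf n}+\mu=\hat\mu e^{-u}\ \text{ on }\Sigma_r .$$ Here $F$ is applied to the eigenvalues of $g^{-1}(\nabla^2u+du\otimes du-\frac12|\nabla u|^2g)$, admissible means that these lie in $\Gamma$ at every point of $\overline B_r^+$, and covariant derivatives and norms are those of $g$. (a) If $\hat\mu=0$, then $$\sup_{\overline B_{r/2}^+}\big(|\nabla u|^2+|\nabla^2u|\big)\le C\Big(1+\sup_{\overline B_r^+}e^{-2u}\Big),$$ where $C$ depends only on $r,n,\epsilon,\mu,\Lambda$, an upper bound of $\|f\|_{C^2(\overline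 B_r^+)}$ and a positive lower bound of $f$. (b) Suppose in addition that $\Gamma\subset\Gamma_2^+$, and that (A) holds: for some $\rho>0$, $\sum_{j\ne i}\partial F/\partial\lambda_j\le\rho\,\partial F/\partial\lambda_i$ for all $i$ and all $\lambda\in\Gamma$ with $\lambda_i\le0$. If $\hat\mu$ is a positive constant, then $$\sup_{\overline B_{r/2}^+}\big(|\nabla u|^2+|\nabla^2u|\big)\le C,$$ where $C$ depends only on $r,n,\epsilon,\rho,\mu,\hat\mu,\Lambda$, a lower bound of $u$, an upper bound of $\|f\|_{C^2(\overline B_r^+)}$ and a positive lower bound of $f$. -/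

import Mathlib

open scoped ContDiff

namespace FermiBdy

/-- Coordinate space `ℝⁿ` with `n = m + 1`; the last coordinate is the normal one. -/
abbrev Coord (m : ℕ) : Type := EuclideanSpace ℝ (Fin (m + 1))

/-! ### Symmetric functions, cones and structure conditions -/

/-- The `k`-th elementary symmetric function of `l = (l₁, …, lₙ)`. -/
noncomputable def sigma {N : ℕ} (k : ℕ) (l : Fin N → ℝ) : ℝ :=
  ∑ S ∈ Finset.powersetCard k (Finset.univ : Finset (Fin N)), ∏ i ∈ S, l i

/-- The positive cone `Γ_k⁺ = {l : σ_i(l) > 0 for 1 ≤ i ≤ k}`. -/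
def posCone (N k : ℕ) : Set (Fin N → ℝ) :=
  {l | ∀ i : ℕ, 1 ≤ i → i ≤ k → 0 < sigma i l}

/-- The partial derivative `∂F/∂l_i`. -/
noncomputable def dF {N : ℕ} (F : (Fin N → ℝ) → ℝ) (i : Fin N) (l : Fin N → ℝ) : ℝ :=
  fderiv ℝ F l (Pi.single i 1)

/-- `Γ` is a symmetric open convex cone with vertex at the origin, `Γ_n⁺ ⊂ Γ ⊂ Γ_1⁺`. -/
structure IsAdmissibleCone {N : ℕ} (Γ : Set (Fin N → ℝ)) : Prop where
  isOpen : IsOpen Γ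
  convex : Convex ℝ Γ
  smul_mem : ∀ t : ℝ, 0 < t → ∀ l ∈ Γ, t • l ∈ Γ
  perm_mem : ∀ τ : Equiv.Perm (Fin N), ∀ l ∈ Γ, l ∘ τ ∈ Γ
  posCone_subset : posCone N N ⊆ Γ
  subset_posCone : Γ ⊆ posCone N 1

/-- `F` is a symmetric function, homogeneous of degree one, on the cone `Γ`, normalized by
`F(1,…,1) = 1`, vanishing on `∂Γ`, with the conditions (S0)-(S3), the last with constant `ε`. -/
structure IsAdmissibleFun {N : ℕ} (ε : ℝ) (Γ : Set (Fin N → ℝ)) (F : (Fin N → ℝ) → ℝ) :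
    Prop where
  smooth : ContDiffOn ℝ ∞ F Γ
  cont : ContinuousOn F (closure Γ)
  symm : ∀ τ : Equiv.Perm (Fin N), ∀ l ∈ Γ, F (l ∘ τ) = F l
  homog : ∀ t : ℝ, 0 < t → ∀ l ∈ Γ, F (t • l) = t * F l
  normalized : F (fun _ => 1) = 1
  zero_frontier : ∀ l ∈ frontier Γ, F l = 0
  pos : ∀ l ∈ Γ, 0 < F l
  concave : ConcaveOn ℝ Γ F
  mono : ∀ l ∈ Γ, ∀ i, 0 < dF F i l
  lower : ∀ l ∈ Γ, ∀ i, ε * (F l / sigma 1 l) ≤ dF F i l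

/-- Condition (A) with constant `ρ`. -/
def ConditionA {N : ℕ} (ρ : ℝ) (Γ : Set (Fin N → ℝ)) (F : (Fin N → ℝ) → ℝ) : Prop :=
  ∀ l ∈ Γ, ∀ i, l i ≤ 0 → ∑ j ∈ Finset.univ.erase i, dF F j l ≤ ρ * dF F i l

/-! ### Half balls and partial derivatives up to the boundary -/

/-- The closed half ball `{x_n ≥ 0, ∑ x_i² ≤ r²}`. -/
def halfBall (m : ℕ) (r : ℝ) : Set (Coord m) :=
  {x | 0 ≤ x (Fin.last m) ∧ ∑ i, x i ^ 2 ≤ r ^ 2}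

/-- The flat boundary portion `{x_n = 0, ∑ x_i² ≤ r²}`. -/
def flatBdy (m : ℕ) (r : ℝ) : Set (Coord m) :=
  {x | x (Fin.last m) = 0 ∧ ∑ i, x i ^ 2 ≤ r ^ 2}

/-- The `i`-th partial derivative of a function on the closed half ball of radius `r`
(one-sided at the boundary). -/
noncomputable def pd {m : ℕ} (r : ℝ) (i : Fin (m + 1)) (v : Coord m → ℝ) (x : Coord m) : ℝ :=
  fderivWithin ℝ v (halfBall m r) x (EuclideanSpace.single i 1)

/-- `‖v‖_{C²} ≤ K` on the closed half ball of radius `r`. -/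
def C2Bound {m : ℕ} (r K : ℝ) (v : Coord m → ℝ) : Prop :=
  ∀ x ∈ halfBall m r, |v x| ≤ K ∧ (∀ i, |pd r i v x| ≤ K) ∧ ∀ i j, |pd r i (pd r j v) x| ≤ K

/-! ### Riemannian geometry of a metric given by its coefficient matrix -/

section Geometry

variable {m : ℕ} (r : ℝ) (g : Coord m → Matrix (Fin (m + 1)) (Fin (m + 1)) ℝ)

/-- Christoffel symbol `Γ^k_{ij}`. -/
noncomputable def christoffel (k i j : Fin (m + 1)) (x : Coord m) : ℝ :=
  (1 / 2) * ∑ l, (g x)⁻¹ k l *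
    (pd r i (fun y => g y j l) x + pd r j (fun y => g y i l) x - pd r l (fun y => g y i j) x)

/-- Riemann curvature `R^l_{kij}`. -/
noncomputable def riemann (l k i j : Fin (m + 1)) (x : Coord m) : ℝ :=
  pd r i (christoffel r g l j k) x - pd r j (christoffel r g l i k) x
    + ∑ p, (christoffel r g l i p x * christoffel r g p j k x
      - christoffel r g l j p x * christoffel r g p i k x)

/-- The second fundamental form `g(∇_α ∂_β, n)` of `{x_n = 0}`, for a metric in Fermi
coordinates, in which the inner unit normal `n` is the last coordinate field. -/
noncomputable def secondFF (a b : Fin m) (x : Coord m) : ℝ :=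
  ∑ k, g x k (Fin.last m) * christoffel r g k a.castSucc b.castSucc x

/-- The covariant Hessian `(∇²u)_{ij}`. -/
noncomputable def covHess (u : Coord m → ℝ) (x : Coord m) :
    Matrix (Fin (m + 1)) (Fin (m + 1)) ℝ :=
  Matrix.of fun i j => pd r i (pd r j u) x - ∑ k, christoffel r g k i j x * pd r k u x

/-- `|∇u|²` with respect to `g`. -/
noncomputable def gradSq (u : Coord m → ℝ) (x : Coord m) : ℝ :=
  ∑ i, ∑ j, (g x)⁻¹ i j * pd r i u x * pd r j u x

/-- `|∇²u|` with respect to `g`. -/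
noncomputable def hessNorm (u : Coord m → ℝ) (x : Coord m) : ℝ :=
  Real.sqrt (∑ i, ∑ j, ∑ k, ∑ l,
    (g x)⁻¹ i k * (g x)⁻¹ j l * covHess r g u x i j * covHess r g u x k l)

/-- The tensor `∇²u + du ⊗ du - ½ |∇u|² g`. -/
noncomputable def schoutenHat (u : Coord m → ℝ) (x : Coord m) :
    Matrix (Fin (m + 1)) (Fin (m + 1)) ℝ :=
  covHess r g u x + Matrix.of (fun i j => pd r i u x * pd r j u x)
    - ((1 / 2) * gradSq r g u x) • g x

/-- `g` is a smooth Riemannian metric on the closed half ball of radius `r`, in Fermi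
coordinates: `g = dxⁿ dxⁿ + g_{αβ} dx^α dx^β`. -/
structure IsFermiMetric : Prop where
  smooth : ∀ i j, ContDiffOn ℝ ∞ (fun x => g x i j) (halfBall m r)
  posDef : ∀ x ∈ halfBall m r, (g x).PosDef
  normal : ∀ x ∈ halfBall m r, g x (Fin.last m) (Fin.last m) = 1
  mixed : ∀ x ∈ halfBall m r, ∀ a : Fin m, g x a.castSucc (Fin.last m) = 0

/-- `g` is flat. -/
def IsFlat : Prop :=
  ∀ x ∈ halfBall m r, ∀ l k i j, riemann r g l k i j x = 0

/-- The boundary portion `{x_n = 0}` is umbilic with principal curvatures `μ`. -/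
def IsUmbilic (μ : Coord m → ℝ) : Prop :=
  ∀ x ∈ flatBdy m r, ∀ a b : Fin m,
    secondFF r g a b x = μ x * g x a.castSucc b.castSucc

/-- The coordinates are controlled by `Λ`: `|ξ|² ≤ Λ g(ξ,ξ)` and the coefficients of `g` are
bounded by `Λ` together with their derivatives up to order two. -/
def ChartBound (Λ : ℝ) : Prop :=
  (∀ x ∈ halfBall m r, ∀ ξ : Fin (m + 1) → ℝ,
    ∑ i, ξ i ^ 2 ≤ Λ * ∑ i, ∑ j, g x i j * ξ i * ξ j) ∧
  ∀ i j, C2Bound r Λ (fun x => g x i j)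

/-- `l` lists the eigenvalues, with multiplicity, of the matrix `W`. -/
def IsEigenvalues {N : ℕ} (W : Matrix (Fin N) (Fin N) ℝ) (l : Fin N → ℝ) : Prop :=
  W.charpoly = ∏ i, (Polynomial.X - Polynomial.C (l i))

/-- `u ∈ C⁴` is an admissible solution of `F(∇²u + du ⊗ du - ½|∇u|² g) = f e^{-2u}` on the
closed half ball, with `∂u/∂n + μ = μhat e^{-u}` on `{x_n = 0}`.
`F` is applied to the eigenvalues of `g⁻¹ (∇²u + du ⊗ du - ½|∇u|² g)`, which lie in `Γ`. -/
structure IsSolution (Γ : Set (Fin (m + 1) → ℝ)) (F : (Fin (m + 1) → ℝ) → ℝ)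
    (μ : Coord m → ℝ) (μhat : ℝ) (f u : Coord m → ℝ) : Prop where
  smooth : ContDiffOn ℝ 4 u (halfBall m r)
  eqn : ∀ x ∈ halfBall m r, ∃ l ∈ Γ,
    IsEigenvalues ((g x)⁻¹ * schoutenHat r g u x) l ∧ F l = f x * Real.exp (-2 * u x)
  bdy : ∀ x ∈ flatBdy m r, pd r (Fin.last m) u x + μ x = μhat * Real.exp (-u x)

/-- `f ∈ C²` on the closed half ball, `‖f‖_{C²} ≤ K` and `inf f ≥ f₀`. -/
structure IsDatum (K f₀ : ℝ) (f : Coord m → ℝ) : Prop where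
  smooth : ContDiffOn ℝ 2 f (halfBall m r)
  bound : C2Bound r K f
  lower : ∀ x ∈ halfBall m r, f₀ ≤ f x

end Geometry

end FermiBdy

open FermiBdy

/-!
Write `W = ∇²u + du ⊗ du - ½|du|² g` and `V = ∇²u + du ⊗ du`. The estimate follows from the maximum
principle for `θ² G`, where `G = V(e, e) + tr V` is maximized over all points of the half ball and all
`g`-unit vectors `e` (encoded as a vector of an orthonormal frame), and
`θ = (r² - |x|²) exp (A xₙ)` is a cut-off with a large constant `A`. Admissibility gives `tr W > 0`,
and for `n ≥ 3` this makes `G` positive and makes it control both `|du|²` and `|∇²u|`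
(`size_bounds`, `gradSq_add_hessNorm_le`).

*The equation.* `F` composed with the eigenvalues is never differentiated. If `l₀` are the
eigenvalues of `W` at the maximum point, concavity, symmetry and homogeneity of `F` (with Birkhoff's
theorem on doubly stochastic matrices) give `f e^{-2u} ≤ ∑ Fᵢ(l₀) W(Eᵢ, Eᵢ)` at every point and in
every orthonormal frame, with equality at the maximum point in a frame of eigenvectors
(`IsAdmissibleFun.le_sum_diag`, `IsSolution.le_sum_frame`). Along a geodesic with a parallel frame the
difference of the two sides is thus minimal at time `0`, and its first and second derivatives there
are the differentiated equation (`IsSolution.linearized`). In such frames the derivatives of tensor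
components are components of covariant derivatives (`IsParallelFrame.hasDeriv2` and its companions):
the connection terms cancel.

*Interior maximum.* The metric being flat, covariant derivatives commute (`flat_commute`), and the
derivative tests for `θ² G` combine with the differentiated equation, summed over all directions, to a
quadratic inequality for `θ² G` whose leading term is `(∑ Fᵢ) |∇²u|² ≥ c (∑ Fᵢ) G²`
(`linearized_bound`, `interior_bound`, `exists_interior_estimate`).

*Boundary maximum.* By the Codazzi equation the umbilic factor `μ` is locally constant on the boundary
(`IsUmbilic.pd_eq_zero`), so that the boundary condition, differentiated tangentially, yields
`u_{αn} = -uₙ u_α`: the normal is an eigenvector of `W`. Differentiating once more gives the normal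
derivative of the tangential entries, `∇ₙW_{αα} = (2μ - ν) W_{αα} - ν W_{nn}` with `ν = μhat e^{-u}`
(`IsSolution.ev3_mixed`). The equation, differentiated in the normal direction, then bounds
`∇ₙW_{nn}` from below; here (S3) controls the right-hand side, and condition (A) the term
`ν W_{nn} ∑ F_α`, which is absent for `μhat = 0`. Altogether `∇ₙG ≥ -C G` (`boundary_bound`), which
excludes a boundary maximum as soon as `2A > C` (`exists_boundary_estimate`).

Only one-sided derivatives and short-time geodesics are used: from an interior point in every frame
direction, and from a boundary point along the normal coordinate line.
-/

namespace FermiBdy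

open Set Filter Topology

/-! ### The half ball and one-sided partial derivatives -/

section HalfBall

variable {m : ℕ} {r : ℝ}

lemma contDiff_coord (i : Fin (m + 1)) : ContDiff ℝ ∞ (fun x : Coord m => x i) := by
  fun_prop

lemma halfBall_eq (hr : 0 < r) :
    halfBall m r = Metric.closedBall 0 r ∩ {x | 0 ≤ x (Fin.last m)} := by
  ext x
  simp only [halfBall, mem_ofPred_eq, mem_inter_iff, Metric.mem_closedBall, dist_zero_right,
    EuclideanSpace.norm_eq, Real.norm_eq_abs, sq_abs]
  rw [Real.sqrt_le_left hr.le]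
  tauto

lemma convex_halfBall (hr : 0 < r) : Convex ℝ (halfBall m r) := by
  rw [halfBall_eq hr]
  refine (convex_closedBall _ _).inter ?_
  intro x hx y hy a b ha hb _
  simp only [mem_ofPred_eq, PiLp.add_apply, PiLp.smul_apply, smul_eq_mul] at *
  positivity

lemma isCompact_halfBall (hr : 0 < r) : IsCompact (halfBall m r) := by
  rw [halfBall_eq hr]
  refine (isCompact_closedBall _ _).inter_right ?_
  exact isClosed_le continuous_const (contDiff_coord _).continuous

lemma mem_nhds_halfBall {x : Coord m} (h0 : 0 < x (Fin.last m)) (h1 : ∑ i, x i ^ 2 < r ^ 2) :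
    halfBall m r ∈ 𝓝 x := by
  have hc : Continuous fun y : Coord m => ∑ i, y i ^ 2 := by fun_prop
  filter_upwards [(contDiff_coord (Fin.last m)).continuous.continuousAt.eventually_const_lt h0,
    hc.continuousAt.eventually_lt_const h1] with y hy0 hy1
  exact ⟨hy0.le, hy1.le⟩

lemma halfBall_interior_nonempty (hr : 0 < r) : (interior (halfBall m r)).Nonempty := by
  refine ⟨EuclideanSpace.single (Fin.last m) (r / 2), mem_interior_iff_mem_nhds.2
    (mem_nhds_halfBall ?_ ?_)⟩
  · simp [hr]
  · have : ∑ i, (EuclideanSpace.single (Fin.last m) (r / 2) : Coord m) i ^ 2 = (r / 2) ^ 2 := by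
      rw [Finset.sum_eq_single (Fin.last m)] <;> simp +contextual
    rw [this]
    nlinarith

lemma uniqueDiffOn_halfBall (hr : 0 < r) : UniqueDiffOn ℝ (halfBall m r) :=
  uniqueDiffOn_convex (convex_halfBall hr) (halfBall_interior_nonempty hr)

lemma halfBall_subset_closure_interior (hr : 0 < r) :
    halfBall m r ⊆ closure (interior (halfBall m r)) := by
  rw [(convex_halfBall hr).closure_interior_eq_closure_of_nonempty_interior
    (halfBall_interior_nonempty hr)]
  exact subset_closure

variable {v w : Coord m → ℝ} {x : Coord m} {i j : Fin (m + 1)}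

lemma contDiffOn_pd (hr : 0 < r) {k l : ℕ∞ω} (hv : ContDiffOn ℝ l v (halfBall m r))
    (hk : k + 1 ≤ l) (i : Fin (m + 1)) : ContDiffOn ℝ k (pd r i v) (halfBall m r) := by
  have := hv.fderivWithin (uniqueDiffOn_halfBall hr) hk
  exact this.clm_apply contDiffOn_const

lemma pd_add (hr : 0 < r) (hx : x ∈ halfBall m r) (hv : DifferentiableOn ℝ v (halfBall m r))
    (hw : DifferentiableOn ℝ w (halfBall m r)) :
    pd r i (fun y => v y + w y) x = pd r i v x + pd r i w x := by
  unfold pd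
  rw [fderivWithin_fun_add (uniqueDiffOn_halfBall hr x hx) (hv x hx) (hw x hx)]
  rfl

lemma pd_sub (hr : 0 < r) (hx : x ∈ halfBall m r) (hv : DifferentiableOn ℝ v (halfBall m r))
    (hw : DifferentiableOn ℝ w (halfBall m r)) :
    pd r i (fun y => v y - w y) x = pd r i v x - pd r i w x := by
  unfold pd
  rw [fderivWithin_fun_sub (uniqueDiffOn_halfBall hr x hx) (hv x hx) (hw x hx)]
  rfl

lemma pd_mul (hr : 0 < r) (hx : x ∈ halfBall m r) (hv : DifferentiableOn ℝ v (halfBall m r))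
    (hw : DifferentiableOn ℝ w (halfBall m r)) :
    pd r i (fun y => v y * w y) x = pd r i v x * w x + v x * pd r i w x := by
  unfold pd
  rw [fderivWithin_fun_mul (uniqueDiffOn_halfBall hr x hx) (hv x hx) (hw x hx)]
  simp
  ring

lemma pd_sum (hr : 0 < r) (hx : x ∈ halfBall m r) {κ : Type*} {s : Finset κ}
    {v : κ → Coord m → ℝ} (hv : ∀ k ∈ s, DifferentiableOn ℝ (v k) (halfBall m r)) :
    pd r i (fun y => ∑ k ∈ s, v k y) x = ∑ k ∈ s, pd r i (v k) x := by
  unfold pd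
  rw [fderivWithin_fun_sum (uniqueDiffOn_halfBall hr x hx) (fun k hk => hv k hk x hx)]
  simp

lemma pd_exp (hr : 0 < r) (hx : x ∈ halfBall m r) (hv : DifferentiableOn ℝ v (halfBall m r)) :
    pd r i (fun y => Real.exp (v y)) x = Real.exp (v x) * pd r i v x := by
  unfold pd
  rw [fderivWithin_exp (hv x hx) (uniqueDiffOn_halfBall hr x hx)]
  simp

lemma pd_const (c : ℝ) : pd r i (fun _ => c) x = 0 := by
  unfold pd
  simp

lemma pd_const_mul (hr : 0 < r) (hx : x ∈ halfBall m r) (c : ℝ)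
    (hv : DifferentiableOn ℝ v (halfBall m r)) :
    pd r i (fun y => c * v y) x = c * pd r i v x := by
  rw [pd_mul hr hx (differentiableOn_const _) hv, pd_const]; ring

lemma pd_congr (hx : x ∈ halfBall m r) (h : ∀ y ∈ halfBall m r, v y = w y) :
    pd r i v x = pd r i w x := by
  unfold pd
  rw [fderivWithin_congr h (h x hx)]

lemma pd_coord (hr : 0 < r) (hx : x ∈ halfBall m r) :
    pd r i (fun y => y j) x = if i = j then 1 else 0 := by
  unfold pd
  have h : HasFDerivAt (fun y : Coord m => y j) (EuclideanSpace.proj j : Coord m →L[ℝ] ℝ) x :=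
    (EuclideanSpace.proj j : Coord m →L[ℝ] ℝ).hasFDerivAt
  rw [h.hasFDerivWithinAt.fderivWithin (uniqueDiffOn_halfBall hr x hx)]
  simp [eq_comm]

lemma pd_comm (hr : 0 < r) (hx : x ∈ halfBall m r) (hv : ContDiffOn ℝ 2 v (halfBall m r)) :
    pd r i (pd r j v) x = pd r j (pd r i v) x := by
  have hs : IsSymmSndFDerivWithinAt ℝ v (halfBall m r) x :=
    (hv x hx).isSymmSndFDerivWithinAt (by simp) (uniqueDiffOn_halfBall hr)
      (halfBall_subset_closure_interior hr hx) hx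
  have hd : DifferentiableWithinAt ℝ (fderivWithin ℝ v (halfBall m r)) (halfBall m r) x :=
    (hv.fderivWithin (uniqueDiffOn_halfBall hr) (m := 1) (by norm_num)).differentiableOn
      (by norm_num) x hx
  have key : ∀ a b : Fin (m + 1), pd r a (pd r b v) x =
      fderivWithin ℝ (fderivWithin ℝ v (halfBall m r)) (halfBall m r) x
        (EuclideanSpace.single a 1) (EuclideanSpace.single b 1) := by
    intro a b
    unfold pd
    rw [fderivWithin_clm_apply (uniqueDiffOn_halfBall hr x hx) hd
      (differentiableWithinAt_const _)]
    simp
  rw [key, key, hs.eq]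

/-- Chain rule along a curve in the half ball. -/
lemma hasDerivWithinAt_comp_curve {γ : ℝ → Coord m} {γ' : Coord m} {I : Set ℝ} {t : ℝ}
    (ht : t ∈ I) (hv : DifferentiableOn ℝ v (halfBall m r)) (hγ : HasDerivWithinAt γ γ' I t)
    (hI : MapsTo γ I (halfBall m r)) :
    HasDerivWithinAt (fun s => v (γ s)) (∑ k, pd r k v (γ t) * γ' k) I t := by
  have h1 := ((hv (γ t) (hI ht)).hasFDerivWithinAt).comp_hasDerivWithinAt t hγ hI
  have h2 : γ' = ∑ k, γ' k • (EuclideanSpace.single k (1 : ℝ) : Coord m) := by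
    ext a
    simp [Finset.sum_apply, Pi.single_apply]
  have h3 : ∑ k, pd r k v (γ t) * γ' k = fderivWithin ℝ v (halfBall m r) (γ t) γ' := by
    conv_rhs => rw [h2]
    simp [pd, map_sum, mul_comm]
  rw [h3]
  exact h1

end HalfBall

/-! ### Covariant derivatives of coordinate arrays -/

section Tensor

variable {m : ℕ} {r : ℝ} {g : Coord m → Matrix (Fin (m + 1)) (Fin (m + 1)) ℝ}

lemma IsFermiMetric.symm (hg : IsFermiMetric r g) {x : Coord m} (hx : x ∈ halfBall m r)
    (i j : Fin (m + 1)) : g x i j = g x j i := by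
  have := (hg.posDef x hx).isHermitian.apply i j
  simpa using this.symm

lemma IsFermiMetric.det_pos (hg : IsFermiMetric r g) {x : Coord m} (hx : x ∈ halfBall m r) :
    0 < (g x).det := (hg.posDef x hx).det_pos

lemma IsFermiMetric.mul_inv (hg : IsFermiMetric r g) {x : Coord m} (hx : x ∈ halfBall m r) :
    g x * (g x)⁻¹ = 1 :=
  Matrix.mul_nonsing_inv _ (isUnit_iff_ne_zero.2 (hg.det_pos hx).ne')

lemma contDiffOn_det {N : ℕ} {k : ℕ∞ω} {s : Set (Coord m)} {A : Coord m → Matrix (Fin N) (Fin N) ℝ}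
    (hA : ∀ i j, ContDiffOn ℝ k (fun x => A x i j) s) :
    ContDiffOn ℝ k (fun x => (A x).det) s := by
  simp only [Matrix.det_apply]
  exact ContDiffOn.sum fun σ _ => (contDiffOn_prod fun i _ => hA _ _).const_smul _

lemma IsFermiMetric.contDiffOn_inv (hg : IsFermiMetric r g) (i j : Fin (m + 1)) :
    ContDiffOn ℝ ∞ (fun x => (g x)⁻¹ i j) (halfBall m r) := by
  have h1 : ContDiffOn ℝ ∞ (fun x => ((g x).det)⁻¹ * ((g x).updateRow j (Pi.single i 1)).det)
      (halfBall m r) := by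
    refine ContDiffOn.mul ((contDiffOn_det hg.smooth).inv fun x hx => (hg.det_pos hx).ne')
      (contDiffOn_det fun a b => ?_)
    by_cases h : a = j
    · subst h
      simp only [Matrix.updateRow_self]
      exact contDiffOn_const
    · simp only [Matrix.updateRow_ne h]
      exact hg.smooth a b
  refine h1.congr fun x _ => ?_
  rw [Matrix.inv_def, Matrix.smul_apply, Matrix.adjugate_apply, Ring.inverse_eq_inv', smul_eq_mul]

lemma IsFermiMetric.contDiffOn_christoffel (hr : 0 < r) (hg : IsFermiMetric r g)
    (k i j : Fin (m + 1)) : ContDiffOn ℝ ∞ (christoffel r g k i j) (halfBall m r) := by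
  unfold christoffel
  refine contDiffOn_const.mul (ContDiffOn.sum fun l _ => (hg.contDiffOn_inv k l).mul ?_)
  exact ((contDiffOn_pd hr (hg.smooth _ _) (by simp) _).add
    (contDiffOn_pd hr (hg.smooth _ _) (by simp) _)).sub (contDiffOn_pd hr (hg.smooth _ _) (by simp) _)

lemma IsFermiMetric.christoffel_symm (hg : IsFermiMetric r g) {x : Coord m}
    (hx : x ∈ halfBall m r) (k i j : Fin (m + 1)) :
    christoffel r g k i j x = christoffel r g k j i x := by
  unfold christoffel
  congr 1
  refine Finset.sum_congr rfl fun l _ => ?_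
  rw [pd_congr (v := fun y => g y i j) (w := fun y => g y j i) hx (fun y hy => hg.symm hy i j)]
  ring

/-- Lowering the upper index of the Christoffel symbol. -/
lemma IsFermiMetric.sum_mul_christoffel (hg : IsFermiMetric r g) {x : Coord m}
    (hx : x ∈ halfBall m r) (l i j : Fin (m + 1)) :
    ∑ k, g x l k * christoffel r g k i j x =
      (1 / 2) * (pd r i (fun y => g y j l) x + pd r j (fun y => g y i l) x
        - pd r l (fun y => g y i j) x) := by
  unfold christoffel
  set q : Fin (m + 1) → ℝ := fun l => pd r i (fun y => g y j l) x + pd r j (fun y => g y i l) x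
        - pd r l (fun y => g y i j) x with hq
  have h := congrFun (congrArg (fun M => Matrix.mulVec M q) (hg.mul_inv hx)) l
  simp only [← Matrix.mulVec_mulVec, Matrix.one_mulVec] at h
  have h2 : ∑ k, g x l k * (1 / 2 * ∑ l, (g x)⁻¹ k l * q l) =
      1 / 2 * ((g x).mulVec ((g x)⁻¹.mulVec q)) l := by
    simp only [Matrix.mulVec, dotProduct, Finset.mul_sum]
    refine Finset.sum_congr rfl fun k _ => Finset.sum_congr rfl fun l _ => ?_
    ring
  rw [h2, h]

/-- The metric is parallel. -/
lemma IsFermiMetric.pd_metric (hg : IsFermiMetric r g) {x : Coord m}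
    (hx : x ∈ halfBall m r) (k i j : Fin (m + 1)) :
    pd r k (fun y => g y i j) x =
      ∑ p, christoffel r g p k i x * g x p j + ∑ p, christoffel r g p k j x * g x i p := by
  have h1 := hg.sum_mul_christoffel hx j k i
  have h2 := hg.sum_mul_christoffel hx i k j
  have e1 : ∑ p, christoffel r g p k i x * g x p j = ∑ p, g x j p * christoffel r g p k i x :=
    Finset.sum_congr rfl fun p _ => by rw [hg.symm hx p j]; ring
  have e2 : ∑ p, christoffel r g p k j x * g x i p = ∑ p, g x i p * christoffel r g p k j x :=
    Finset.sum_congr rfl fun p _ => by ring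
  rw [e1, e2, h1, h2]
  have e3 : ∀ l a b, pd r l (fun y => g y a b) x = pd r l (fun y => g y b a) x := fun l a b =>
    pd_congr hx fun y hy => hg.symm hy a b
  rw [e3 k j i, e3 j k i, e3 i k j]
  ring

variable (r g)

/-- Coordinates `(∇S)_{ki}` of the covariant derivative of a 1-tensor. -/
noncomputable def cov1 (S : Fin (m + 1) → Coord m → ℝ) (k i : Fin (m + 1)) (x : Coord m) : ℝ :=
  pd r k (S i) x - ∑ p, christoffel r g p k i x * S p x

/-- Coordinates `(∇S)_{kij}` of the covariant derivative of a covariant 2-tensor; `k` is the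
direction of differentiation. -/
noncomputable def cov2 (S : Fin (m + 1) → Fin (m + 1) → Coord m → ℝ) (k i j : Fin (m + 1))
    (x : Coord m) : ℝ :=
  pd r k (S i j) x - ∑ p, christoffel r g p k i x * S p j x
    - ∑ p, christoffel r g p k j x * S i p x

/-- Coordinates `(∇S)_{lkij}` of the covariant derivative of a covariant 3-tensor; `l` is the
direction of differentiation. -/
noncomputable def cov3 (S : Fin (m + 1) → Fin (m + 1) → Fin (m + 1) → Coord m → ℝ)
    (l k i j : Fin (m + 1)) (x : Coord m) : ℝ :=
  pd r l (S k i j) x - ∑ p, christoffel r g p l k x * S p i j x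
    - ∑ p, christoffel r g p l i x * S k p j x - ∑ p, christoffel r g p l j x * S k i p x

variable {r g}

lemma pd_matrix_mul (hr : 0 < r) {κ ι τ : Type*} [Fintype ι]
    {P : Coord m → Matrix κ ι ℝ} {Q : Coord m → Matrix ι τ ℝ} {x : Coord m}
    (hx : x ∈ halfBall m r)
    (hP : ∀ a b, DifferentiableOn ℝ (fun y => P y a b) (halfBall m r))
    (hQ : ∀ a b, DifferentiableOn ℝ (fun y => Q y a b) (halfBall m r)) (l : Fin (m + 1)) :
    (Matrix.of fun a b => pd r l (fun y => (P y * Q y) a b) x) =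
      (Matrix.of fun a b => pd r l (fun y => P y a b) x) * Q x +
      P x * (Matrix.of fun a b => pd r l (fun y => Q y a b) x) := by
  ext a b
  simp only [Matrix.of_apply, Matrix.add_apply, Matrix.mul_apply]
  rw [pd_sum hr hx (fun k _ => (hP a k).fun_mul (hQ k b)), ← Finset.sum_add_distrib]
  exact Finset.sum_congr rfl fun k _ => pd_mul hr hx (hP a k) (hQ k b)

/-- The commutator identity for two flat connections: covariant derivatives of a section `S` of
`Hom` between two flat bundles commute. With `κ` a point and `B = 0` this is the Ricci identity for
1-forms, with `B = A` the one for covariant 2-tensors. -/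
lemma flat_commute (hr : 0 < r) {κ ι : Type*} [Fintype κ] [Fintype ι]
    {S : Coord m → Matrix κ ι ℝ} {A : Fin (m + 1) → Coord m → Matrix ι ι ℝ}
    {B : Fin (m + 1) → Coord m → Matrix κ κ ℝ} {x : Coord m} (hx : x ∈ halfBall m r)
    (hS : ∀ a b, ContDiffOn ℝ 2 (fun y => S y a b) (halfBall m r))
    (hA : ∀ i a b, DifferentiableOn ℝ (fun y => A i y a b) (halfBall m r))
    (hB : ∀ i a b, DifferentiableOn ℝ (fun y => B i y a b) (halfBall m r))
    {l k : Fin (m + 1)}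
    (hAf : (Matrix.of fun a b => pd r l (fun y => A k y a b) x) =
      (Matrix.of fun a b => pd r k (fun y => A l y a b) x) + A k x * A l x - A l x * A k x)
    (hBf : (Matrix.of fun a b => pd r l (fun y => B k y a b) x) =
      (Matrix.of fun a b => pd r k (fun y => B l y a b) x) + B k x * B l x - B l x * B k x)
    {D : Fin (m + 1) → Coord m → Matrix κ ι ℝ}
    (hD : ∀ i, ∀ y, D i y = (Matrix.of fun a b => pd r i (fun z => S z a b) y)
      - (B i y).transpose * S y - S y * A i y) :
    (Matrix.of fun a b => pd r l (fun y => D k y a b) x)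
        - (B l x).transpose * D k x - D k x * A l x =
      (Matrix.of fun a b => pd r k (fun y => D l y a b) x)
        - (B k x).transpose * D l x - D l x * A k x := by
  have hSd : ∀ a b, DifferentiableOn ℝ (fun y => S y a b) (halfBall m r) := fun a b =>
    (hS a b).differentiableOn (by norm_num)
  have hSp : ∀ i a b, DifferentiableOn ℝ (pd r i (fun z => S z a b)) (halfBall m r) := fun i a b =>
    (contDiffOn_pd hr (k := 1) (hS a b) (by norm_num) i).differentiableOn (by norm_num)
  have hBS : ∀ i a b, DifferentiableOn ℝ (fun y => ((B i y).transpose * S y) a b)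
      (halfBall m r) := fun i a b => by
    simp only [Matrix.mul_apply]
    exact DifferentiableOn.fun_sum fun c _ => (hB i c a).mul (hSd c b)
  have hSA : ∀ i a b, DifferentiableOn ℝ (fun y => (S y * A i y) a b) (halfBall m r) :=
    fun i a b => by
      simp only [Matrix.mul_apply]
      exact DifferentiableOn.fun_sum fun c _ => (hSd a c).mul (hA i c b)
  have key : ∀ l k, (Matrix.of fun a b => pd r l (fun y => D k y a b) x) =
      (Matrix.of fun a b => pd r l (pd r k (fun z => S z a b)) x)
      - ((Matrix.of fun a b => pd r l (fun y => B k y a b) x).transpose * S x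
        + (B k x).transpose * (Matrix.of fun a b => pd r l (fun z => S z a b) x))
      - ((Matrix.of fun a b => pd r l (fun z => S z a b) x) * A k x
        + S x * (Matrix.of fun a b => pd r l (fun y => A k y a b) x)) := by
    intro l k
    rw [← pd_matrix_mul hr hx hSd (hA k)]
    have : (Matrix.of fun a b => pd r l (fun y => B k y a b) x).transpose =
        Matrix.of fun a b => pd r l (fun y => (B k y).transpose a b) x := rfl
    rw [this, ← pd_matrix_mul hr hx (P := fun y => (B k y).transpose) (fun a b => hB k b a) hSd]
    ext a b
    simp only [hD, Matrix.of_apply, Matrix.sub_apply]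
    rw [pd_sub hr hx ((hSp k a b).fun_sub (hBS k a b)) (hSA k a b), pd_sub hr hx (hSp k a b) (hBS k a b)]
  have hcomm : (Matrix.of fun a b => pd r l (pd r k (fun z => S z a b)) x) =
      (Matrix.of fun a b => pd r k (pd r l (fun z => S z a b)) x) := by
    ext a b
    exact pd_comm hr hx (hS a b)
  rw [key l k, key k l, hcomm, hAf, hBf, hD, hD]
  simp only [Matrix.transpose_sub, Matrix.transpose_add, Matrix.transpose_mul, Matrix.mul_sub,
    Matrix.sub_mul, Matrix.mul_add, Matrix.add_mul, Matrix.mul_assoc]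
  abel

/-- Flatness as the structure equation `∂_l Γ_k - ∂_k Γ_l = Γ_k Γ_l - Γ_l Γ_k` of the connection
matrices `(Γ_k)^a_b`. -/
lemma IsFlat.connection (hf : IsFlat r g) {x : Coord m}
    (hx : x ∈ halfBall m r) (l k : Fin (m + 1)) :
    (Matrix.of fun a b => pd r l (christoffel r g a k b) x) =
      (Matrix.of fun a b => pd r k (christoffel r g a l b) x)
      + (Matrix.of fun a b => christoffel r g a k b x) * (Matrix.of fun a b => christoffel r g a l b x)
      - (Matrix.of fun a b => christoffel r g a l b x)
        * (Matrix.of fun a b => christoffel r g a k b x) := by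
  ext a b
  have := hf x hx a b l k
  simp only [riemann, Finset.sum_sub_distrib] at this
  simp only [Matrix.of_apply, Matrix.add_apply, Matrix.sub_apply, Matrix.mul_apply]
  linarith

/-- Second covariant derivatives of a 1-form commute for a flat metric. -/
lemma cov2_cov1_symm (hr : 0 < r) (hg : IsFermiMetric r g) (hf : IsFlat r g)
    {S : Fin (m + 1) → Coord m → ℝ} (hS : ∀ i, ContDiffOn ℝ 2 (S i) (halfBall m r))
    {x : Coord m} (hx : x ∈ halfBall m r) (l k j : Fin (m + 1)) :
    cov2 r g (cov1 r g S) l k j x = cov2 r g (cov1 r g S) k l j x := by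
  have hΓ : ∀ i a b, DifferentiableOn ℝ (christoffel r g a i b) (halfBall m r) := fun i a b =>
    (hg.contDiffOn_christoffel hr a i b).differentiableOn (by simp)
  have h := flat_commute (r := r) hr (κ := Unit) (ι := Fin (m + 1)) (S := fun y => Matrix.of fun _ b => S b y)
    (A := fun i y => Matrix.of fun a b => christoffel r g a i b y) (B := fun _ _ => 0) hx
    (fun _ b => hS b) (fun i a b => hΓ i a b) (fun _ _ _ => differentiableOn_const _)
    (l := l) (k := k) (hf.connection hx l k)
    (by ext a b; simp [pd_const])
    (D := fun i y => Matrix.of fun _ b => cov1 r g S i b y)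
    (by
      intro i y
      ext a b
      simp [cov1, Matrix.mul_apply, mul_comm])
  have h' := congrFun (congrFun h ()) j
  simp only [Matrix.of_apply, Matrix.sub_apply, Matrix.mul_apply, Matrix.transpose_zero,
    Matrix.zero_apply, zero_mul, Finset.sum_const_zero, sub_zero] at h'
  unfold cov2
  have e : ∀ a b, (∑ p, cov1 r g S a p x * christoffel r g p b j x) =
    ∑ p, christoffel r g p b j x * cov1 r g S a p x := fun a b =>
      Finset.sum_congr rfl fun p _ => mul_comm _ _
  rw [e, e] at h'
  have e2 : ∑ p, christoffel r g p l k x * cov1 r g S p j x =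
      ∑ p, christoffel r g p k l x * cov1 r g S p j x :=
    Finset.sum_congr rfl fun p _ => by rw [hg.christoffel_symm hx]
  have e3 : ∀ a b, pd r a (cov1 r g S b j) x = pd r a (fun y => cov1 r g S b j y) x := fun _ _ => rfl
  rw [e2, e3, e3]
  linarith

/-- Second covariant derivatives of a covariant 2-tensor commute for a flat metric. -/
lemma cov3_cov2_symm (hr : 0 < r) (hg : IsFermiMetric r g) (hf : IsFlat r g)
    {S : Fin (m + 1) → Fin (m + 1) → Coord m → ℝ}
    (hS : ∀ i j, ContDiffOn ℝ 2 (S i j) (halfBall m r))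
    {x : Coord m} (hx : x ∈ halfBall m r) (l k i j : Fin (m + 1)) :
    cov3 r g (cov2 r g S) l k i j x = cov3 r g (cov2 r g S) k l i j x := by
  have hΓ : ∀ i a b, DifferentiableOn ℝ (christoffel r g a i b) (halfBall m r) := fun i a b =>
    (hg.contDiffOn_christoffel hr a i b).differentiableOn (by simp)
  have h := flat_commute (r := r) hr (κ := Fin (m + 1)) (ι := Fin (m + 1))
    (S := fun y => Matrix.of fun a b => S a b y)
    (A := fun i y => Matrix.of fun a b => christoffel r g a i b y)
    (B := fun i y => Matrix.of fun a b => christoffel r g a i b y) hx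
    (fun a b => hS a b) (fun i a b => hΓ i a b) (fun i a b => hΓ i a b)
    (l := l) (k := k) (hf.connection hx l k) (hf.connection hx l k)
    (D := fun i y => Matrix.of fun a b => cov2 r g S i a b y)
    (by
      intro i y
      ext a b
      simp only [cov2, Matrix.mul_apply, Matrix.of_apply, Matrix.sub_apply, Matrix.transpose_apply]
      congr 1
      exact Finset.sum_congr rfl fun p _ => mul_comm _ _)
  have h' := congrFun (congrFun h i) j
  simp only [Matrix.of_apply, Matrix.sub_apply, Matrix.mul_apply, Matrix.transpose_apply] at h'
  unfold cov3
  have e : ∀ a b, (∑ p, cov2 r g S a i p x * christoffel r g p b j x) =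
    ∑ p, christoffel r g p b j x * cov2 r g S a i p x := fun a b =>
      Finset.sum_congr rfl fun p _ => mul_comm _ _
  rw [e, e] at h'
  have e2 : ∑ p, christoffel r g p l k x * cov2 r g S p i j x =
      ∑ p, christoffel r g p k l x * cov2 r g S p i j x :=
    Finset.sum_congr rfl fun p _ => by rw [hg.christoffel_symm hx]
  have e3 : ∀ a b, pd r a (cov2 r g S b i j) x = pd r a (fun y => cov2 r g S b i j y) x :=
    fun _ _ => rfl
  rw [e2, e3, e3]
  linarith

end Tensor

/-! ### Concave symmetric functions of eigenvalues -/

section Eigen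

variable {N : ℕ}

lemma exists_perm_of_prod_eq {a b : Fin N → ℝ}
    (h : ∏ i, (Polynomial.X - Polynomial.C (a i)) = ∏ i, (Polynomial.X - Polynomial.C (b i))) :
    ∃ τ : Equiv.Perm (Fin N), a = b ∘ τ := by
  classical
  have h1 : Multiset.map a Finset.univ.val = Multiset.map b Finset.univ.val := by
    have := congrArg Polynomial.roots h
    have e : ∀ c : Fin N → ℝ, (∏ i, (Polynomial.X - Polynomial.C (c i))).roots
        = Multiset.map c Finset.univ.val := by
      intro c
      have := Polynomial.roots_multiset_prod_X_sub_C (Multiset.map c Finset.univ.val)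
      rw [Multiset.map_map] at this
      exact this
    rwa [e, e] at this
  have h2 : ∀ y, Fintype.card {i // a i = y} = Fintype.card {i // b i = y} := by
    intro y
    have := congrArg (Multiset.count y) h1
    rw [Multiset.count_map, Multiset.count_map] at this
    rw [Fintype.card_subtype, Fintype.card_subtype, Finset.card_def, Finset.card_def,
      Finset.filter_val, Finset.filter_val]
    simpa [eq_comm] using this
  let e : ∀ y, {i // a i = y} ≃ {i // b i = y} := fun y => Fintype.equivOfCardEq (h2 y)
  refine ⟨Equiv.ofFiberEquiv e, ?_⟩
  funext i
  exact (Equiv.ofFiberEquiv_map e i).symm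

lemma sigma_one (l : Fin N → ℝ) : sigma 1 l = ∑ i, l i := by
  unfold sigma
  rw [Finset.powersetCard_one, Finset.sum_map]
  simp

variable {ε : ℝ} {Γ : Set (Fin N → ℝ)} {F : (Fin N → ℝ) → ℝ}

lemma IsAdmissibleCone.sum_pos (hΓ : IsAdmissibleCone Γ) {l : Fin N → ℝ}
    (hl : l ∈ Γ) : 0 < ∑ i, l i := by
  rw [← sigma_one]
  exact hΓ.subset_posCone hl 1 le_rfl le_rfl

lemma IsAdmissibleCone.one_mem (hΓ : IsAdmissibleCone Γ) : (fun _ => (1 : ℝ)) ∈ Γ := by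
  apply hΓ.posCone_subset
  intro i _ hi
  unfold sigma
  simp only [Finset.prod_const_one, Finset.sum_const, Finset.card_powersetCard, nsmul_eq_mul,
    mul_one, Nat.cast_pos, Finset.card_univ, Fintype.card_fin]
  exact Nat.choose_pos hi

lemma IsAdmissibleFun.hasFDerivAt (hΓ : IsAdmissibleCone Γ) (hF : IsAdmissibleFun ε Γ F)
    {l : Fin N → ℝ} (hl : l ∈ Γ) : HasFDerivAt F (fderiv ℝ F l) l :=
  ((hF.smooth.differentiableOn (by simp)).differentiableAt (hΓ.isOpen.mem_nhds hl)).hasFDerivAt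

lemma fderiv_apply_eq_sum (l w : Fin N → ℝ) : fderiv ℝ F l w = ∑ i, dF F i l * w i := by
  have h2 : w = ∑ i, w i • (Pi.single i (1 : ℝ) : Fin N → ℝ) := by
    ext a
    simp [Finset.sum_apply, Pi.single_apply]
  have h3 := congrArg (fderiv ℝ F l) h2
  rw [h3]
  simp [dF, map_sum, mul_comm]

/-- Euler's identity. -/
lemma IsAdmissibleFun.euler (hΓ : IsAdmissibleCone Γ) (hF : IsAdmissibleFun ε Γ F)
    {l : Fin N → ℝ} (hl : l ∈ Γ) : ∑ i, dF F i l * l i = F l := by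
  rw [← fderiv_apply_eq_sum]
  have h1 : HasDerivAt (fun t : ℝ => F (t • l)) (fderiv ℝ F l l) 1 := by
    have hd : HasDerivAt (fun t : ℝ => t • l) ((1 : ℝ) • l) 1 := (hasDerivAt_id 1).smul_const l
    rw [one_smul] at hd
    have := (hF.hasFDerivAt hΓ hl)
    rw [← one_smul ℝ l] at this
    have h3 := this.comp_hasDerivAt (1 : ℝ) hd
    simp only [one_smul] at h3
    exact h3
  have h2 : HasDerivAt (fun t : ℝ => F (t • l)) (F l) 1 := by
    have : HasDerivAt (fun t : ℝ => t * F l) (1 * F l) 1 := (hasDerivAt_id 1).mul_const _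
    rw [one_mul] at this
    refine this.congr_of_eventuallyEq ?_
    filter_upwards [lt_mem_nhds (show (0 : ℝ) < 1 by norm_num)] with t ht
    exact hF.homog t ht l hl
  exact h1.unique h2

/-- The tangent plane of a concave function homogeneous of degree one supports it from above. -/
lemma IsAdmissibleFun.le_sum (hΓ : IsAdmissibleCone Γ) (hF : IsAdmissibleFun ε Γ F)
    {l₀ l : Fin N → ℝ} (hl₀ : l₀ ∈ Γ) (hl : l ∈ Γ) : F l ≤ ∑ i, dF F i l₀ * l i := by
  have hd : HasDerivAt (fun t : ℝ => F (l₀ + t • (l - l₀)))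
      (fderiv ℝ F l₀ (l - l₀)) 0 := by
    have hd : HasDerivAt (fun t : ℝ => l₀ + t • (l - l₀)) ((1 : ℝ) • (l - l₀)) 0 :=
      ((hasDerivAt_id 0).smul_const (l - l₀)).const_add l₀
    rw [one_smul] at hd
    have h := hF.hasFDerivAt hΓ hl₀
    have e : l₀ = l₀ + (0 : ℝ) • (l - l₀) := by simp
    rw [e] at h
    have h3 := h.comp_hasDerivAt (0 : ℝ) hd
    rw [← e] at h3
    exact h3
  have hs : ∀ t ∈ Set.Ioo (0 : ℝ) 1,
      F l - F l₀ ≤ slope (fun t : ℝ => F (l₀ + t • (l - l₀))) 0 t := by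
    intro t ht
    have := hF.concave.2 hl₀ hl (sub_nonneg.2 ht.2.le) ht.1.le (by ring)
    have e : (1 - t) • l₀ + t • l = l₀ + t • (l - l₀) := by
      module
    rw [e] at this
    simp only [slope_def_field, zero_smul, add_zero, sub_zero]
    rw [le_div_iff₀ ht.1]
    simp only [smul_eq_mul] at this
    linarith
  have hlim := hd.hasDerivWithinAt (s := Set.Ioi 0)
  rw [hasDerivWithinAt_iff_tendsto_slope' (by simp)] at hlim
  have := ge_of_tendsto hlim (by
    filter_upwards [Ioo_mem_nhdsGT (show (0 : ℝ) < 1 by norm_num)] with t ht using hs t ht)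
  rw [map_sub, fderiv_apply_eq_sum, fderiv_apply_eq_sum, hF.euler hΓ hl₀] at this
  linarith

lemma IsAdmissibleFun.one_le_sum (hΓ : IsAdmissibleCone Γ) (hF : IsAdmissibleFun ε Γ F)
    {l₀ : Fin N → ℝ} (hl₀ : l₀ ∈ Γ) : 1 ≤ ∑ i, dF F i l₀ := by
  have := hF.le_sum hΓ hl₀ hΓ.one_mem
  rw [hF.normalized] at this
  simpa using this

/-- The linearization at `l₀` of a concave symmetric function bounds it on the diagonal of any
symmetric matrix with admissible eigenvalues: the diagonal is an average of permutations of the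
eigenvalues, by Birkhoff's theorem. -/
lemma IsAdmissibleFun.le_sum_diag (hΓ : IsAdmissibleCone Γ) (hF : IsAdmissibleFun ε Γ F)
    {l₀ l : Fin N → ℝ} (hl₀ : l₀ ∈ Γ) (hl : l ∈ Γ) {A : Matrix (Fin N) (Fin N) ℝ}
    (hA : A.IsHermitian) (hAl : IsEigenvalues A l) : F l ≤ ∑ i, dF F i l₀ * A i i := by
  obtain ⟨τ, hτ⟩ := exists_perm_of_prod_eq (a := hA.eigenvalues) (b := l)
    (by rw [← hAl, hA.charpoly_eq]; simp)
  set U : Matrix (Fin N) (Fin N) ℝ := hA.eigenvectorUnitary.1 with hU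
  have hUU : U * star U = 1 := (Matrix.mem_unitaryGroup_iff).1 hA.eigenvectorUnitary.2
  have hUU' : star U * U = 1 := (Matrix.mem_unitaryGroup_iff').1 hA.eigenvectorUnitary.2
  have hspec : A = U * Matrix.diagonal hA.eigenvalues * star U := by
    have := hA.spectral_theorem
    simpa [Unitary.conjStarAlgAut_apply] using this
  have hdiag : ∀ i, A i i = ∑ j, U i j ^ 2 * hA.eigenvalues j := by
    intro i
    conv_lhs => rw [hspec]
    simp [Matrix.mul_apply, Matrix.diagonal_apply, Matrix.star_apply]
    exact Finset.sum_congr rfl fun j _ => by ring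
  set M : Matrix (Fin N) (Fin N) ℝ := Matrix.of fun i j => U i j ^ 2 with hM
  have hMd : M ∈ doublyStochastic ℝ (Fin N) := by
    rw [mem_doublyStochastic_iff_sum]
    refine ⟨fun i j => by simp [hM]; positivity, fun i => ?_, fun j => ?_⟩
    · have := congrFun (congrFun hUU i) i
      simp only [Matrix.mul_apply, Matrix.star_apply, Matrix.one_apply_eq] at this
      simpa [hM, pow_two] using this
    · have := congrFun (congrFun hUU' j) j
      simp only [Matrix.mul_apply, Matrix.star_apply, Matrix.one_apply_eq] at this
      simpa [hM, pow_two] using this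
  obtain ⟨w, hw0, hw1, hw⟩ := exists_eq_sum_perm_of_mem_doublyStochastic hMd
  have hdiag2 : ∀ i, A i i = ∑ σ, w σ * l (τ (σ i)) := by
    intro i
    have e : ∀ j, U i j ^ 2 = ∑ σ, w σ * (σ.permMatrix ℝ) i j := by
      intro j
      have := congrFun (congrFun hw i) j
      simp only [Matrix.sum_apply, Matrix.smul_apply, smul_eq_mul] at this
      rw [this]
      simp [hM]
    rw [hdiag]
    simp_rw [e, Finset.sum_mul]
    rw [Finset.sum_comm]
    refine Finset.sum_congr rfl fun σ _ => ?_
    simp_rw [mul_assoc]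
    rw [← Finset.mul_sum]
    congr 1
    rw [Finset.sum_eq_single (σ i)]
    · simp [Equiv.Perm.permMatrix, PEquiv.toMatrix_apply, hτ]
    · intro j _ hj
      simp [Equiv.Perm.permMatrix, PEquiv.toMatrix_apply, hj.symm]
    · simp
  have hσ : ∀ σ : Equiv.Perm (Fin N), F l ≤ ∑ i, dF F i l₀ * l (τ (σ i)) := by
    intro σ
    have h := hF.le_sum hΓ hl₀ (hΓ.perm_mem (σ.trans τ) l hl)
    rw [hF.symm _ l hl] at h
    exact h
  calc F l = ∑ σ, w σ * F l := by rw [← Finset.sum_mul, hw1, one_mul]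
    _ ≤ ∑ σ, w σ * ∑ i, dF F i l₀ * l (τ (σ i)) :=
        Finset.sum_le_sum fun σ _ => mul_le_mul_of_nonneg_left (hσ σ) (hw0 σ)
    _ = ∑ i, dF F i l₀ * A i i := by
        simp_rw [hdiag2, Finset.mul_sum]
        rw [Finset.sum_comm]
        exact Finset.sum_congr rfl fun i _ => Finset.sum_congr rfl fun σ _ => by ring

/-- The spectrum of a symmetric form `S` relative to a metric `G` is that of its matrix in an
orthonormal frame; the rows of `E` are the frame vectors. -/
lemma isEigenvalues_frame {G S E : Matrix (Fin N) (Fin N) ℝ} (hE : E * G * E.transpose = 1)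
    {l : Fin N → ℝ} (h : IsEigenvalues (G⁻¹ * S) l) : IsEigenvalues (E * S * E.transpose) l := by
  have hGinv : G⁻¹ = E.transpose * E := by
    have h1 : (E.transpose * E) * G = 1 := by
      have : E.transpose * (E * G) = 1 := by rw [← mul_eq_one_comm]; exact hE
      rw [Matrix.mul_assoc]; exact this
    exact Matrix.inv_eq_left_inv h1
  unfold IsEigenvalues at *
  rw [← h, hGinv, Matrix.charpoly_mul_comm, ← Matrix.mul_assoc]

/-- Simultaneous diagonalization of a metric and a symmetric form. -/
lemma exists_diagonal_frame {G S : Matrix (Fin N) (Fin N) ℝ} (hG : G.PosDef) (hS : S.IsHermitian) :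
    ∃ (E : Matrix (Fin N) (Fin N) ℝ) (l : Fin N → ℝ), E * G * E.transpose = 1 ∧
      E * S * E.transpose = Matrix.diagonal l := by
  have hdiag : ∀ {A : Matrix (Fin N) (Fin N) ℝ} (hA : A.IsHermitian),
      ∃ U : Matrix (Fin N) (Fin N) ℝ, U * U.transpose = 1 ∧
        U * A * U.transpose = Matrix.diagonal hA.eigenvalues := by
    intro A hA
    set U : Matrix (Fin N) (Fin N) ℝ := hA.eigenvectorUnitary.1 with hU
    have hUU' : star U * U = 1 := (Matrix.mem_unitaryGroup_iff').1 hA.eigenvectorUnitary.2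
    have hspec : A = U * Matrix.diagonal hA.eigenvalues * star U := by
      have := hA.spectral_theorem
      simpa [Unitary.conjStarAlgAut_apply] using this
    have ht : star U = U.transpose := by
      ext i j; simp [Matrix.star_apply]
    rw [ht] at hUU' hspec
    refine ⟨U.transpose, by simpa using hUU', ?_⟩
    conv_lhs => rw [hspec]
    rw [Matrix.transpose_transpose]
    calc U.transpose * (U * Matrix.diagonal hA.eigenvalues * U.transpose) * U
        = (U.transpose * U) * Matrix.diagonal hA.eigenvalues * (U.transpose * U) := by
          simp only [Matrix.mul_assoc]
      _ = _ := by rw [hUU']; simp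
  obtain ⟨U, hU, hUG⟩ := hdiag hG.isHermitian
  set d := hG.isHermitian.eigenvalues with hd
  have hdpos : ∀ i, 0 < d i := hG.eigenvalues_pos
  set Q : Matrix (Fin N) (Fin N) ℝ := Matrix.diagonal fun i => (Real.sqrt (d i))⁻¹ with hQ
  have hQt : Q.transpose = Q := by simp [hQ]
  have hQd : Q * Matrix.diagonal d * Q = 1 := by
    rw [hQ, Matrix.diagonal_mul_diagonal, Matrix.diagonal_mul_diagonal, ← Matrix.diagonal_one]
    congr 1
    funext i
    have h1 := Real.mul_self_sqrt (hdpos i).le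
    have h2 := (Real.sqrt_pos.2 (hdpos i)).ne'
    field_simp
    nlinarith
  set P := Q * U with hP
  have hPG : P * G * P.transpose = 1 := by
    rw [hP, Matrix.transpose_mul, hQt]
    calc Q * U * G * (U.transpose * Q) = Q * (U * G * U.transpose) * Q := by
          simp only [Matrix.mul_assoc]
      _ = 1 := by rw [hUG, hQd]
  have hPS : (P * S * P.transpose).IsHermitian := by
    have := Matrix.isHermitian_mul_mul_conjTranspose P hS
    simpa using this
  obtain ⟨R, hR, hRS⟩ := hdiag hPS
  refine ⟨R * P, hPS.eigenvalues, ?_, ?_⟩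
  · rw [Matrix.transpose_mul]
    calc R * P * G * (P.transpose * R.transpose) = R * (P * G * P.transpose) * R.transpose := by
          simp only [Matrix.mul_assoc]
      _ = 1 := by rw [hPG, Matrix.mul_one, hR]
  · rw [Matrix.transpose_mul, ← hRS]
    simp only [Matrix.mul_assoc]

end Eigen

/-! ### Parallel frames along geodesics -/

section Curves

variable {m : ℕ} {r : ℝ} {g : Coord m → Matrix (Fin (m + 1)) (Fin (m + 1)) ℝ}

/-- Components of a 1-tensor in the frame `E` whose vectors are `E a`. -/
def ev1 (S : Fin (m + 1) → Coord m → ℝ) (E : Fin (m + 1) → Fin (m + 1) → ℝ)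
    (a : Fin (m + 1)) (x : Coord m) : ℝ := ∑ i, S i x * E a i

/-- Components of a 2-tensor in the frame `E`. -/
def ev2 (S : Fin (m + 1) → Fin (m + 1) → Coord m → ℝ) (E : Fin (m + 1) → Fin (m + 1) → ℝ)
    (a b : Fin (m + 1)) (x : Coord m) : ℝ := ∑ j, (∑ i, S i j x * E a i) * E b j

/-- Components of a 3-tensor in the frame `E`. -/
def ev3 (S : Fin (m + 1) → Fin (m + 1) → Fin (m + 1) → Coord m → ℝ)
    (E : Fin (m + 1) → Fin (m + 1) → ℝ)
    (a b c : Fin (m + 1)) (x : Coord m) : ℝ := ∑ j, (∑ i, (∑ k, S k i j x * E a k) * E b i) * E c j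

/-- Components of a 4-tensor in the frame `E`. -/
def ev4 (S : Fin (m + 1) → Fin (m + 1) → Fin (m + 1) → Fin (m + 1) → Coord m → ℝ)
    (E : Fin (m + 1) → Fin (m + 1) → ℝ)
    (a b c d : Fin (m + 1)) (x : Coord m) : ℝ :=
  ∑ j, (∑ i, (∑ k, (∑ l, S l k i j x * E a l) * E b k) * E c i) * E d j

variable (r g)

/-- `E` is a parallel frame along the curve `γ` in the half ball, over the time set `I`, and the
velocity of `γ` is the frame vector `E c`; thus `γ` is a geodesic. -/
structure IsParallelFrame (γ : ℝ → Coord m) (E : ℝ → Fin (m + 1) → Fin (m + 1) → ℝ)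
    (c : Fin (m + 1)) (I : Set ℝ) : Prop where
  maps : MapsTo γ I (halfBall m r)
  velocity : ∀ t ∈ I, HasDerivWithinAt γ (WithLp.toLp 2 (E t c)) I t
  parallel : ∀ t ∈ I, ∀ a i, HasDerivWithinAt (fun s => E s a i)
    (-∑ q, (∑ p, christoffel r g i p q (γ t) * E t c p) * E t a q) I t

variable {r g}

/-- Contraction with a parallel vector `e` cancels the connection term of a covariant index. -/
lemma hasDerivWithinAt_contract {ι : Type*} [Fintype ι] {I : Set ℝ} {t : ℝ} {s : ι → ℝ → ℝ}
    {e : ι → ℝ → ℝ} {A : ι → ι → ℝ} {d : ι → ℝ}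
    (hs : ∀ i, HasDerivWithinAt (s i) ((∑ p, A p i * s p t) + d i) I t)
    (he : ∀ i, HasDerivWithinAt (e i) (-∑ q, A i q * e q t) I t) :
    HasDerivWithinAt (fun τ => ∑ i, s i τ * e i τ) (∑ i, d i * e i t) I t := by
  have h := HasDerivWithinAt.fun_sum (u := Finset.univ) fun i _ => (hs i).fun_mul (he i)
  refine h.congr_deriv ?_
  have e1 : ∑ i, s i t * ∑ q, A i q * e q t = ∑ i, (∑ p, A p i * s p t) * e i t := by
    simp_rw [Finset.mul_sum, Finset.sum_mul]
    rw [Finset.sum_comm]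
    exact Finset.sum_congr rfl fun i _ => Finset.sum_congr rfl fun q _ => by ring
  simp only [mul_neg, add_mul, Finset.sum_add_distrib, Finset.sum_neg_distrib]
  rw [e1]
  ring

variable {γ : ℝ → Coord m} {E : ℝ → Fin (m + 1) → Fin (m + 1) → ℝ} {c : Fin (m + 1)} {I : Set ℝ}

lemma IsParallelFrame.hasDeriv0 (h : IsParallelFrame r g γ E c I) {v : Coord m → ℝ}
    (hv : DifferentiableOn ℝ v (halfBall m r)) {t : ℝ} (ht : t ∈ I) :
    HasDerivWithinAt (fun s => v (γ s)) (ev1 (fun k => pd r k v) (E t) c (γ t)) I t :=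
  hasDerivWithinAt_comp_curve ht hv (h.velocity t ht) h.maps

lemma IsParallelFrame.hasDeriv1 (h : IsParallelFrame r g γ E c I)
    {S : Fin (m + 1) → Coord m → ℝ}
    (hS : ∀ i, DifferentiableOn ℝ (S i) (halfBall m r)) {t : ℝ} (ht : t ∈ I)
    (a : Fin (m + 1)) :
    HasDerivWithinAt (fun s => ev1 S (E s) a (γ s)) (ev2 (cov1 r g S) (E t) c a (γ t)) I t := by
  refine hasDerivWithinAt_contract (fun i => ?_) (fun i => h.parallel t ht a i)
  have h0 := h.hasDeriv0 (hS i) ht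
  convert h0 using 1
  simp only [ev1, cov1, sub_mul, Finset.sum_sub_distrib, Finset.sum_mul]
  rw [Finset.sum_comm]
  have : ∑ k, ∑ p, christoffel r g p k i (γ t) * S p (γ t) * E t c k =
    ∑ k, ∑ p, christoffel r g p k i (γ t) * E t c k * S p (γ t) :=
    Finset.sum_congr rfl fun _ _ => Finset.sum_congr rfl fun _ _ => by ring
  rw [this]
  ring

lemma IsParallelFrame.hasDeriv2 (h : IsParallelFrame r g γ E c I)
    {S : Fin (m + 1) → Fin (m + 1) → Coord m → ℝ}
    (hS : ∀ i j, DifferentiableOn ℝ (S i j) (halfBall m r)) {t : ℝ} (ht : t ∈ I)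
    (a b : Fin (m + 1)) :
    HasDerivWithinAt (fun s => ev2 S (E s) a b (γ s)) (ev3 (cov2 r g S) (E t) c a b (γ t)) I t := by
  refine hasDerivWithinAt_contract (fun j => ?_) (fun i => h.parallel t ht b i)
  have key : HasDerivWithinAt (fun s => ∑ i, S i j (γ s) * E s a i)
      (∑ i, ((∑ k, cov2 r g S k i j (γ t) * E t c k) +
        ∑ p, (∑ k, christoffel r g p k j (γ t) * E t c k) * S i p (γ t)) * E t a i) I t := by
    refine hasDerivWithinAt_contract (fun i => ?_) (fun i => h.parallel t ht a i)
    have h0 := h.hasDeriv0 (hS i j) ht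
    convert h0 using 1
    simp only [ev1, cov2, sub_mul, Finset.sum_sub_distrib, Finset.sum_mul]
    rw [Finset.sum_comm]
    rw [Finset.sum_comm (f := fun p k => christoffel r g p k j (γ t) * E t c k * S i p (γ t))]
    have e1 : ∑ k, ∑ p, christoffel r g p k i (γ t) * S p j (γ t) * E t c k =
      ∑ k, ∑ p, christoffel r g p k i (γ t) * E t c k * S p j (γ t) :=
      Finset.sum_congr rfl fun _ _ => Finset.sum_congr rfl fun _ _ => by ring
    have e2 : ∑ k, ∑ p, christoffel r g p k j (γ t) * S i p (γ t) * E t c k =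
      ∑ k, ∑ p, christoffel r g p k j (γ t) * E t c k * S i p (γ t) :=
      Finset.sum_congr rfl fun _ _ => Finset.sum_congr rfl fun _ _ => by ring
    rw [e1, e2]
    ring
  convert key using 1
  simp only [add_mul, Finset.sum_add_distrib]
  rw [add_comm]
  congr 1
  simp only [Finset.mul_sum, Finset.sum_mul]
  rw [Finset.sum_comm]
  refine Finset.sum_congr rfl fun _ _ => Finset.sum_congr rfl fun _ _ =>
    Finset.sum_congr rfl fun _ _ => by ring

lemma IsParallelFrame.hasDeriv3 (h : IsParallelFrame r g γ E c I)
    {S : Fin (m + 1) → Fin (m + 1) → Fin (m + 1) → Coord m → ℝ}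
    (hS : ∀ k i j, DifferentiableOn ℝ (S k i j) (halfBall m r)) {t : ℝ} (ht : t ∈ I)
    (d a b : Fin (m + 1)) :
    HasDerivWithinAt (fun s => ev3 S (E s) d a b (γ s))
      (ev4 (cov3 r g S) (E t) c d a b (γ t)) I t := by
  refine hasDerivWithinAt_contract (fun j => ?_) (fun i => h.parallel t ht b i)
  have key : ∀ i, HasDerivWithinAt (fun s => ∑ k, S k i j (γ s) * E s d k)
      (∑ k, ((∑ l, cov3 r g S l k i j (γ t) * E t c l) +
        ∑ p, (∑ l, christoffel r g p l i (γ t) * E t c l) * S k p j (γ t) +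
        ∑ p, (∑ l, christoffel r g p l j (γ t) * E t c l) * S k i p (γ t)) * E t d k) I t := by
    intro i
    refine hasDerivWithinAt_contract (fun k => ?_) (fun i => h.parallel t ht d i)
    have h0 := h.hasDeriv0 (hS k i j) ht
    convert h0 using 1
    simp only [ev1, cov3, sub_mul, Finset.sum_sub_distrib, Finset.sum_mul]
    rw [Finset.sum_comm]
    rw [Finset.sum_comm (f := fun p l => christoffel r g p l i (γ t) * E t c l * S k p j (γ t)),
      Finset.sum_comm (f := fun p l => christoffel r g p l j (γ t) * E t c l * S k i p (γ t))]
    have e0 : ∑ l, ∑ p, christoffel r g p l k (γ t) * S p i j (γ t) * E t c l =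
      ∑ l, ∑ p, christoffel r g p l k (γ t) * E t c l * S p i j (γ t) :=
      Finset.sum_congr rfl fun _ _ => Finset.sum_congr rfl fun _ _ => by ring
    have e1 : ∑ l, ∑ p, christoffel r g p l i (γ t) * S k p j (γ t) * E t c l =
      ∑ l, ∑ p, christoffel r g p l i (γ t) * E t c l * S k p j (γ t) :=
      Finset.sum_congr rfl fun _ _ => Finset.sum_congr rfl fun _ _ => by ring
    have e2 : ∑ l, ∑ p, christoffel r g p l j (γ t) * S k i p (γ t) * E t c l =
      ∑ l, ∑ p, christoffel r g p l j (γ t) * E t c l * S k i p (γ t) :=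
      Finset.sum_congr rfl fun _ _ => Finset.sum_congr rfl fun _ _ => by ring
    rw [e0, e1, e2]
    ring
  have key2 : HasDerivWithinAt (fun s => ∑ i, (∑ k, S k i j (γ s) * E s d k) * E s a i)
      (∑ i, (∑ k, ((∑ l, cov3 r g S l k i j (γ t) * E t c l) +
        ∑ p, (∑ l, christoffel r g p l j (γ t) * E t c l) * S k i p (γ t)) * E t d k) * E t a i)
      I t := by
    refine hasDerivWithinAt_contract (fun i => ?_) (fun i => h.parallel t ht a i)
    convert key i using 1
    simp only [add_mul, Finset.sum_add_distrib]
    have : ∑ p, (∑ k, christoffel r g p k i (γ t) * E t c k) * ∑ k, S k p j (γ t) * E t d k =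
        ∑ x, (∑ p, (∑ l, christoffel r g p l i (γ t) * E t c l) * S x p j (γ t)) * E t d x := by
      simp only [Finset.mul_sum, Finset.sum_mul]
      rw [Finset.sum_comm]
      exact Finset.sum_congr rfl fun _ _ => Finset.sum_congr rfl fun _ _ =>
        Finset.sum_congr rfl fun _ _ => by ring
    rw [this]
    ring
  convert key2 using 1
  simp only [add_mul, Finset.sum_add_distrib]
  rw [add_comm]
  congr 1
  simp only [Finset.mul_sum, Finset.sum_mul]
  rw [Finset.sum_comm]
  refine Finset.sum_congr rfl fun i _ => ?_
  rw [Finset.sum_comm]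
  refine Finset.sum_congr rfl fun _ _ => Finset.sum_congr rfl fun _ _ =>
    Finset.sum_congr rfl fun _ _ => by ring

/-- Parallel frames keep their inner products. -/
lemma IsParallelFrame.ev2_metric (hg : IsFermiMetric r g) (h : IsParallelFrame r g γ E c I)
    (hI : Convex ℝ I) {s t : ℝ} (hs : s ∈ I) (ht : t ∈ I) (a b : Fin (m + 1)) :
    ev2 (fun i j x => g x i j) (E t) a b (γ t) = ev2 (fun i j x => g x i j) (E s) a b (γ s) := by
  have hd : ∀ τ ∈ I, HasDerivWithinAt
      (fun s => ev2 (fun i j x => g x i j) (E s) a b (γ s)) 0 I τ := by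
    intro τ hτ
    have h2 := h.hasDeriv2 (S := fun i j x => g x i j)
      (fun i j => (hg.smooth i j).differentiableOn (by simp)) hτ a b
    convert h2 using 1
    have : ∀ k i j, cov2 r g (fun i j x => g x i j) k i j (γ τ) = 0 := by
      intro k i j
      have := hg.pd_metric (h.maps hτ) k i j
      unfold cov2
      rw [this]
      ring
    simp [ev3, this]
  have := hI.norm_image_sub_le_of_norm_hasDerivWithin_le hd (C := 0) (by simp) hs ht
  rw [zero_mul, norm_le_zero_iff, sub_eq_zero] at this
  exact this

/-- Geodesics with a parallel frame exist for short time at interior points. -/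
lemma exists_parallelFrame_interior (hr : 0 < r) (hg : IsFermiMetric r g) {x₀ : Coord m}
    (h0 : 0 < x₀ (Fin.last m)) (h1 : ∑ i, x₀ i ^ 2 < r ^ 2)
    (E₀ : Fin (m + 1) → Fin (m + 1) → ℝ) (c : Fin (m + 1)) :
    ∃ (γ : ℝ → Coord m) (E : ℝ → Fin (m + 1) → Fin (m + 1) → ℝ), ∃ δ > 0,
      γ 0 = x₀ ∧ E 0 = E₀ ∧ IsParallelFrame r g γ E c (Ioo (-δ) δ) := by
  have hB := mem_nhds_halfBall h0 h1
  set X : Coord m × (Fin (m + 1) → Fin (m + 1) → ℝ) → Coord m × (Fin (m + 1) → Fin (m + 1) → ℝ) :=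
    fun z => (WithLp.toLp 2 (z.2 c), fun a i =>
      -∑ q, (∑ p, christoffel r g i p q z.1 * z.2 c p) * z.2 a q) with hX
  have hXd : ContDiffAt ℝ 1 X (x₀, E₀) := by
    have hc : ∀ a i, ContDiff ℝ 1
        (fun z : Coord m × (Fin (m + 1) → Fin (m + 1) → ℝ) => z.2 a i) := by
      intro a i
      fun_prop
    have hΓ : ∀ i p q, ContDiffAt ℝ 1
        (fun z : Coord m × (Fin (m + 1) → Fin (m + 1) → ℝ) => christoffel r g i p q z.1) (x₀, E₀) := by
      intro i p q
      have h2 : ContDiffAt ℝ 1 (christoffel r g i p q) x₀ :=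
        ((hg.contDiffOn_christoffel hr i p q).contDiffAt hB).of_le (by exact_mod_cast le_top)
      exact ContDiffAt.comp (x₀, E₀) (f := Prod.fst) h2 contDiffAt_fst
    refine ContDiffAt.prodMk ?_ ?_
    · refine ContDiff.contDiffAt ?_
      rw [contDiff_euclidean]
      exact fun i => hc c i
    · rw [contDiffAt_pi]
      intro a
      rw [contDiffAt_pi]
      intro i
      refine ContDiffAt.neg (ContDiffAt.sum fun q _ => ContDiffAt.mul
        (ContDiffAt.sum fun p _ => (hΓ i p q).mul (hc c p).contDiffAt) (hc a q).contDiffAt)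
  obtain ⟨α, hα0, δ, hδ, hα⟩ :=
    hXd.exists_forall_mem_closedBall_exists_eq_forall_mem_Ioo_hasDerivAt₀ 0
  simp only [zero_sub, zero_add] at hα
  have hcont : ContinuousAt α 0 := (hα 0 ⟨by linarith, hδ⟩).continuousAt
  have hev : ∀ᶠ t in 𝓝 (0 : ℝ), (α t).1 ∈ halfBall m r := by
    have : ContinuousAt (fun t => (α t).1) 0 := hcont.fst
    apply this
    simp only [hα0]
    exact hB
  obtain ⟨δ', hδ', hball⟩ := Metric.eventually_nhds_iff_ball.1 hev
  refine ⟨fun t => (α t).1, fun t => (α t).2, min δ δ', lt_min hδ hδ', by simp [hα0],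
    by simp [hα0], ⟨?_, ?_, ?_⟩⟩
  · intro t ht
    apply hball
    rw [Metric.mem_ball, Real.dist_eq, sub_zero, abs_lt]
    exact ⟨by linarith [ht.1, min_le_right δ δ'], by linarith [ht.2, min_le_right δ δ']⟩
  · intro t ht
    have := hα t ⟨by linarith [ht.1, min_le_left δ δ'], by linarith [ht.2, min_le_left δ δ']⟩
    have h2 := (hasFDerivAt_fst (𝕜 := ℝ) (p := α t)).comp_hasDerivAt t this
    exact h2.hasDerivWithinAt
  · intro t ht a i
    have := hα t ⟨by linarith [ht.1, min_le_left δ δ'], by linarith [ht.2, min_le_left δ δ']⟩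
    have h2 := (hasFDerivAt_snd (𝕜 := ℝ) (p := α t)).comp_hasDerivAt t this
    have h3 := hasDerivAt_pi.1 (hasDerivAt_pi.1 h2 a) i
    exact h3.hasDerivWithinAt

lemma IsFermiMetric.last_eq (hg : IsFermiMetric r g) {x : Coord m} (hx : x ∈ halfBall m r)
    (i : Fin (m + 1)) : g x i (Fin.last m) = if i = Fin.last m then 1 else 0 := by
  refine Fin.lastCases ?_ (fun a => ?_) i
  · simp [hg.normal x hx]
  · simp [hg.mixed x hx a, (Fin.castSucc_lt_last a).ne]

lemma IsFermiMetric.pd_last (hg : IsFermiMetric r g) {x : Coord m} (hx : x ∈ halfBall m r)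
    (k i : Fin (m + 1)) : pd r k (fun y => g y i (Fin.last m)) x = 0 := by
  rw [pd_congr (w := fun _ => if i = Fin.last m then 1 else 0) hx (fun y hy => hg.last_eq hy i),
    pd_const]

lemma IsFermiMetric.pd_last' (hg : IsFermiMetric r g) {x : Coord m} (hx : x ∈ halfBall m r)
    (k i : Fin (m + 1)) : pd r k (fun y => g y (Fin.last m) i) x = 0 := by
  rw [pd_congr (w := fun y => g y i (Fin.last m)) hx (fun y hy => hg.symm hy _ _),
    hg.pd_last hx]

/-- The normal coordinate lines are geodesics. -/
lemma IsFermiMetric.christoffel_last_last (hg : IsFermiMetric r g) {x : Coord m}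
    (hx : x ∈ halfBall m r) (k : Fin (m + 1)) :
    christoffel r g k (Fin.last m) (Fin.last m) x = 0 := by
  unfold christoffel
  simp [hg.pd_last hx, hg.pd_last' hx]

/-- Parallel frames exist for short time along the normal geodesic from a boundary point. -/
lemma exists_parallelFrame_boundary (hr : 0 < r) (hg : IsFermiMetric r g) {x₀ : Coord m}
    (h0 : x₀ (Fin.last m) = 0) (h1 : ∑ i, x₀ i ^ 2 < r ^ 2)
    (E₀ : Fin (m + 1) → Fin (m + 1) → ℝ) (hE₀ : E₀ (Fin.last m) = Pi.single (Fin.last m) 1) :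
    ∃ (γ : ℝ → Coord m) (E : ℝ → Fin (m + 1) → Fin (m + 1) → ℝ), ∃ δ > 0,
      γ 0 = x₀ ∧ E 0 = E₀ ∧ IsParallelFrame r g γ E (Fin.last m) (Icc 0 δ) := by
  set γ : ℝ → Coord m := fun t => x₀ + t • EuclideanSpace.single (Fin.last m) 1 with hγ
  have hγd : ∀ t, HasDerivAt γ (EuclideanSpace.single (Fin.last m) 1) t := by
    intro t
    have := ((hasDerivAt_id t).smul_const
      (EuclideanSpace.single (Fin.last m) 1 : Coord m)).const_add x₀
    rw [one_smul] at this
    exact this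
  have hγc : Continuous γ := continuous_iff_continuousAt.2 fun t => (hγd t).continuousAt
  obtain ⟨δ₁, hδ₁, hball⟩ : ∃ δ > 0, MapsTo γ (Icc 0 δ) (halfBall m r) := by
    have hc : Continuous fun t => ∑ i, γ t i ^ 2 := by fun_prop
    have hev : ∀ᶠ t in 𝓝 (0 : ℝ), ∑ i, γ t i ^ 2 < r ^ 2 := by
      refine hc.continuousAt.eventually_lt_const ?_
      simpa [hγ] using h1
    obtain ⟨δ, hδ, hb⟩ := Metric.eventually_nhds_iff_ball.1 hev
    refine ⟨δ / 2, by positivity, fun t ht => ⟨?_, (hb t ?_).le⟩⟩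
    · simp [hγ, h0, ht.1]
    · rw [Metric.mem_ball, Real.dist_eq, sub_zero, abs_lt]
      exact ⟨by linarith [ht.1], by linarith [ht.2]⟩
  obtain ⟨M, hM0, hM⟩ : ∃ M : ℝ, 0 ≤ M ∧ ∀ x ∈ halfBall m r, ∀ i q,
      |christoffel r g i (Fin.last m) q x| ≤ M := by
    have hb : ∀ i q, ∃ M : ℝ, ∀ x ∈ halfBall m r, |christoffel r g i (Fin.last m) q x| ≤ M := by
      intro i q
      obtain ⟨M, hM⟩ := (isCompact_halfBall (m := m) hr).exists_bound_of_continuousOn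
        (hg.contDiffOn_christoffel hr i (Fin.last m) q).continuousOn
      exact ⟨M, hM⟩
    choose M hM using hb
    refine ⟨∑ i, ∑ q, |M i q|, by positivity, fun x hx i q => (hM i q x hx).trans ?_⟩
    refine (le_abs_self _).trans ?_
    refine (Finset.single_le_sum (f := fun q => |M i q|) (fun _ _ => abs_nonneg _)
      (Finset.mem_univ q)).trans ?_
    exact Finset.single_le_sum (f := fun i => ∑ q, |M i q|)
      (fun _ _ => Finset.sum_nonneg fun _ _ => abs_nonneg _) (Finset.mem_univ i)
  set f : ℝ → (Fin (m + 1) → Fin (m + 1) → ℝ) → (Fin (m + 1) → Fin (m + 1) → ℝ) :=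
    fun t E a i => -∑ q, christoffel r g i (Fin.last m) q (γ t) * E a q with hf
  have hfb : ∀ t ∈ Icc 0 δ₁, ∀ E, ‖f t E‖ ≤ ((m + 1 : ℝ) * M) * ‖E‖ := by
    intro t ht E
    rw [pi_norm_le_iff_of_nonneg (by positivity)]
    intro a
    rw [pi_norm_le_iff_of_nonneg (by positivity)]
    intro i
    simp only [hf, norm_neg]
    refine (norm_sum_le _ _).trans ?_
    calc ∑ q, ‖christoffel r g i (Fin.last m) q (γ t) * E a q‖ ≤ ∑ _q : Fin (m + 1), M * ‖E‖ := by
          refine Finset.sum_le_sum fun q _ => ?_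
          rw [norm_mul]
          refine mul_le_mul (hM _ (hball ht) _ _) ?_ (norm_nonneg _) hM0
          exact (norm_le_pi_norm (E a) q).trans (norm_le_pi_norm E a)
      _ = _ := by simp; ring
  have hfsub : ∀ t E E', f t E - f t E' = f t (E - E') := by
    intro t E E'
    ext a i
    simp only [hf, Pi.sub_apply, mul_sub, Finset.sum_sub_distrib]
    ring
  set L : ℝ := ((m + 1 : ℝ) * M) * (‖E₀‖ + 1) with hL
  have hL0 : 0 ≤ L := by positivity
  set δ : ℝ := min δ₁ (1 / (L + 1)) with hδdef
  have hδ : 0 < δ := lt_min hδ₁ (by positivity)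
  have hsub : Icc 0 δ ⊆ Icc 0 δ₁ := Icc_subset_Icc_right (min_le_left _ _)
  have hPL : IsPicardLindelof f (tmin := 0) (tmax := δ) ⟨0, le_rfl, hδ.le⟩ E₀ 1 0
      ⟨L, hL0⟩ ⟨(m + 1 : ℝ) * M, by positivity⟩ := by
    refine ⟨fun t ht => ?_, fun E _ => ?_, fun t ht E hE => ?_, ?_⟩
    · refine LipschitzOnWith.of_dist_le_mul fun E _ E' _ => ?_
      rw [dist_eq_norm, dist_eq_norm, hfsub]
      exact hfb t (hsub ht) _
    · refine continuousOn_pi.2 fun a => continuousOn_pi.2 fun i => ?_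
      refine ContinuousOn.neg (continuousOn_finsetSum _ fun q _ => ContinuousOn.mul ?_
        continuousOn_const)
      exact (hg.contDiffOn_christoffel hr i (Fin.last m) q).continuousOn.comp hγc.continuousOn
        (hball.mono_left hsub)
    · refine (hfb t (hsub ht) E).trans ?_
      refine mul_le_mul_of_nonneg_left ?_ (by positivity)
      have : ‖E - E₀‖ ≤ 1 := by simpa [dist_eq_norm] using hE
      linarith [norm_le_norm_add_norm_sub' E E₀]
    · have h3 : L * δ ≤ 1 := by
        have : δ ≤ 1 / (L + 1) := min_le_right _ _
        calc L * δ ≤ L * (1 / (L + 1)) := mul_le_mul_of_nonneg_left this hL0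
          _ ≤ 1 := by rw [mul_one_div, div_le_one (by positivity)]; linarith
      simp only [sub_zero, sub_self]
      rw [max_eq_left hδ.le]
      show L * δ ≤ ((1 : NNReal) : ℝ) - ((0 : NNReal) : ℝ)
      simpa using h3
  obtain ⟨α, hα0, hα⟩ := hPL.exists_eq_forall_mem_Icc_hasDerivWithinAt₀
  refine ⟨γ, fun t a => if a = Fin.last m then Pi.single (Fin.last m) 1 else α t a, δ, hδ,
    by simp [hγ], ?_, ⟨hball.mono_left hsub, fun t ht => ?_, fun t ht a i => ?_⟩⟩
  · funext a
    simp only at hα0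
    by_cases ha : a = Fin.last m
    · simp [ha, hE₀]
    · simp [ha, hα0]
  · have := (hγd t).hasDerivWithinAt (s := Icc 0 δ)
    simpa using this
  · have hsum : ∀ q, ∑ p, christoffel r g i p q (γ t) *
        (if Fin.last m = Fin.last m then Pi.single (Fin.last m) (1 : ℝ) else α t (Fin.last m)) p
        = christoffel r g i (Fin.last m) q (γ t) := by
      intro q
      simp [Pi.single_apply]
    rw [Finset.sum_congr rfl fun q _ => by rw [hsum q]]
    by_cases ha : a = Fin.last m
    · subst ha
      have h0 : -∑ q, christoffel r g i (Fin.last m) q (γ t) *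
          (Pi.single (Fin.last m) (1 : ℝ) : Fin (m + 1) → ℝ) q = 0 := by
        simp [Pi.single_apply, hg.christoffel_last_last (hball (hsub ht))]
      simp only [if_true]
      rw [h0]
      exact hasDerivWithinAt_const _ _ _
    · simp only [ha, if_false]
      have := hα t ht
      rw [hasDerivWithinAt_pi] at this
      have := this a
      rw [hasDerivWithinAt_pi] at this
      exact this i

end Curves

/-! ### Tensors in orthonormal frames -/

section Frames

variable {m : ℕ} {r : ℝ} {g : Coord m → Matrix (Fin (m + 1)) (Fin (m + 1)) ℝ}

/-- The vectors `E a` form an orthonormal basis at `x`. -/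
def IsOrtho (g : Coord m → Matrix (Fin (m + 1)) (Fin (m + 1)) ℝ) (x : Coord m)
    (E : Fin (m + 1) → Fin (m + 1) → ℝ) : Prop :=
  ∀ a b, ev2 (fun i j y => g y i j) E a b x = if a = b then 1 else 0

lemma ev2_eq_matrix (S : Fin (m + 1) → Fin (m + 1) → Coord m → ℝ)
    (E : Matrix (Fin (m + 1)) (Fin (m + 1)) ℝ) (a b : Fin (m + 1)) (x : Coord m) :
    ev2 S E a b x = (E * (Matrix.of fun i j => S i j x) * E.transpose) a b := by
  simp only [ev2, Matrix.mul_apply, Matrix.of_apply, Matrix.transpose_apply]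
  exact Finset.sum_congr rfl fun j _ => by
    congr 1; exact Finset.sum_congr rfl fun i _ => mul_comm _ _

variable {x : Coord m} {E : Fin (m + 1) → Fin (m + 1) → ℝ}

lemma IsOrtho.mul_eq_one (h : IsOrtho g x E) :
    (Matrix.of E) * g x * (Matrix.of E).transpose = 1 := by
  ext a b
  have := ev2_eq_matrix (fun i j y => g y i j) (Matrix.of E) a b x
  have h2 := h a b
  rw [Matrix.one_apply, ← h2]
  exact this.symm

lemma isOrtho_of_mul_eq_one {E : Matrix (Fin (m + 1)) (Fin (m + 1)) ℝ}
    (h : E * g x * E.transpose = 1) : IsOrtho g x E := by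
  intro a b
  have := ev2_eq_matrix (fun i j y => g y i j) E a b x
  rw [this, ← Matrix.one_apply, ← h]
  rfl

lemma IsOrtho.inv_eq (h : IsOrtho g x E) : (g x)⁻¹ = (Matrix.of E).transpose * Matrix.of E := by
  refine Matrix.inv_eq_left_inv ?_
  have : (Matrix.of E).transpose * (Matrix.of E * g x) = 1 := by
    rw [← mul_eq_one_comm]; exact h.mul_eq_one
  rw [Matrix.mul_assoc]; exact this

lemma IsOrtho.inv_apply (h : IsOrtho g x E) (i j : Fin (m + 1)) :
    (g x)⁻¹ i j = ∑ a, E a i * E a j := by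
  rw [h.inv_eq]
  simp [Matrix.mul_apply]

lemma IsOrtho.gradSq_eq (h : IsOrtho g x E) (u : Coord m → ℝ) :
    gradSq r g u x = ∑ a, ev1 (fun i => pd r i u) E a x ^ 2 := by
  unfold gradSq ev1
  simp_rw [h.inv_apply, pow_two, Finset.sum_mul_sum, Finset.sum_mul]
  rw [Finset.sum_comm (s := Finset.univ (α := Fin (m + 1))) (t := Finset.univ)
    (f := fun a i => ∑ j, pd r i u x * E a i * (pd r j u x * E a j))]
  refine Finset.sum_congr rfl fun i _ => ?_
  rw [Finset.sum_comm]
  refine Finset.sum_congr rfl fun j _ => Finset.sum_congr rfl fun a _ => by ring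

lemma IsOrtho.hessNorm_eq (h : IsOrtho g x E) (u : Coord m → ℝ) :
    hessNorm r g u x =
      Real.sqrt (∑ a, ∑ b, ev2 (cov1 r g fun i => pd r i u) E a b x ^ 2) := by
  unfold hessNorm
  congr 1
  set H : Matrix (Fin (m + 1)) (Fin (m + 1)) ℝ :=
    Matrix.of fun i j => cov1 r g (fun i => pd r i u) i j x with hH
  have hHe : ∀ i j, covHess r g u x i j = H i j := fun i j => rfl
  set A := Matrix.of E * H * (Matrix.of E).transpose with hA
  have h1 : ∑ a, ∑ b, ev2 (cov1 r g fun i => pd r i u) E a b x ^ 2 = (A * A.transpose).trace := by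
    simp only [Matrix.trace, Matrix.diag_apply, Matrix.mul_apply (M := A), Matrix.transpose_apply]
    refine Finset.sum_congr rfl fun a _ => Finset.sum_congr rfl fun b _ => ?_
    have : ev2 (cov1 r g fun i => pd r i u) E a b x = A a b :=
      ev2_eq_matrix (cov1 r g fun i => pd r i u) (Matrix.of E) a b x
    rw [this, pow_two]
  have h2 : (A * A.transpose).trace = ((g x)⁻¹ * H * (g x)⁻¹ * H.transpose).trace := by
    rw [h.inv_eq, hA]
    simp only [Matrix.transpose_mul, Matrix.transpose_transpose]
    calc _ = (Matrix.of E * (H * (Matrix.of E).transpose * Matrix.of E * H.transpose)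
          * (Matrix.of E).transpose).trace := by simp only [Matrix.mul_assoc]
      _ = _ := by
        rw [Matrix.trace_mul_comm]
        simp only [Matrix.mul_assoc]
  rw [h1, h2]
  simp only [hHe, Matrix.trace, Matrix.diag_apply, Matrix.mul_apply, Matrix.transpose_apply,
    Finset.sum_mul]
  have hs : ∀ i j, (g x)⁻¹ i j = (g x)⁻¹ j i := by
    intro i j
    rw [h.inv_apply, h.inv_apply]
    exact Finset.sum_congr rfl fun _ _ => mul_comm _ _
  have e1 : ∀ i j k l, (g x)⁻¹ i k * (g x)⁻¹ j l * H i j * H k l =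
      (g x)⁻¹ k i * H i j * (g x)⁻¹ j l * H k l := by
    intro i j k l
    rw [hs i k]; ring
  simp_rw [e1]
  rw [Finset.sum_congr rfl fun i _ => Finset.sum_comm]
  rw [Finset.sum_comm]
  refine Finset.sum_congr rfl fun k _ => ?_
  rw [Finset.sum_congr rfl fun i _ => Finset.sum_comm]
  rw [Finset.sum_comm]
  refine Finset.sum_congr rfl fun l _ => ?_
  rw [Finset.sum_comm]

lemma ev2_add (S S' : Fin (m + 1) → Fin (m + 1) → Coord m → ℝ) (a b : Fin (m + 1)) :
    ev2 (fun i j y => S i j y + S' i j y) E a b x = ev2 S E a b x + ev2 S' E a b x := by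
  simp only [ev2, add_mul, Finset.sum_add_distrib]

lemma ev2_sub (S S' : Fin (m + 1) → Fin (m + 1) → Coord m → ℝ) (a b : Fin (m + 1)) :
    ev2 (fun i j y => S i j y - S' i j y) E a b x = ev2 S E a b x - ev2 S' E a b x := by
  simp only [ev2, sub_mul, Finset.sum_sub_distrib]

lemma ev2_smul (c : Coord m → ℝ) (S : Fin (m + 1) → Fin (m + 1) → Coord m → ℝ)
    (a b : Fin (m + 1)) :
    ev2 (fun i j y => c y * S i j y) E a b x = c x * ev2 S E a b x := by
  simp only [ev2, Finset.mul_sum, Finset.sum_mul]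
  exact Finset.sum_congr rfl fun j _ => Finset.sum_congr rfl fun i _ => by ring

lemma ev2_mul (S S' : Fin (m + 1) → Coord m → ℝ) (a b : Fin (m + 1)) :
    ev2 (fun i j y => S i y * S' j y) E a b x = ev1 S E a x * ev1 S' E b x := by
  simp only [ev2, ev1, Finset.mul_sum, Finset.sum_mul]
  exact Finset.sum_congr rfl fun j _ => Finset.sum_congr rfl fun i _ => by ring

lemma IsOrtho.ev2_schoutenHat (h : IsOrtho g x E) (u : Coord m → ℝ) (a b : Fin (m + 1)) :
    ev2 (fun i j y => schoutenHat r g u y i j) E a b x =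
      ev2 (cov1 r g fun i => pd r i u) E a b x
        + ev1 (fun i => pd r i u) E a x * ev1 (fun i => pd r i u) E b x
        - (1 / 2) * (∑ k, ev1 (fun i => pd r i u) E k x ^ 2) * (if a = b then 1 else 0) := by
  have e : (fun i j y => schoutenHat r g u y i j) = fun i j y =>
      (cov1 r g (fun i => pd r i u) i j y + pd r i u y * pd r j u y)
        - ((1 / 2) * gradSq r g u y) * g y i j := by
    funext i j y
    simp [schoutenHat, covHess, cov1]
  rw [e, ev2_sub (fun i j y => cov1 r g (fun i => pd r i u) i j y + pd r i u y * pd r j u y)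
      (fun i j y => ((1 / 2) * gradSq r g u y) * g y i j),
    ev2_add (cov1 r g (fun i => pd r i u)) (fun i j y => pd r i u y * pd r j u y),
    ev2_mul (fun i => pd r i u) (fun i => pd r i u),
    ev2_smul (fun y => (1 / 2) * gradSq r g u y) (fun i j y => g y i j), h a b, h.gradSq_eq]

lemma cov1_symm (hr : 0 < r) (hg : IsFermiMetric r g) {u : Coord m → ℝ}
    (hu : ContDiffOn ℝ 2 u (halfBall m r)) (hx : x ∈ halfBall m r) (i j : Fin (m + 1)) :
    cov1 r g (fun i => pd r i u) i j x = cov1 r g (fun i => pd r i u) j i x := by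
  unfold cov1
  rw [pd_comm hr hx hu]
  congr 1
  exact Finset.sum_congr rfl fun p _ => by rw [hg.christoffel_symm hx]

lemma schoutenHat_isHermitian (hr : 0 < r) (hg : IsFermiMetric r g) {u : Coord m → ℝ}
    (hu : ContDiffOn ℝ 2 u (halfBall m r)) (hx : x ∈ halfBall m r) :
    (schoutenHat r g u x).IsHermitian := by
  ext i j
  have := cov1_symm hr hg hu hx i j
  have e : ∀ i j, schoutenHat r g u x i j = (cov1 r g (fun i => pd r i u) i j x
      + pd r i u x * pd r j u x) - ((1 / 2) * gradSq r g u x) * g x i j := by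
    intro i j
    simp [schoutenHat, covHess, cov1]
  simp only [Matrix.conjTranspose_apply, star_trivial]
  rw [e, e, this, hg.symm hx i j]
  ring

variable {Γ : Set (Fin (m + 1) → ℝ)} {F : (Fin (m + 1) → ℝ) → ℝ} {μ : Coord m → ℝ} {μhat ε : ℝ}
  {f u : Coord m → ℝ}

/-- In any orthonormal frame, the linearization of `F` at an admissible `l₀` bounds the right-hand
side of the equation, with equality where the frame diagonalizes the tensor to `l₀`. -/
lemma IsSolution.le_sum_frame (hr : 0 < r) (hg : IsFermiMetric r g) (hΓ : IsAdmissibleCone Γ)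
    (hF : IsAdmissibleFun ε Γ F) (hu : IsSolution r g Γ F μ μhat f u) {l₀ : Fin (m + 1) → ℝ}
    (hl₀ : l₀ ∈ Γ) (hx : x ∈ halfBall m r) (hE : IsOrtho g x E) :
    f x * Real.exp (-2 * u x) ≤
      ∑ i, dF F i l₀ * ev2 (fun i j y => schoutenHat r g u y i j) E i i x := by
  obtain ⟨l, hl, hlW, hFl⟩ := hu.eqn x hx
  rw [← hFl]
  have hS := schoutenHat_isHermitian hr hg (hu.smooth.of_le (by norm_num)) hx
  have h1 := isEigenvalues_frame hE.mul_eq_one hlW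
  have h2 : (Matrix.of E * schoutenHat r g u x * (Matrix.of E).transpose).IsHermitian := by
    have := Matrix.isHermitian_mul_mul_conjTranspose (Matrix.of E) hS
    simpa using this
  have h3 := hF.le_sum_diag hΓ hl₀ hl h2 h1
  refine h3.trans_eq (Finset.sum_congr rfl fun i _ => ?_)
  rw [show E = Matrix.of E from rfl, ev2_eq_matrix]
  rfl

/-- The diagonal values of the tensor in a diagonalizing frame are admissible and solve the
equation. -/
lemma IsSolution.diag_mem (hΓ : IsAdmissibleCone Γ)
    (hF : IsAdmissibleFun ε Γ F) (hu : IsSolution r g Γ F μ μhat f u) {l₀ : Fin (m + 1) → ℝ}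
    (hx : x ∈ halfBall m r) {E : Matrix (Fin (m + 1)) (Fin (m + 1)) ℝ}
    (hE : E * g x * E.transpose = 1)
    (hd : E * schoutenHat r g u x * E.transpose = Matrix.diagonal l₀) :
    l₀ ∈ Γ ∧ F l₀ = f x * Real.exp (-2 * u x) := by
  obtain ⟨l, hl, hlW, hFl⟩ := hu.eqn x hx
  have h1 := isEigenvalues_frame hE hlW
  rw [hd] at h1
  unfold IsEigenvalues at h1
  rw [Matrix.charpoly_diagonal] at h1
  obtain ⟨τ, hτ⟩ := exists_perm_of_prod_eq h1
  rw [hτ]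
  exact ⟨hΓ.perm_mem τ l hl, by rw [hF.symm τ l hl, hFl]⟩

/-- A tensor that splits off the normal direction, as the metric does, is diagonalized by an
orthonormal frame that contains the normal vector. -/
lemma exists_diagonal_frame_last {G S : Matrix (Fin (m + 1)) (Fin (m + 1)) ℝ} (hG : G.PosDef)
    (hS : S.IsHermitian) (hGn : G (Fin.last m) (Fin.last m) = 1)
    (hGa : ∀ a : Fin m, G a.castSucc (Fin.last m) = 0)
    (hSa : ∀ a : Fin m, S a.castSucc (Fin.last m) = 0) :
    ∃ (E : Matrix (Fin (m + 1)) (Fin (m + 1)) ℝ) (l : Fin (m + 1) → ℝ),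
      E * G * E.transpose = 1 ∧ E * S * E.transpose = Matrix.diagonal l ∧
      E (Fin.last m) = Pi.single (Fin.last m) 1 ∧
      ∀ a : Fin m, E a.castSucc (Fin.last m) = 0 := by
  have hG' : (G.submatrix (Fin.castSucc : Fin m → Fin (m + 1)) Fin.castSucc).PosDef :=
    hG.submatrix (Fin.castSucc_injective m)
  have hS' : (S.submatrix (Fin.castSucc : Fin m → Fin (m + 1)) Fin.castSucc).IsHermitian :=
    hS.submatrix _
  obtain ⟨E, l, hE, hl⟩ := exists_diagonal_frame hG' hS'
  have hGa' : ∀ a : Fin m, G (Fin.last m) a.castSucc = 0 := fun a => by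
    have := hG.isHermitian.apply (Fin.last m) a.castSucc
    rw [← this, hGa]; simp
  have hSa' : ∀ a : Fin m, S (Fin.last m) a.castSucc = 0 := fun a => by
    have := hS.apply (Fin.last m) a.castSucc
    rw [← this, hSa]; simp
  set P : Matrix (Fin (m + 1)) (Fin (m + 1)) ℝ := Matrix.of fun a i =>
    Fin.lastCases (motive := fun _ => ℝ) (Fin.lastCases (motive := fun _ => ℝ) 1 (fun _ => 0) i)
      (fun α => Fin.lastCases (motive := fun _ => ℝ) 0 (fun β => E α β) i) a with hP
  have p1 : P (Fin.last m) (Fin.last m) = 1 := by simp [hP]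
  have p2 : ∀ β : Fin m, P (Fin.last m) β.castSucc = 0 := by simp [hP]
  have p3 : ∀ β : Fin m, P β.castSucc (Fin.last m) = 0 := by simp [hP]
  have p4 : ∀ α β : Fin m, P α.castSucc β.castSucc = E α β := by simp [hP]
  have key : ∀ (A : Matrix (Fin (m + 1)) (Fin (m + 1)) ℝ) (d : Fin m → ℝ),
      (∀ a : Fin m, A a.castSucc (Fin.last m) = 0) → (∀ a : Fin m, A (Fin.last m) a.castSucc = 0) →
      E * A.submatrix Fin.castSucc Fin.castSucc * E.transpose = Matrix.diagonal d →
      P * A * P.transpose = Matrix.diagonal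
        (Fin.lastCases (motive := fun _ => ℝ) (A (Fin.last m) (Fin.last m)) d) := by
    intro A d h1 h2 h3
    ext a b
    simp only [Matrix.mul_apply, Matrix.transpose_apply, Fin.sum_univ_castSucc]
    refine Fin.lastCases ?_ (fun α => ?_) a <;> refine Fin.lastCases ?_ (fun β => ?_) b
    · simp [p1, p2, h1, h2]
    · simp [p1, p2, p3, p4, h1, h2, (Fin.castSucc_lt_last β).ne']
    · simp [p1, p2, p3, p4, h1, h2, (Fin.castSucc_lt_last α).ne]
    · have h4 := congrFun (congrFun h3 α) β
      simp only [Matrix.mul_apply, Matrix.transpose_apply, Matrix.submatrix_apply] at h4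
      simp [p3, p4, h4, Matrix.diagonal_apply]
  refine ⟨P, _, ?_, key S l hSa hSa' hl, ?_, p3⟩
  · rw [key G (fun _ => 1) hGa hGa' (by rw [hE]; rfl), hGn, ← Matrix.diagonal_one]
    congr 1
    funext a
    refine Fin.lastCases ?_ (fun α => ?_) a <;> simp
  · funext i
    refine Fin.lastCases ?_ (fun β => ?_) i
    · simp [p1]
    · simp [p2, (Fin.castSucc_lt_last β).ne]

end Frames

/-! ### The inequalities at a maximum point -/

section Algebra

variable {N : ℕ}

/-- Consequences of `tr W > 0`, where `W = q + p ⊗ p - ½|p|²` and `V = q + p ⊗ p` is diagonal with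
largest entry `V a a`, for the quantity `G = V a a + tr V`. -/
lemma size_bounds (hN : 3 ≤ N) {p : Fin N → ℝ} {q : Fin N → Fin N → ℝ} {a : Fin N} {G : ℝ}
    (hG : G = q a a + p a ^ 2 + ∑ k, (q k k + p k ^ 2))
    (htr : 0 < ∑ k, (q k k + p k ^ 2 - 1 / 2 * ∑ l, p l ^ 2))
    (hmax : ∀ k, q k k + p k ^ 2 ≤ q a a + p a ^ 2) :
    0 < G ∧ ∑ l, p l ^ 2 ≤ 2 * G ∧ (∀ k, |q k k + p k ^ 2| ≤ N * G) ∧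
      ∑ k, (q k k + p k ^ 2) ≤ G ∧ G ^ 2 ≤ 52 * N * ∑ k, ∑ l, q k l ^ 2 := by
  have hN' : (3 : ℝ) ≤ N := by exact_mod_cast hN
  set P := ∑ l, p l ^ 2 with hP
  have hP0 : 0 ≤ P := Finset.sum_nonneg fun _ _ => sq_nonneg _
  set Δ := ∑ k, q k k with hΔ
  have hK : ∑ k, (q k k + p k ^ 2) = Δ + P := by rw [Finset.sum_add_distrib]
  rw [Finset.sum_sub_distrib, hK] at htr
  simp only [Finset.sum_const, Finset.card_univ, Fintype.card_fin, nsmul_eq_mul] at htr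
  rw [hK] at hG ⊢
  have hNP := mul_nonneg (sub_nonneg.2 hN') hP0
  have h1 : P ≤ 2 * Δ := by linarith
  have hΔ0 : 0 < Δ := by linarith
  set M := q a a + p a ^ 2 with hM
  have hsum : ∑ k, (q k k + p k ^ 2) ≤ N * M := by
    have := Finset.sum_le_sum fun k (_ : k ∈ Finset.univ) => hmax k
    simpa using this
  have hM0 : 0 < M := by
    rw [hK] at hsum
    by_contra hcon
    have := mul_nonneg (show (0 : ℝ) ≤ N by positivity) (sub_nonneg.2 (not_lt.1 hcon))
    linarith
  have hpa : ∀ k, p k ^ 2 ≤ P := fun k =>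
    Finset.single_le_sum (f := fun k => p k ^ 2) (fun _ _ => sq_nonneg _) (Finset.mem_univ k)
  have hG0 : 0 ≤ G := by linarith
  refine ⟨by linarith, by linarith, fun k => ?_, by linarith, ?_⟩
  · rw [abs_le]
    constructor
    · have h2 : ∑ l ∈ Finset.univ.erase k, (q l l + p l ^ 2) ≤ (N - 1) * M := by
        have := Finset.sum_le_sum fun l (_ : l ∈ Finset.univ.erase k) => hmax l
        refine this.trans_eq ?_
        rw [Finset.sum_const, Finset.card_erase_of_mem (Finset.mem_univ k), nsmul_eq_mul,
          Finset.card_univ, Fintype.card_fin, Nat.cast_sub (by omega), Nat.cast_one]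
      have h3 := Finset.add_sum_erase Finset.univ (fun l => q l l + p l ^ 2) (Finset.mem_univ k)
      rw [hK] at h3
      have h4 : -(N * M) ≤ -((N - 1) * M) := by linarith
      have h5 : (N : ℝ) * M ≤ N * G := by gcongr; linarith
      linarith
    · have := hmax k
      have h5 : (3 : ℝ) * G ≤ N * G := by gcongr
      linarith
  · have hS : q a a ^ 2 ≤ ∑ k, ∑ l, q k l ^ 2 :=
      (Finset.single_le_sum (f := fun l => q a l ^ 2) (fun _ _ => sq_nonneg _)
        (Finset.mem_univ a)).trans
      (Finset.single_le_sum (f := fun k => ∑ l, q k l ^ 2)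
        (fun _ _ => Finset.sum_nonneg fun _ _ => sq_nonneg _) (Finset.mem_univ a))
    have hD : Δ ^ 2 ≤ N * ∑ k, ∑ l, q k l ^ 2 := by
      have h1 : Δ ^ 2 ≤ N * ∑ k, q k k ^ 2 := by
        have := sq_sum_le_card_mul_sum_sq (s := Finset.univ) (f := fun k => q k k)
        simpa using this
      refine h1.trans (mul_le_mul_of_nonneg_left (Finset.sum_le_sum fun k _ => ?_) (by positivity))
      exact Finset.single_le_sum (f := fun l => q k l ^ 2) (fun _ _ => sq_nonneg _)
        (Finset.mem_univ k)
    have hS0 : 0 ≤ ∑ k, ∑ l, q k l ^ 2 := (sq_nonneg _).trans hS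
    have hGle : G ≤ q a a + 5 * Δ := by have := hpa a; linarith
    have hG0 : 0 < G := by linarith
    have : G ^ 2 ≤ 2 * q a a ^ 2 + 50 * Δ ^ 2 := by
      have : G ^ 2 ≤ (q a a + 5 * Δ) ^ 2 := by gcongr
      linarith [sq_nonneg (q a a - 5 * Δ)]
    have := mul_nonneg (show (0 : ℝ) ≤ N - 1 by linarith) hS0
    linarith

/-- The differentiated equation, in one direction `k`. Here `q`, `T`, `Q` are the second, third and
fourth covariant derivatives of `u` in an orthonormal frame (the last index pair of `Q c c` and the
last of `T c` are the original Hessian indices), and `h₁`, `h₂` are the first and second derivative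
of the right-hand side in direction `k`. -/
lemma linearized_bound {F p : Fin N → ℝ} {q : Fin N → Fin N → ℝ} {T : Fin N → Fin N → Fin N → ℝ}
    {Q : Fin N → Fin N → ℝ} {k : Fin N} {h₁ h₂ : ℝ}
    (hq : ∀ i j, q i j = q j i) (hT : ∀ c i j, T c i j = T i c j) (hT' : ∀ c i j, T c i j = T c j i)
    (hQ : ∀ c i, Q c i = Q i c)
    (hfirst : ∑ i, F i * (T k i i + 2 * p i * q k i - ∑ l, p l * q k l) = h₁)
    (hsecond : h₂ ≤ ∑ i, F i * (Q k i + 2 * q k i ^ 2 + 2 * p i * T k k i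
      - ∑ l, (q k l ^ 2 + p l * T k k l))) :
    h₂ + 2 * p k * h₁ + (∑ i, F i) * ∑ l, q k l ^ 2
        + ∑ l, ((∑ i, F i) - 2 * F l) * p l * (T l k k + 2 * p k * q l k) ≤
      ∑ c, F c * (Q c k + 2 * q c k ^ 2 + 2 * p k * T c c k) := by
  have e1 : ∑ i, F i * (T k i i + 2 * p i * q k i - ∑ l, p l * q k l) =
      ∑ i, F i * T k i i + 2 * ∑ i, F i * (p i * q k i) - (∑ i, F i) * ∑ l, p l * q k l := by
    simp only [mul_add, mul_sub, Finset.sum_add_distrib, Finset.sum_sub_distrib, Finset.mul_sum,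
      Finset.sum_mul]
    congr 1
    · congr 1
      exact Finset.sum_congr rfl fun i _ => by ring
    · rw [Finset.sum_comm]
  have e2 : ∑ i, F i * (Q k i + 2 * q k i ^ 2 + 2 * p i * T k k i
      - ∑ l, (q k l ^ 2 + p l * T k k l)) =
      ∑ i, F i * Q k i + 2 * ∑ i, F i * q k i ^ 2 + 2 * ∑ i, F i * (p i * T k k i)
        - (∑ i, F i) * ∑ l, q k l ^ 2 - (∑ i, F i) * ∑ l, p l * T k k l := by
    simp only [mul_add, mul_sub, Finset.sum_add_distrib, Finset.sum_sub_distrib, ← Finset.sum_mul]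
    have a1 : ∑ i, F i * (2 * q k i ^ 2) = 2 * ∑ i, F i * q k i ^ 2 := by
      rw [Finset.mul_sum]; exact Finset.sum_congr rfl fun i _ => by ring
    have a2 : ∑ i, F i * (2 * p i * T k k i) = 2 * ∑ i, F i * (p i * T k k i) := by
      rw [Finset.mul_sum]; exact Finset.sum_congr rfl fun i _ => by ring
    rw [a1, a2]
    ring
  have e3 : ∑ c, F c * (Q c k + 2 * q c k ^ 2 + 2 * p k * T c c k) =
      ∑ i, F i * Q k i + 2 * ∑ i, F i * q k i ^ 2 + 2 * p k * ∑ i, F i * T k i i := by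
    simp only [mul_add, Finset.sum_add_distrib, Finset.mul_sum]
    congr 1
    · congr 1
      · exact Finset.sum_congr rfl fun i _ => by rw [hQ]
      · exact Finset.sum_congr rfl fun i _ => by rw [hq]; ring
    · exact Finset.sum_congr rfl fun i _ => by rw [hT' i i k, hT i k i]; ring
  have e4 : ∑ l, ((∑ i, F i) - 2 * F l) * p l * (T l k k + 2 * p k * q l k) =
      (∑ i, F i) * ∑ l, p l * T k k l + 2 * p k * ((∑ i, F i) * ∑ l, p l * q k l)
      - 2 * ∑ i, F i * (p i * T k k i) - 4 * p k * ∑ i, F i * (p i * q k i) := by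
    generalize (∑ i, F i) = T₀
    simp only [Finset.mul_sum]
    rw [← Finset.sum_add_distrib, ← Finset.sum_sub_distrib, ← Finset.sum_sub_distrib]
    refine Finset.sum_congr rfl fun l _ => ?_
    rw [hT l k k, hT' k l k, hq l k]
    ring
  rw [e1] at hfirst
  rw [e2] at hsecond
  rw [e3, e4, ← hfirst]
  linarith

/-- The quadratic inequality for `X = θ²G` at an interior maximum forces `X ≤ C (1 + s)`. -/
lemma quadratic_bound {X D s : ℝ} (hD : 0 ≤ D) (hs : 0 ≤ s)
    (h : X ^ 2 ≤ D * ((1 + s) * (1 + X))) : X ≤ (2 * D + 1) * (1 + s) := by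
  by_cases h1 : X ≤ 1
  · nlinarith [mul_nonneg hD hs]
  · push Not at h1
    have h2 : X ^ 2 ≤ 2 * D * (1 + s) * X := by
      have : D * ((1 + s) * (1 + X)) ≤ D * ((1 + s) * (2 * X)) := by gcongr; linarith
      nlinarith
    have h3 : X ≤ 2 * D * (1 + s) := by
      have : X * X ≤ 2 * D * (1 + s) * X := by nlinarith
      exact le_of_mul_le_mul_right this (by linarith)
    nlinarith

set_option maxHeartbeats 1600000 in
/-- The estimate at an interior maximum of `θ²G`, as a statement about numbers: `F` is the gradient
of the curvature function, `p` and `q` are the first and second covariant derivatives of `u`, `A k c`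
and `A₂ k c` are the first and second derivatives of `V k k` in direction `c`, the `θ` and `f` with
indices are derivatives of the cut-off and of the datum, and `e = exp (-2u)`. The good term
`(∑ F) |q|²` dominates `(∑ F) G²` and absorbs everything else. -/
lemma interior_bound (hN : 3 ≤ N) (B K : ℝ) : ∃ C : ℝ, 0 ≤ C ∧
    ∀ (F p θ₁ θ₂ f₁ f₂ : Fin N → ℝ) (q A A₂ : Fin N → Fin N → ℝ) (a : Fin N) (θ f₀ e s G : ℝ),
      (∀ c, 0 ≤ F c) → 1 ≤ ∑ c, F c → 0 < θ →
      G = q a a + p a ^ 2 + ∑ k, (q k k + p k ^ 2) →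
      0 < ∑ k, (q k k + p k ^ 2 - 1 / 2 * ∑ l, p l ^ 2) →
      (∀ k, q k k + p k ^ 2 ≤ q a a + p a ^ 2) →
      |θ| ≤ B → (∀ c, |θ₁ c| ≤ B) → (∀ c, |θ₂ c| ≤ B) →
      |f₀| ≤ K → (∀ c, |f₁ c| ≤ K) → (∀ c, |f₂ c| ≤ K) →
      0 ≤ e → e ≤ s →
      (∀ c, 2 * θ * θ₁ c * G + θ ^ 2 * (A a c + ∑ k, A k c) = 0) →
      (∀ c, (2 * θ₁ c ^ 2 + 2 * θ * θ₂ c) * G + 4 * θ * θ₁ c * (A a c + ∑ k, A k c)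
        + θ ^ 2 * (A₂ a c + ∑ k, A₂ k c) ≤ 0) →
      (∀ k, e * (f₂ k - 2 * f₁ k * p k - 2 * f₀ * q k k) + (∑ i, F i) * ∑ l, q k l ^ 2
        + ∑ l, ((∑ i, F i) - 2 * F l) * p l * A k l ≤ ∑ c, F c * A₂ k c) →
      θ ^ 2 * G ≤ C * (1 + s) := by
  have hN' : (3 : ℝ) ≤ N := by exact_mod_cast hN
  set C₁ : ℝ := 8 * B ^ 2 + 208 * N ^ 2 * B ^ 2 with hC₁
  set C₂ : ℝ := (N + 1) * |K| * (2 * N + 8) with hC₂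
  have hC₁0 : 0 ≤ C₁ := by positivity
  have hC₂0 : 0 ≤ C₂ := by positivity
  set D : ℝ := 104 * N * (C₁ + C₂ * B ^ 2 * (1 + B ^ 2)) with hD
  have hD0 : 0 ≤ D := by positivity
  refine ⟨2 * D + 1, by positivity, ?_⟩
  intro F p θ₁ θ₂ f₁ f₂ q A A₂ a θ f₀ e s G hF hT hθ hG htr hmax hθB hθ₁ hθ₂ hf₀ hf₁ hf₂ he hes
    hmax1 hmax2 hlin
  obtain ⟨hG0, hP, hv, -, hS⟩ := size_bounds hN hG htr hmax
  set T := ∑ c, F c with hTdef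
  have hT0 : 0 < T := by linarith
  set S2 := ∑ k, ∑ l, q k l ^ 2 with hS2
  set G1 : Fin N → ℝ := fun c => A a c + ∑ k, A k c with hG1
  have hs0 : 0 ≤ s := he.trans hes
  have hpk : ∀ k, p k ^ 2 ≤ 2 * G := fun k =>
    (Finset.single_le_sum (f := fun k => p k ^ 2) (fun _ _ => sq_nonneg _)
      (Finset.mem_univ k)).trans hP
  have hgrad : ∀ c, θ * G1 c = -2 * θ₁ c * G := by
    intro c
    have h1 := hmax1 c
    have : θ * (2 * θ₁ c * G + θ * G1 c) = 0 := by rw [← h1]; ring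
    rcases mul_eq_zero.1 this with h | h
    · exact absurd h hθ.ne'
    · linarith
  have hsq : ∀ {z : ℝ}, |z| ≤ B → z ^ 2 ≤ B ^ 2 := fun {z} hz => by
    rw [← sq_abs z]; gcongr
  -- the trace of the second-order condition
  have h2 : θ ^ 2 * ∑ c, F c * (A₂ a c + ∑ k, A₂ k c) ≤ 8 * B ^ 2 * T * G := by
    rw [Finset.mul_sum]
    calc ∑ c, θ ^ 2 * (F c * (A₂ a c + ∑ k, A₂ k c)) ≤ ∑ c, F c * (8 * B ^ 2 * G) := by
          refine Finset.sum_le_sum fun c _ => ?_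
          have h3 := hmax2 c
          have h4 : 4 * θ * θ₁ c * (A a c + ∑ k, A k c) = -8 * θ₁ c ^ 2 * G := by
            have := hgrad c
            calc 4 * θ * θ₁ c * (A a c + ∑ k, A k c) = 4 * θ₁ c * (θ * G1 c) := by
                  simp only [hG1]; ring
              _ = _ := by rw [this]; ring
          have h5 : θ ^ 2 * (A₂ a c + ∑ k, A₂ k c) ≤ (6 * θ₁ c ^ 2 - 2 * θ * θ₂ c) * G := by
            linarith
          have h6 : 6 * θ₁ c ^ 2 - 2 * θ * θ₂ c ≤ 8 * B ^ 2 := by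
            have := hsq (hθ₁ c)
            linarith [hsq hθB, hsq (hθ₂ c), sq_nonneg (θ + θ₂ c)]
          have h7 := h5.trans (mul_le_mul_of_nonneg_right h6 hG0.le)
          calc θ ^ 2 * (F c * (A₂ a c + ∑ k, A₂ k c))
              = F c * (θ ^ 2 * (A₂ a c + ∑ k, A₂ k c)) := by ring
            _ ≤ _ := mul_le_mul_of_nonneg_left h7 (hF c)
      _ = _ := by rw [← Finset.sum_mul]; ring
  -- the sum of the linearized inequalities over the direction `a` and all frame directions
  set hk : Fin N → ℝ := fun k => e * (f₂ k - 2 * f₁ k * p k - 2 * f₀ * q k k) with hhk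
  have hsumlin : hk a + ∑ k, hk k + T * S2 + ∑ l, (T - 2 * F l) * p l * G1 l ≤
      ∑ c, F c * (A₂ a c + ∑ k, A₂ k c) := by
    have h3 := hlin a
    have h4 := Finset.sum_le_sum fun k (_ : k ∈ Finset.univ) => hlin k
    have e1 : ∑ k, ∑ c, F c * A₂ k c = ∑ c, F c * ∑ k, A₂ k c := by
      rw [Finset.sum_comm]
      exact Finset.sum_congr rfl fun c _ => by rw [Finset.mul_sum]
    have e2 : ∑ k, ∑ l, (T - 2 * F l) * p l * A k l = ∑ l, (T - 2 * F l) * p l * ∑ k, A k l := by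
      rw [Finset.sum_comm]
      exact Finset.sum_congr rfl fun c _ => by rw [Finset.mul_sum]
    have e3 : ∑ k, T * ∑ l, q k l ^ 2 = T * S2 := by rw [hS2, Finset.mul_sum]
    rw [e1, Finset.sum_add_distrib, Finset.sum_add_distrib, e2, e3] at h4
    simp only [hG1, mul_add, Finset.sum_add_distrib]
    have h5 : 0 ≤ T * ∑ l, q a l ^ 2 := by positivity
    have h6 : hk a = e * (f₂ a - 2 * f₁ a * p a - 2 * f₀ * q a a) := rfl
    have h7 : ∑ k, hk k = ∑ k, e * (f₂ k - 2 * f₁ k * p k - 2 * f₀ * q k k) := rfl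
    linarith
  -- the gradient term is absorbed with a small multiple of `T θ² G²`
  have hgradterm : -(T * G * (1 / (104 * N) * θ ^ 2 * G + 208 * N ^ 2 * B ^ 2)) ≤
      θ ^ 2 * ∑ l, (T - 2 * F l) * p l * G1 l := by
    rw [Finset.mul_sum]
    have hterm : ∀ l, -(T * G * (1 / (208 * N) * (θ ^ 2 * p l ^ 2) + 208 * N * B ^ 2)) ≤
        θ ^ 2 * ((T - 2 * F l) * p l * G1 l) := by
      intro l
      have e1 : θ ^ 2 * ((T - 2 * F l) * p l * G1 l) =
          -(2 * G * ((T - 2 * F l) * (θ * p l * θ₁ l))) := by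
        calc _ = (T - 2 * F l) * p l * θ * (θ * G1 l) := by ring
          _ = _ := by rw [hgrad l]; ring
      rw [e1]
      have hFl : F l ≤ T := Finset.single_le_sum (f := F) (fun c _ => hF c) (Finset.mem_univ l)
      have hTF : |T - 2 * F l| ≤ T := by
        rw [abs_le]; constructor <;> linarith [hF l]
      have h3 : (T - 2 * F l) * (θ * p l * θ₁ l) ≤ T * |θ * p l * θ₁ l| :=
        (le_abs_self _).trans (by rw [abs_mul]; gcongr)
      have h4 : 2 * |θ * p l * θ₁ l| ≤ 1 / (208 * N) * (θ ^ 2 * p l ^ 2) + 208 * N * B ^ 2 := by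
        have h5 := hsq (hθ₁ l)
        have h6 : 2 * |θ * p l * θ₁ l| ≤
            1 / (208 * N) * (θ ^ 2 * p l ^ 2) + 208 * N * θ₁ l ^ 2 := by
          have hpos : (0 : ℝ) < 208 * N := by positivity
          rw [abs_mul, ← sq_abs (θ₁ l), ← mul_pow, ← sq_abs (θ * p l)]
          have := sq_nonneg (|θ * p l| - 208 * N * |θ₁ l|)
          have e2 : 1 / (208 * N) * |θ * p l| ^ 2 + 208 * N * |θ₁ l| ^ 2
              - 2 * (|θ * p l| * |θ₁ l|) =
              1 / (208 * N) * (|θ * p l| - 208 * N * |θ₁ l|) ^ 2 := by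
            field_simp
            ring
          have : 0 ≤ 1 / (208 * N) * (|θ * p l| - 208 * N * |θ₁ l|) ^ 2 := by positivity
          linarith
        have : 208 * N * θ₁ l ^ 2 ≤ 208 * (N : ℝ) * B ^ 2 := by gcongr
        linarith
      have h7 : 2 * G * ((T - 2 * F l) * (θ * p l * θ₁ l)) ≤
          T * G * (2 * |θ * p l * θ₁ l|) := by
        have := mul_le_mul_of_nonneg_left h3 (show 0 ≤ 2 * G by linarith)
        linarith
      have h8 := mul_le_mul_of_nonneg_left h4 (show 0 ≤ T * G by positivity)
      linarith
    have h9 := Finset.sum_le_sum fun l (_ : l ∈ Finset.univ) => hterm l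
    refine le_trans ?_ h9
    rw [Finset.sum_neg_distrib, neg_le_neg_iff, ← Finset.mul_sum, Finset.sum_add_distrib,
      ← Finset.mul_sum, ← Finset.mul_sum]
    simp only [Finset.sum_const, Finset.card_univ, Fintype.card_fin, nsmul_eq_mul]
    refine mul_le_mul_of_nonneg_left ?_ (by positivity)
    have : 1 / (208 * N) * (θ ^ 2 * ∑ l, p l ^ 2) ≤ 1 / (208 * (N : ℝ)) * (θ ^ 2 * (2 * G)) := by
      gcongr
    have e3 : 1 / (208 * (N : ℝ)) * (θ ^ 2 * (2 * G)) = 1 / (104 * N) * θ ^ 2 * G := by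
      field_simp; ring
    linarith
  -- the terms from the right-hand side of the equation
  have hrhs : -(s * C₂ * (1 + G)) ≤ hk a + ∑ k, hk k := by
    have hterm : ∀ k, -(s * (|K| * (2 * N + 8) * (1 + G))) ≤ hk k := by
      intro k
      have hKK : K ≤ |K| := le_abs_self K
      have h3 : |p k| ≤ 1 + G := by
        have := hpk k
        rw [← sq_abs] at this
        linarith [sq_nonneg (|p k| - 1)]
      have h4 : |q k k| ≤ (N + 2) * G := by
        have h5 := abs_le.1 (hv k)
        have h6 := hpk k
        rw [abs_le]
        constructor <;> linarith [sq_nonneg (p k)]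
      have h5 : |f₂ k - 2 * f₁ k * p k - 2 * f₀ * q k k| ≤ |K| * (2 * N + 8) * (1 + G) := by
        have t1 : |2 * f₁ k * p k| ≤ 2 * |K| * (1 + G) := by
          rw [abs_mul, abs_mul, abs_two]
          have := (hf₁ k).trans hKK
          gcongr
        have t2 : |2 * f₀ * q k k| ≤ 2 * |K| * ((N + 2) * G) := by
          rw [abs_mul, abs_mul, abs_two]
          have := hf₀.trans hKK
          gcongr
        have t3 := (hf₂ k).trans hKK
        have t4 : |f₂ k - 2 * f₁ k * p k - 2 * f₀ * q k k| ≤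
            |f₂ k| + |2 * f₁ k * p k| + |2 * f₀ * q k k| := by
          refine (abs_sub _ _).trans ?_
          gcongr
          exact abs_sub _ _
        have hK0 := abs_nonneg K
        linarith [mul_nonneg hK0 hG0.le, mul_nonneg hK0 (show (0 : ℝ) ≤ N by linarith)]
      have h6 : -(|K| * (2 * N + 8) * (1 + G)) ≤ f₂ k - 2 * f₁ k * p k - 2 * f₀ * q k k :=
        (abs_le.1 h5).1
      have h7 := mul_le_mul_of_nonneg_left h6 he
      have h8 : e * (|K| * (2 * N + 8) * (1 + G)) ≤ s * (|K| * (2 * N + 8) * (1 + G)) := by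
        gcongr
      simp only [hhk]
      linarith
    have h9 := Finset.sum_le_sum fun l (_ : l ∈ Finset.univ) => hterm l
    simp only [Finset.sum_const, Finset.card_univ, Fintype.card_fin, nsmul_eq_mul] at h9
    have := hterm a
    have e4 : s * C₂ * (1 + G) = (N + 1) * (s * (|K| * (2 * N + 8) * (1 + G))) := by
      rw [hC₂]; ring
    rw [e4]
    linarith
  have hmain : T * (θ ^ 2 * G ^ 2 * (1 / (104 * N))) ≤ T * (G * C₁ + θ ^ 2 * (s * C₂ * (1 + G))) := by
    have h3 := mul_le_mul_of_nonneg_left hsumlin (sq_nonneg θ)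
    have h4 := mul_le_mul_of_nonneg_left hrhs (sq_nonneg θ)
    have h5 : T * (θ ^ 2 * G ^ 2 * (1 / (52 * N))) ≤ T * (θ ^ 2 * S2) := by
      refine mul_le_mul_of_nonneg_left ?_ hT0.le
      rw [mul_assoc]
      refine mul_le_mul_of_nonneg_left ?_ (sq_nonneg _)
      rw [mul_one_div, div_le_iff₀ (by positivity)]
      linarith
    have h6 : θ ^ 2 * (s * C₂ * (1 + G)) ≤ T * (θ ^ 2 * (s * C₂ * (1 + G))) :=
      le_mul_of_one_le_left (by positivity) hT
    have e5 : T * (θ ^ 2 * G ^ 2 * (1 / (52 * N))) = 2 * (T * (θ ^ 2 * G ^ 2 * (1 / (104 * N)))) := by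
      field_simp; ring
    have e6 : T * G * (1 / (104 * N) * θ ^ 2 * G + 208 * N ^ 2 * B ^ 2) =
        T * (θ ^ 2 * G ^ 2 * (1 / (104 * N))) + T * (G * (208 * N ^ 2 * B ^ 2)) := by ring
    rw [e6] at hgradterm
    rw [hC₁]
    linarith
  have hmain' := le_of_mul_le_mul_left hmain hT0
  have hθsq := hsq hθB
  set X := θ ^ 2 * G with hX
  have hX0 : 0 ≤ X := by positivity
  refine quadratic_bound hD0 hs0 ?_
  have h3 : X ^ 2 ≤ 104 * N * (X * C₁ + θ ^ 2 * (s * C₂ * (θ ^ 2 + X))) := by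
    have := mul_le_mul_of_nonneg_left hmain' (show 0 ≤ 104 * (N : ℝ) * θ ^ 2 by positivity)
    have e1 : 104 * (N : ℝ) * θ ^ 2 * (θ ^ 2 * G ^ 2 * (1 / (104 * N))) = X ^ 2 := by
      rw [hX]; field_simp
    rw [e1] at this
    refine this.trans_eq ?_
    rw [hX]; ring
  refine h3.trans ?_
  rw [hD, mul_assoc (104 * (N : ℝ))]
  refine mul_le_mul_of_nonneg_left ?_ (by positivity)
  have h4 : X * C₁ ≤ C₁ * ((1 + s) * (1 + X)) := by
    rw [mul_comm]
    refine mul_le_mul_of_nonneg_left ?_ hC₁0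
    have := mul_nonneg hs0 hX0
    linarith
  have h5 : θ ^ 2 * (s * C₂ * (θ ^ 2 + X)) ≤ B ^ 2 * (s * C₂ * ((1 + B ^ 2) * (1 + X))) := by
    gcongr
    linarith [mul_nonneg (sq_nonneg B) hX0]
  have h6 : B ^ 2 * (s * C₂ * ((1 + B ^ 2) * (1 + X))) ≤
      C₂ * B ^ 2 * (1 + B ^ 2) * ((1 + s) * (1 + X)) := by
    have : 0 ≤ C₂ * B ^ 2 * (1 + B ^ 2) * (1 + X) := by positivity
    linarith
  linarith

set_option maxHeartbeats 1000000 in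
/-- The lower bound for the normal derivative of `G` at a boundary point, `n` being the normal
direction. Here `w` and `w'` are the diagonal entries of `W` and their normal derivatives. -/
lemma boundary_bound (hN : 3 ≤ N) (ε M νmax K f₀ ρ : ℝ) (hε : 0 < ε) (hf₀ : 0 < f₀) (hρ : 0 ≤ ρ) :
    ∃ C : ℝ, 0 ≤ C ∧
    ∀ (F p w w' : Fin N → ℝ) (q : Fin N → Fin N → ℝ) (a n : Fin N) (μ ν e fx fn G : ℝ),
      (∀ c, 0 < F c) →
      G = q a a + p a ^ 2 + ∑ k, (q k k + p k ^ 2) →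
      (∀ k, w k = q k k + p k ^ 2 - 1 / 2 * ∑ l, p l ^ 2) →
      0 < ∑ k, w k →
      (∀ k, q k k + p k ^ 2 ≤ q a a + p a ^ 2) →
      |μ| ≤ M → 0 ≤ ν → ν ≤ νmax → p n = ν - μ →
      (∀ k, k ≠ n → q n k = - p n * p k) →
      0 < e → f₀ ≤ fx → |fn| ≤ K →
      (∀ k, k ≠ n → w' k = (2 * μ - ν) * w k - ν * w n) →
      e * (fn - 2 * fx * p n) ≤ ∑ k, F k * w' k →
      ∑ k, F k * w k = e * fx →
      ε * ((∑ k, F k * w k) / ∑ k, w k) ≤ F n →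
      (ν = 0 ∨ (w n ≤ 0 → ∑ k ∈ Finset.univ.erase n, F k ≤ ρ * F n)) →
      -(C * G) ≤ w' a + ∑ k, w' k + (N + 1) * ∑ k, p k * q n k := by
  have hN' : (3 : ℝ) ≤ N := by exact_mod_cast hN
  set Cα : ℝ := (2 * |M| + 2 * |νmax|) * (N + 1) with hCα
  set Cn : ℝ := (|K| / f₀ + |νmax|) / ε + (2 * |M| + |νmax|) * (N + 1) + |νmax| * ρ * (N + 1)
    with hCn
  have hCα0 : 0 ≤ Cα := by positivity
  have hCn0 : 0 ≤ Cn := by positivity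
  refine ⟨(N + 1) * (Cα + Cn) + (N + 1) * ((|M| + |νmax|) * (N + 4)), by positivity, ?_⟩
  intro F p w w' q a n μ ν e fx fn G hF hG hw htr hmax hμ hν hνm hpn hqn he hfx hfn hw't heq hFw
    hlow hA
  simp only [hw] at htr
  obtain ⟨hG0, hP, hv, hVG, -⟩ := size_bounds hN hG htr hmax
  simp only [← hw] at htr
  have hP0 : 0 ≤ ∑ l, p l ^ 2 := Finset.sum_nonneg fun _ _ => sq_nonneg _
  have hwk : ∀ k, |w k| ≤ (N + 1) * G := by
    intro k
    have h1 := abs_le.1 (hv k)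
    rw [hw k, abs_le]
    constructor <;> linarith
  have hsw : ∑ k, w k ≤ G := by
    refine le_trans (Finset.sum_le_sum fun k _ => ?_) hVG
    rw [hw k]; linarith
  have hνm' : ν ≤ |νmax| := hνm.trans (le_abs_self _)
  have hμ' : |μ| ≤ |M| := hμ.trans (le_abs_self _)
  have h2μ : |2 * μ - ν| ≤ 2 * |M| + |νmax| := by
    refine (abs_sub _ _).trans ?_
    rw [abs_mul, abs_two, abs_of_nonneg hν]
    linarith
  have hprod : ∀ k, -((2 * |M| + |νmax|) * (N + 1) * G) ≤ (2 * μ - ν) * w k := by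
    intro k
    have : |(2 * μ - ν) * w k| ≤ (2 * |M| + |νmax|) * ((N + 1) * G) := by
      rw [abs_mul]
      exact mul_le_mul h2μ (hwk k) (abs_nonneg _) (by positivity)
    linarith [(abs_le.1 this).1]
  -- the tangential entries are explicit in terms of `w`
  have htan : ∀ k, k ≠ n → -(Cα * G) ≤ w' k := by
    intro k hk
    rw [hw't k hk]
    have h1 : ν * w n ≤ |νmax| * ((N + 1) * G) :=
      (mul_le_mul_of_nonneg_left ((le_abs_self _).trans (hwk n)) hν).trans
        (mul_le_mul_of_nonneg_right hνm' (by positivity))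
    have := hprod k
    rw [hCα]
    linarith
  -- the normal entry is found from the differentiated equation; the result is divided by `F n`
  have hnor : -(Cn * G) ≤ w' n := by
    set Φ := ∑ k ∈ Finset.univ.erase n, F k with hΦ
    have hΦ0 : 0 ≤ Φ := Finset.sum_nonneg fun k _ => (hF k).le
    have s1 := Finset.add_sum_erase Finset.univ (fun k => F k * w' k) (Finset.mem_univ n)
    have s2 := Finset.add_sum_erase Finset.univ (fun k => F k * w k) (Finset.mem_univ n)
    have s3 : ∑ k ∈ Finset.univ.erase n, F k * w' k =
        (2 * μ - ν) * ∑ k ∈ Finset.univ.erase n, F k * w k - ν * w n * Φ := by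
      rw [hΦ, Finset.mul_sum, Finset.mul_sum, ← Finset.sum_sub_distrib]
      refine Finset.sum_congr rfl fun k hk => ?_
      rw [hw't k (Finset.ne_of_mem_erase hk)]
      ring
    rw [← s1, s3, eq_sub_of_add_eq' s2, hFw, hpn] at heq
    rw [hFw, ← mul_div_assoc, div_le_iff₀ htr] at hlow
    -- the structure condition on `F n` bounds the right-hand side of the equation
    have hefx : e * fx ≤ F n * (G / ε) := by
      rw [← mul_div_assoc, le_div_iff₀ hε]
      calc e * fx * ε = ε * (e * fx) := by ring
        _ ≤ F n * ∑ k, w k := hlow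
        _ ≤ F n * G := mul_le_mul_of_nonneg_left hsw (hF n).le
    have hefn : -(|K| / f₀ * (F n * (G / ε))) ≤ e * fn := by
      have h1 : -|K| ≤ fn := by
        have := (abs_le.1 (hfn.trans (le_abs_self K))).1
        exact this
      have h2 : e * |K| ≤ |K| / f₀ * (e * fx) := by
        have : |K| / f₀ * (e * f₀) ≤ |K| / f₀ * (e * fx) := by gcongr
        refine le_trans (le_of_eq ?_) this
        field_simp
      have h3 : |K| / f₀ * (e * fx) ≤ |K| / f₀ * (F n * (G / ε)) := by gcongr
      have h4 := mul_le_mul_of_nonneg_left h1 he.le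
      linarith
    have hνfx : ν * (e * fx) ≤ |νmax| * (F n * (G / ε)) := by
      have : 0 ≤ e * fx := by have := hf₀.trans_le hfx; positivity
      exact mul_le_mul hνm' hefx this (abs_nonneg _)
    have hwn := abs_le.1 (hwk n)
    -- only where `w n ≤ 0` does this term have the bad sign, and there `Φ ≤ ρ F n`
    have hνw : -(|νmax| * ρ * (N + 1) * G * F n) ≤ ν * w n * Φ := by
      have hneg : -(|νmax| * ρ * (N + 1) * G * F n) ≤ 0 := by
        have := (hF n).le
        rw [neg_nonpos]; positivity
      rcases hA with h0 | hA
      · rw [h0]; simpa using hneg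
      · rcases le_total 0 (w n) with hw0 | hw0
        · exact hneg.trans (by positivity)
        · have h1 := hA hw0
          have h2 : ν * (-w n) * Φ ≤ |νmax| * ((N + 1) * G) * (ρ * F n) := by
            have h3 : ν * (-w n) ≤ |νmax| * ((N + 1) * G) :=
              mul_le_mul hνm' (by linarith) (by linarith) (abs_nonneg _)
            exact mul_le_mul h3 h1 hΦ0 (by positivity)
          linarith
    have h2 := mul_le_mul_of_nonneg_left (hprod n) (hF n).le
    have key : F n * -(Cn * G) ≤ F n * w' n := by
      have e1 : F n * -(Cn * G) = -(|K| / f₀ * (F n * (G / ε))) - |νmax| * (F n * (G / ε))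
          + F n * -((2 * |M| + |νmax|) * (N + 1) * G) - |νmax| * ρ * (N + 1) * G * F n := by
        rw [hCn]; ring
      rw [e1]
      linarith
    exact le_of_mul_le_mul_left key (hF n)
  have hall : ∀ k, -((Cα + Cn) * G) ≤ w' k := by
    intro k
    have h1 := mul_nonneg hCα0 hG0.le
    have h2 := mul_nonneg hCn0 hG0.le
    by_cases hk : k = n
    · rw [hk]; linarith
    · have := htan k hk; linarith
  have hsum := Finset.sum_le_sum fun k (_ : k ∈ Finset.univ) => hall k
  simp only [Finset.sum_const, Finset.card_univ, Fintype.card_fin, nsmul_eq_mul] at hsum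
  have hpq : -((|M| + |νmax|) * (N + 4) * G) ≤ ∑ k, p k * q n k := by
    have s1 := Finset.add_sum_erase Finset.univ (fun k => p k * q n k) (Finset.mem_univ n)
    have s2 : ∑ k ∈ Finset.univ.erase n, p k * q n k =
        -(p n * ∑ k ∈ Finset.univ.erase n, p k ^ 2) := by
      rw [Finset.mul_sum, ← Finset.sum_neg_distrib]
      refine Finset.sum_congr rfl fun k hk => ?_
      rw [hqn k (Finset.ne_of_mem_erase hk)]
      ring
    have hR0 : 0 ≤ ∑ k ∈ Finset.univ.erase n, p k ^ 2 := Finset.sum_nonneg fun _ _ => sq_nonneg _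
    have s3 := Finset.add_sum_erase Finset.univ (fun k => p k ^ 2) (Finset.mem_univ n)
    have hpn' : |p n| ≤ |M| + |νmax| := by
      rw [hpn]
      refine (abs_sub _ _).trans ?_
      rw [abs_of_nonneg hν]; linarith
    have hqnn : |q n n| ≤ (N + 2) * G := by
      have h1 := abs_le.1 (hv n)
      have := sq_nonneg (p n)
      rw [abs_le]; constructor <;> linarith
    have t1 : |p n * q n n| ≤ (|M| + |νmax|) * ((N + 2) * G) := by
      rw [abs_mul]; exact mul_le_mul hpn' hqnn (abs_nonneg _) (by positivity)
    have t2 : |p n * ∑ k ∈ Finset.univ.erase n, p k ^ 2| ≤ (|M| + |νmax|) * (2 * G) := by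
      rw [abs_mul, abs_of_nonneg hR0]
      exact mul_le_mul hpn' (by linarith [sq_nonneg (p n)]) hR0 (by positivity)
    rw [← s1, s2]
    linarith [(abs_le.1 t1).1, (abs_le.1 t2).2]
  have h3 := mul_le_mul_of_nonneg_left hpq (show 0 ≤ (N : ℝ) + 1 by positivity)
  have h4 := hall a
  linarith

end Algebra

/-! ### The umbilic boundary -/

section Boundary

variable {m : ℕ} {r : ℝ} {g : Coord m → Matrix (Fin (m + 1)) (Fin (m + 1)) ℝ} {μ : Coord m → ℝ}

lemma mem_halfBall_of_bdy {x : Coord m} (h0 : x (Fin.last m) = 0) (h1 : ∑ i, x i ^ 2 < r ^ 2) :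
    x ∈ halfBall m r := ⟨h0.ge, h1.le⟩

lemma mem_flatBdy_of_bdy {x : Coord m} (h0 : x (Fin.last m) = 0) (h1 : ∑ i, x i ^ 2 < r ^ 2) :
    x ∈ flatBdy m r := ⟨h0, h1.le⟩

/-- Tangential derivatives of a function vanishing on the flat boundary vanish there. -/
lemma pd_tangential_eq_zero {φ : Coord m → ℝ}
    (hφ : DifferentiableOn ℝ φ (halfBall m r))
    (hz : ∀ x : Coord m, x (Fin.last m) = 0 → ∑ i, x i ^ 2 < r ^ 2 → φ x = 0)
    {x₀ : Coord m} (h0 : x₀ (Fin.last m) = 0) (h1 : ∑ i, x₀ i ^ 2 < r ^ 2) (a : Fin m) :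
    pd r a.castSucc φ x₀ = 0 := by
  set γ : ℝ → Coord m := fun t => x₀ + t • EuclideanSpace.single a.castSucc 1 with hγ
  have hγd : ∀ t, HasDerivAt γ (EuclideanSpace.single a.castSucc 1) t := by
    intro t
    have := ((hasDerivAt_id t).smul_const
      (EuclideanSpace.single a.castSucc 1 : Coord m)).const_add x₀
    rw [one_smul] at this
    exact this
  have hγc : Continuous γ := continuous_iff_continuousAt.2 fun t => (hγd t).continuousAt
  have hγ0 : ∀ t, γ t (Fin.last m) = 0 := by
    intro t
    simp [hγ, h0, (Fin.castSucc_lt_last a).ne']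
  have hev : ∀ᶠ t in 𝓝 (0 : ℝ), ∑ i, γ t i ^ 2 < r ^ 2 := by
    have hc : Continuous fun t => ∑ i, γ t i ^ 2 := by fun_prop
    refine hc.continuousAt.eventually_lt_const ?_
    simpa [hγ] using h1
  have hγx : γ 0 = x₀ := by simp [hγ]
  set I : Set ℝ := {t | ∑ i, γ t i ^ 2 < r ^ 2} with hI
  have h0I : (0 : ℝ) ∈ I := by
    change ∑ i, γ 0 i ^ 2 < r ^ 2
    rw [hγx]; exact h1
  have hd := hasDerivWithinAt_comp_curve h0I hφ (hγd 0).hasDerivWithinAt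
    (fun t ht => mem_halfBall_of_bdy (hγ0 t) ht)
  have hd' := hd.hasDerivAt hev
  have hz' : HasDerivAt (fun t => φ (γ t)) 0 0 := by
    refine (hasDerivAt_const (0 : ℝ) (0 : ℝ)).congr_of_eventuallyEq ?_
    filter_upwards [hev] with t ht using hz _ (hγ0 t) ht
  have := hd'.unique hz'
  rw [hγx] at this
  simpa [Pi.single_apply] using this

lemma IsFermiMetric.christoffel_last (hg : IsFermiMetric r g) {x : Coord m}
    (hx : x ∈ halfBall m r) (i j : Fin (m + 1)) :
    christoffel r g (Fin.last m) i j x = -(1 / 2) * pd r (Fin.last m) (fun y => g y i j) x := by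
  have h := hg.sum_mul_christoffel hx (Fin.last m) i j
  have e : ∑ k, g x (Fin.last m) k * christoffel r g k i j x =
      christoffel r g (Fin.last m) i j x := by
    rw [Finset.sum_eq_single (Fin.last m)]
    · rw [hg.last_eq hx]; simp
    · intro k _ hk
      rw [hg.symm hx, hg.last_eq hx]; simp [hk]
    · simp
  rw [e, hg.pd_last hx, hg.pd_last hx] at h
  rw [h]
  ring

lemma IsFermiMetric.christoffel_last_right (hg : IsFermiMetric r g) {x : Coord m}
    (hx : x ∈ halfBall m r) (i : Fin (m + 1)) :
    christoffel r g (Fin.last m) i (Fin.last m) x = 0 := by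
  rw [hg.christoffel_last hx, hg.pd_last hx, mul_zero]

lemma IsUmbilic.christoffel_last (hg : IsFermiMetric r g) (hum : IsUmbilic r g μ) {x : Coord m}
    (hx : x ∈ flatBdy m r) (a b : Fin m) :
    christoffel r g (Fin.last m) a.castSucc b.castSucc x = μ x * g x a.castSucc b.castSucc := by
  have hxB : x ∈ halfBall m r := ⟨hx.1.ge, hx.2⟩
  rw [← hum x hx a b]
  unfold secondFF
  rw [Finset.sum_eq_single (Fin.last m)]
  · rw [hg.last_eq hxB]; simp
  · intro k _ hk
    rw [hg.last_eq hxB]; simp [hk]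
  · simp

/-- The shape operator of the umbilic boundary. -/
lemma IsUmbilic.christoffel_normal (hg : IsFermiMetric r g) (hum : IsUmbilic r g μ) {x : Coord m}
    (hx : x ∈ flatBdy m r) (k : Fin (m + 1)) (a : Fin m) :
    christoffel r g k a.castSucc (Fin.last m) x = if k = a.castSucc then -μ x else 0 := by
  have hxB : x ∈ halfBall m r := ⟨hx.1.ge, hx.2⟩
  have h : ∀ b, ∑ k, g x b k * christoffel r g k a.castSucc (Fin.last m) x =
      -μ x * g x b a.castSucc := by
    intro b
    rw [hg.sum_mul_christoffel hxB, hg.pd_last hxB, hg.pd_last' hxB]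
    have h2 := hg.christoffel_last hxB a.castSucc b
    have h3 : christoffel r g (Fin.last m) a.castSucc b x = μ x * g x b a.castSucc := by
      refine Fin.lastCases ?_ (fun b => ?_) b
      · rw [hg.christoffel_last_right hxB, hg.symm hxB, hg.mixed x hxB, mul_zero]
      · rw [hum.christoffel_last hg hx, hg.symm hxB]
    linarith
  have hv : (g x).mulVec (fun k => christoffel r g k a.castSucc (Fin.last m) x) =
      (g x).mulVec (Pi.single a.castSucc (-μ x)) := by
    funext b
    simp only [Matrix.mulVec, dotProduct]
    rw [h b]
    simp [Pi.single_apply, mul_comm]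
  have hinj : Function.Injective (g x).mulVec :=
    Matrix.mulVec_injective_iff_isUnit.2 ((Matrix.isUnit_iff_isUnit_det _).2
      (isUnit_iff_ne_zero.2 (hg.det_pos hxB).ne'))
  have := congrFun (hinj hv) k
  simp only [Pi.single_apply] at this
  exact this

/-- The principal curvature of an umbilic hypersurface of a flat space is constant, by the Codazzi
equation; this needs at least two tangential directions. -/
lemma IsUmbilic.pd_eq_zero (hm : 2 ≤ m) (hr : 0 < r) (hg : IsFermiMetric r g) (hf : IsFlat r g)
    (hum : IsUmbilic r g μ)
    {M : Coord m → ℝ} (hM : DifferentiableOn ℝ M (halfBall m r))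
    (hMμ : ∀ x ∈ flatBdy m r, M x = μ x) {x : Coord m}
    (h0 : x (Fin.last m) = 0) (h1 : ∑ i, x i ^ 2 < r ^ 2) (a : Fin m) :
    pd r a.castSucc M x = 0 := by
  have hxB := mem_halfBall_of_bdy h0 h1
  have hxF := mem_flatBdy_of_bdy h0 h1
  have hgd : ∀ i j, DifferentiableOn ℝ (fun y => g y i j) (halfBall m r) := fun i j =>
    (hg.smooth i j).differentiableOn (by simp)
  have hΓd : ∀ k i j, DifferentiableOn ℝ (christoffel r g k i j) (halfBall m r) := fun k i j =>
    (hg.contDiffOn_christoffel hr k i j).differentiableOn (by simp)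
  have hpd : ∀ a b c : Fin m, pd r c.castSucc (christoffel r g (Fin.last m) a.castSucc b.castSucc) x
      = pd r c.castSucc M x * g x a.castSucc b.castSucc
        + μ x * pd r c.castSucc (fun y => g y a.castSucc b.castSucc) x := by
    intro a b c
    have h2 := pd_tangential_eq_zero (r := r) (φ := fun y =>
      christoffel r g (Fin.last m) a.castSucc b.castSucc y - M y * g y a.castSucc b.castSucc)
      ((hΓd _ _ _).sub (hM.mul (hgd _ _)))
      (fun y hy0 hy1 => by
        rw [hum.christoffel_last hg (mem_flatBdy_of_bdy hy0 hy1),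
          hMμ y (mem_flatBdy_of_bdy hy0 hy1), sub_self]) h0 h1 c
    rw [pd_sub hr hxB (hΓd _ _ _) (hM.fun_mul (hgd _ _)), pd_mul hr hxB hM (hgd _ _), hMμ x hxF] at h2
    linarith
  have hquad : ∀ a b c : Fin m, ∑ p, christoffel r g (Fin.last m) a.castSucc p x *
      christoffel r g p c.castSucc b.castSucc x =
      μ x * ((1 / 2) * (pd r c.castSucc (fun y => g y b.castSucc a.castSucc) x
        + pd r b.castSucc (fun y => g y c.castSucc a.castSucc) x
        - pd r a.castSucc (fun y => g y c.castSucc b.castSucc) x)) := by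
    intro a b c
    rw [← hg.sum_mul_christoffel hxB, Finset.mul_sum]
    refine Finset.sum_congr rfl fun p _ => ?_
    refine Fin.lastCases ?_ (fun p => ?_) p
    · rw [hg.christoffel_last_right hxB, hg.mixed x hxB]; ring
    · rw [hum.christoffel_last hg hxF]; ring
  have hcod : ∀ a b c : Fin m, pd r a.castSucc M x * g x c.castSucc b.castSucc =
      pd r c.castSucc M x * g x a.castSucc b.castSucc := by
    intro a b c
    have h2 := hf x hxB (Fin.last m) b.castSucc a.castSucc c.castSucc
    unfold riemann at h2
    rw [Finset.sum_sub_distrib, hpd, hpd, hquad, hquad] at h2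
    have e : ∀ l i j : Fin m, pd r l.castSucc (fun y => g y i.castSucc j.castSucc) x =
        pd r l.castSucc (fun y => g y j.castSucc i.castSucc) x := fun l i j =>
      pd_congr hxB fun y hy => hg.symm hy _ _
    rw [e c b a, e b c a, e a c b] at h2
    rw [e b a c, e c a b] at h2
    rw [e c b a] at h2
    linarith
  obtain ⟨c, hc⟩ : ∃ c : Fin m, c ≠ a := by
    have : Nontrivial (Fin m) := Fin.nontrivial_iff_two_le.2 hm
    exact exists_ne a
  have e1 := hcod a c c
  have e2 := hcod a a c
  set A := g x a.castSucc a.castSucc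
  set D := g x c.castSucc c.castSucc
  set Bc := g x a.castSucc c.castSucc with hBc
  rw [hg.symm hxB c.castSucc a.castSucc, ← hBc] at e2
  -- positivity of the 2 × 2 minor
  have hpos := (hg.posDef x hxB).dotProduct_mulVec_pos
    (x := (Pi.single a.castSucc D - Pi.single c.castSucc Bc : Fin (m + 1) → ℝ))
  have hD : 0 < D := (hg.posDef x hxB).diag_pos
  have hac : a.castSucc ≠ c.castSucc := fun h => hc (Fin.castSucc_injective m h).symm
  have hne : (Pi.single a.castSucc D - Pi.single c.castSucc Bc : Fin (m + 1) → ℝ) ≠ 0 := by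
    intro h
    have := congrFun h a.castSucc
    simp [hac] at this
    exact hD.ne' this
  have hpos' := hpos hne
  have hval : star (Pi.single a.castSucc D - Pi.single c.castSucc Bc : Fin (m + 1) → ℝ) ⬝ᵥ
      (g x).mulVec (Pi.single a.castSucc D - Pi.single c.castSucc Bc) = D * (A * D - Bc ^ 2) := by
    have e3 : g x c.castSucc a.castSucc = Bc := hg.symm hxB _ _
    rw [star_trivial, Matrix.mulVec_sub, sub_dotProduct, dotProduct_sub, dotProduct_sub]
    simp only [single_dotProduct, Matrix.mulVec_single, Matrix.col_apply, Pi.smul_apply,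
      MulOpposite.smul_eq_mul_unop, MulOpposite.unop_op]
    rw [e3]
    change D * (A * D) - D * (Bc * Bc) - (Bc * (Bc * D) - Bc * (D * Bc)) = _
    ring
  rw [hval] at hpos'
  have hdet : 0 < A * D - Bc ^ 2 := (mul_pos_iff_of_pos_left hD).1 hpos'
  have : pd r a.castSucc M x * (A * D - Bc ^ 2) = 0 := by
    linear_combination A * e1 - Bc * e2
  exact (mul_eq_zero.1 this).resolve_right hdet.ne'

variable {Γ : Set (Fin (m + 1) → ℝ)} {F : (Fin (m + 1) → ℝ) → ℝ} {μhat : ℝ}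
  {f u : Coord m → ℝ}

/-- The boundary condition differentiated along the boundary. -/
lemma IsSolution.pd_pd_last (hm : 2 ≤ m) (hr : 0 < r) (hg : IsFermiMetric r g) (hf : IsFlat r g)
    (hum : IsUmbilic r g μ) (hu : IsSolution r g Γ F μ μhat f u) {x : Coord m}
    (h0 : x (Fin.last m) = 0) (h1 : ∑ i, x i ^ 2 < r ^ 2) (a : Fin m) :
    pd r a.castSucc (pd r (Fin.last m) u) x =
      -(μhat * Real.exp (-u x)) * pd r a.castSucc u x := by
  have hxB := mem_halfBall_of_bdy h0 h1
  have hud : DifferentiableOn ℝ u (halfBall m r) := hu.smooth.differentiableOn (by norm_num)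
  have hund : DifferentiableOn ℝ (pd r (Fin.last m) u) (halfBall m r) :=
    (contDiffOn_pd hr (k := 3) hu.smooth (by norm_num) _).differentiableOn (by norm_num)
  have hnegd : DifferentiableOn ℝ (fun y => -1 * u y) (halfBall m r) :=
    (differentiableOn_const _).mul hud
  have hexp : DifferentiableOn ℝ (fun y => Real.exp (-1 * u y)) (halfBall m r) := hnegd.exp
  have hexp' : DifferentiableOn ℝ (fun y => μhat * Real.exp (-1 * u y)) (halfBall m r) :=
    (differentiableOn_const _).mul hexp
  have h := hum.pd_eq_zero hm hr hg hf
    (M := fun y => μhat * Real.exp (-1 * u y) - pd r (Fin.last m) u y) (hexp'.sub hund)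
    (fun y hy => by have := hu.bdy y hy; rw [neg_one_mul]; linarith) h0 h1 a
  rw [pd_sub hr hxB hexp' hund, pd_const_mul hr hxB _ hexp, pd_exp hr hxB hnegd,
    pd_const_mul hr hxB _ hud, neg_one_mul (u x)] at h
  linarith

/-- On the boundary the mixed part of `∇²u + du ⊗ du` vanishes. -/
lemma IsSolution.cov1_mixed (hm : 2 ≤ m) (hr : 0 < r) (hg : IsFermiMetric r g) (hf : IsFlat r g)
    (hum : IsUmbilic r g μ) (hu : IsSolution r g Γ F μ μhat f u) {x : Coord m}
    (h0 : x (Fin.last m) = 0) (h1 : ∑ i, x i ^ 2 < r ^ 2) (a : Fin m) :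
    cov1 r g (fun i => pd r i u) a.castSucc (Fin.last m) x =
      -pd r (Fin.last m) u x * pd r a.castSucc u x := by
  have hxF := mem_flatBdy_of_bdy h0 h1
  unfold cov1
  rw [hu.pd_pd_last hm hr hg hf hum h0 h1]
  simp only [hum.christoffel_normal hg hxF, ite_mul, zero_mul, Finset.sum_ite_eq',
    Finset.mem_univ, if_true]
  have := hu.bdy x hxF
  linear_combination (pd r a.castSucc u x) * this

/-- The components `u_{anb}` of the third covariant derivatives on the boundary. -/
lemma IsSolution.cov2_mixed (hm : 2 ≤ m) (hr : 0 < r) (hg : IsFermiMetric r g) (hf : IsFlat r g)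
    (hum : IsUmbilic r g μ) (hu : IsSolution r g Γ F μ μhat f u) {x : Coord m}
    (h0 : x (Fin.last m) = 0) (h1 : ∑ i, x i ^ 2 < r ^ 2) (a b : Fin m) :
    cov2 r g (cov1 r g (fun i => pd r i u)) a.castSucc (Fin.last m) b.castSucc x =
      μhat * Real.exp (-u x) * (pd r a.castSucc u x * pd r b.castSucc u x)
      + (μ x - pd r (Fin.last m) u x) * cov1 r g (fun i => pd r i u) a.castSucc b.castSucc x
      - μ x * g x a.castSucc b.castSucc * (pd r (Fin.last m) u x ^ 2
        + cov1 r g (fun i => pd r i u) (Fin.last m) (Fin.last m) x) := by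
  have hxB := mem_halfBall_of_bdy h0 h1
  have hxF := mem_flatBdy_of_bdy h0 h1
  have hu2 : ContDiffOn ℝ 2 u (halfBall m r) := hu.smooth.of_le (by norm_num)
  have hu1 : ∀ i, ContDiffOn ℝ 3 (pd r i u) (halfBall m r) := fun i =>
    contDiffOn_pd hr hu.smooth (by norm_num) i
  have hu1d : ∀ i, DifferentiableOn ℝ (pd r i u) (halfBall m r) := fun i =>
    (hu1 i).differentiableOn (by norm_num)
  have hH : ∀ i j, DifferentiableOn ℝ (cov1 r g (fun i => pd r i u) i j) (halfBall m r) := by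
    intro i j
    unfold cov1
    refine DifferentiableOn.fun_sub
      ((contDiffOn_pd hr (k := 2) (hu1 j) (by norm_num) i).differentiableOn (by norm_num))
      (DifferentiableOn.fun_sum fun p _ => ?_)
    exact ((hg.contDiffOn_christoffel hr p i j).differentiableOn (by simp)).mul (hu1d p)
  have hsymm : ∀ (y : Coord m) (_ : y ∈ halfBall m r) i j, cov1 r g (fun i => pd r i u) i j y =
      cov1 r g (fun i => pd r i u) j i y := fun y hy i j => cov1_symm hr hg hu2 hy i j
  have hmixed : ∀ (y : Coord m), y (Fin.last m) = 0 → ∑ i, y i ^ 2 < r ^ 2 → ∀ c : Fin m,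
      cov1 r g (fun i => pd r i u) (Fin.last m) c.castSucc y =
        -pd r (Fin.last m) u y * pd r c.castSucc u y := fun y hy0 hy1 c => by
    rw [hsymm y (mem_halfBall_of_bdy hy0 hy1)]
    exact hu.cov1_mixed hm hr hg hf hum hy0 hy1 c
  -- the tangential derivative of the mixed components
  have hd : pd r a.castSucc (cov1 r g (fun i => pd r i u) (Fin.last m) b.castSucc) x =
      -(pd r a.castSucc (pd r (Fin.last m) u) x * pd r b.castSucc u x
        + pd r (Fin.last m) u x * pd r a.castSucc (pd r b.castSucc u) x) := by
    have h2 := pd_tangential_eq_zero (r := r) (φ := fun y =>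
      cov1 r g (fun i => pd r i u) (Fin.last m) b.castSucc y
        + pd r (Fin.last m) u y * pd r b.castSucc u y)
      ((hH _ _).add ((hu1d _).mul (hu1d _)))
      (fun y hy0 hy1 => by rw [hmixed y hy0 hy1]; ring) h0 h1 a
    have e : pd r a.castSucc (cov1 r g (fun i => pd r i u) (Fin.last m) b.castSucc) x =
      pd r a.castSucc (fun y => cov1 r g (fun i => pd r i u) (Fin.last m) b.castSucc y) x := rfl
    rw [pd_add hr hxB (hH _ _) ((hu1d _).fun_mul (hu1d _)), pd_mul hr hxB (hu1d _) (hu1d _)] at h2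
    rw [e]
    linarith
  have hab : pd r a.castSucc (pd r b.castSucc u) x =
      cov1 r g (fun i => pd r i u) a.castSucc b.castSucc x
        + (∑ c : Fin m, christoffel r g c.castSucc a.castSucc b.castSucc x * pd r c.castSucc u x
          + μ x * g x a.castSucc b.castSucc * pd r (Fin.last m) u x) := by
    unfold cov1
    rw [Fin.sum_univ_castSucc, hum.christoffel_last hg hxF]
    ring
  unfold cov2
  rw [hd, hu.pd_pd_last hm hr hg hf hum h0 h1, hab]
  simp only [hum.christoffel_normal hg hxF, ite_mul, zero_mul, Finset.sum_ite_eq',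
    Finset.mem_univ, if_true]
  rw [Fin.sum_univ_castSucc, hum.christoffel_last hg hxF]
  simp only [hmixed x h0 h1]
  have e3 : ∑ c : Fin m, christoffel r g c.castSucc a.castSucc b.castSucc x *
      (-pd r (Fin.last m) u x * pd r c.castSucc u x) =
      -pd r (Fin.last m) u x *
        ∑ c : Fin m, christoffel r g c.castSucc a.castSucc b.castSucc x * pd r c.castSucc u x := by
    rw [Finset.mul_sum]
    exact Finset.sum_congr rfl fun c _ => by ring
  rw [e3]
  ring

/-- The third derivatives `u_{αnα}` on the boundary, in a frame adapted to the boundary. -/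
lemma IsSolution.ev3_mixed (hm : 2 ≤ m) (hr : 0 < r) (hg : IsFermiMetric r g) (hf : IsFlat r g)
    (hum : IsUmbilic r g μ) (hu : IsSolution r g Γ F μ μhat f u) {x : Coord m}
    (h0 : x (Fin.last m) = 0) (h1 : ∑ i, x i ^ 2 < r ^ 2)
    {E : Fin (m + 1) → Fin (m + 1) → ℝ} (hE : IsOrtho g x E)
    (hEn : E (Fin.last m) = Pi.single (Fin.last m) 1) {α : Fin (m + 1)}
    (hEα : E α (Fin.last m) = 0) :
    ev3 (cov2 r g (cov1 r g (fun i => pd r i u))) E α (Fin.last m) α x =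
      μhat * Real.exp (-u x) * ev1 (fun i => pd r i u) E α x ^ 2
      + (μ x - ev1 (fun i => pd r i u) E (Fin.last m) x)
        * ev2 (cov1 r g (fun i => pd r i u)) E α α x
      - μ x * (ev1 (fun i => pd r i u) E (Fin.last m) x ^ 2
        + ev2 (cov1 r g (fun i => pd r i u)) E (Fin.last m) (Fin.last m) x) := by
  have en1 : ev1 (fun i => pd r i u) E (Fin.last m) x = pd r (Fin.last m) u x := by
    simp [ev1, hEn, Pi.single_apply]
  have en2 : ev2 (cov1 r g (fun i => pd r i u)) E (Fin.last m) (Fin.last m) x =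
      cov1 r g (fun i => pd r i u) (Fin.last m) (Fin.last m) x := by
    simp [ev2, hEn, Pi.single_apply]
  have en3 : ev3 (cov2 r g (cov1 r g (fun i => pd r i u))) E α (Fin.last m) α x =
      ev2 (fun k j => cov2 r g (cov1 r g (fun i => pd r i u)) k (Fin.last m) j) E α α x := by
    simp [ev3, ev2, hEn, Pi.single_apply]
  have hαα := hE α α
  rw [if_pos rfl] at hαα
  set ν := μhat * Real.exp (-u x)
  set c1 := μ x - pd r (Fin.last m) u x with hc1
  set c2 := μ x * (pd r (Fin.last m) u x ^ 2
      + cov1 r g (fun i => pd r i u) (Fin.last m) (Fin.last m) x) with hc2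
  have key : ev2 (fun k j => cov2 r g (cov1 r g (fun i => pd r i u)) k (Fin.last m) j) E α α x =
      ev2 (fun i j y => (ν * (pd r i u y * pd r j u y)
        + c1 * cov1 r g (fun i => pd r i u) i j y) - c2 * g y i j) E α α x := by
    simp only [ev2]
    refine Finset.sum_congr rfl fun j _ => ?_
    refine Fin.lastCases ?_ (fun b => ?_) j
    · rw [hEα, mul_zero, mul_zero]
    · congr 1
      refine Finset.sum_congr rfl fun i _ => ?_
      refine Fin.lastCases ?_ (fun a => ?_) i
      · rw [hEα, mul_zero, mul_zero]
      · rw [hu.cov2_mixed hm hr hg hf hum h0 h1]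
        congr 1
        rw [hc1, hc2]
        ring
  rw [en3, key, en1, en2,
    ev2_sub (fun i j y => ν * (pd r i u y * pd r j u y) + c1 * cov1 r g (fun i => pd r i u) i j y)
      (fun i j y => c2 * g y i j),
    ev2_add (fun i j y => ν * (pd r i u y * pd r j u y))
      (fun i j y => c1 * cov1 r g (fun i => pd r i u) i j y),
    ev2_smul (fun _ => ν) (fun i j y => pd r i u y * pd r j u y),
    ev2_smul (fun _ => c1) (cov1 r g (fun i => pd r i u)),
    ev2_smul (fun _ => c2) (fun i j y => g y i j),
    ev2_mul (fun i => pd r i u) (fun i => pd r i u), hαα]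
  ring

end Boundary

/-! ### Symmetries of the covariant derivatives of a function -/

section Symmetries

variable {m : ℕ} {r : ℝ} {g : Coord m → Matrix (Fin (m + 1)) (Fin (m + 1)) ℝ}

lemma contDiffOn_cov1 (hr : 0 < r) (hg : IsFermiMetric r g) {k l : ℕ∞ω} (hk : k + 1 ≤ l)
    (hl : l ≤ ∞)
    {S : Fin (m + 1) → Coord m → ℝ} (hS : ∀ i, ContDiffOn ℝ l (S i) (halfBall m r))
    (i j : Fin (m + 1)) : ContDiffOn ℝ k (cov1 r g S i j) (halfBall m r) := by
  have hkl : k ≤ l := le_self_add.trans hk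
  exact (contDiffOn_pd hr (hS j) hk i).sub (ContDiffOn.sum fun p _ =>
    ((hg.contDiffOn_christoffel hr p i j).of_le (hkl.trans hl)).mul ((hS p).of_le hkl))

lemma contDiffOn_cov2 (hr : 0 < r) (hg : IsFermiMetric r g) {k l : ℕ∞ω} (hk : k + 1 ≤ l)
    (hl : l ≤ ∞) {S : Fin (m + 1) → Fin (m + 1) → Coord m → ℝ}
    (hS : ∀ i j, ContDiffOn ℝ l (S i j) (halfBall m r))
    (a i j : Fin (m + 1)) : ContDiffOn ℝ k (cov2 r g S a i j) (halfBall m r) := by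
  have hkl : k ≤ l := le_self_add.trans hk
  refine ((contDiffOn_pd hr (hS i j) hk a).sub (ContDiffOn.sum fun p _ => ?_)).sub
    (ContDiffOn.sum fun p _ => ?_)
  · exact ((hg.contDiffOn_christoffel hr _ _ _).of_le (hkl.trans hl)).mul ((hS _ _).of_le hkl)
  · exact ((hg.contDiffOn_christoffel hr _ _ _).of_le (hkl.trans hl)).mul ((hS _ _).of_le hkl)

lemma cov2_symm_right {S : Fin (m + 1) → Fin (m + 1) → Coord m → ℝ}
    (hS : ∀ x ∈ halfBall m r, ∀ i j, S i j x = S j i x) {x : Coord m} (hx : x ∈ halfBall m r)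
    (k i j : Fin (m + 1)) : cov2 r g S k i j x = cov2 r g S k j i x := by
  unfold cov2
  rw [pd_congr (w := S j i) hx (fun y hy => hS y hy i j)]
  simp only [hS x hx _ j, hS x hx i _]
  ring

lemma cov3_symm_left {S : Fin (m + 1) → Fin (m + 1) → Fin (m + 1) → Coord m → ℝ}
    (hS : ∀ x ∈ halfBall m r, ∀ k i j, S k i j x = S i k j x) {x : Coord m}
    (hx : x ∈ halfBall m r) (l k i j : Fin (m + 1)) :
    cov3 r g S l k i j x = cov3 r g S l i k j x := by
  unfold cov3
  rw [pd_congr (w := S i k j) hx (fun y hy => hS y hy k i j)]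
  have e1 : ∀ p, S p i j x = S i p j x := fun p => hS x hx _ _ _
  have e2 : ∀ p, S k p j x = S p k j x := fun p => hS x hx _ _ _
  have e3 : ∀ p, S k i p x = S i k p x := fun p => hS x hx _ _ _
  simp only [e1, e2, e3]
  ring

lemma cov3_symm_right {S : Fin (m + 1) → Fin (m + 1) → Fin (m + 1) → Coord m → ℝ}
    (hS : ∀ x ∈ halfBall m r, ∀ k i j, S k i j x = S k j i x) {x : Coord m}
    (hx : x ∈ halfBall m r) (l k i j : Fin (m + 1)) :
    cov3 r g S l k i j x = cov3 r g S l k j i x := by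
  unfold cov3
  rw [pd_congr (w := S k j i) hx (fun y hy => hS y hy k i j)]
  have e1 : ∀ p, S p i j x = S p j i x := fun p => hS x hx _ _ _
  have e2 : ∀ p, S k p j x = S k j p x := fun p => hS x hx _ _ _
  have e3 : ∀ p, S k i p x = S k p i x := fun p => hS x hx _ _ _
  simp only [e1, e2, e3]
  ring

variable {x : Coord m} {E : Fin (m + 1) → Fin (m + 1) → ℝ}

lemma ev2_symm {S : Fin (m + 1) → Fin (m + 1) → Coord m → ℝ} (hS : ∀ i j, S i j x = S j i x)
    (a b : Fin (m + 1)) : ev2 S E a b x = ev2 S E b a x := by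
  simp only [ev2, Finset.sum_mul]
  rw [Finset.sum_comm]
  exact Finset.sum_congr rfl fun i _ => Finset.sum_congr rfl fun j _ => by rw [hS]; ring

lemma ev3_symm_left {S : Fin (m + 1) → Fin (m + 1) → Fin (m + 1) → Coord m → ℝ}
    (hS : ∀ k i j, S k i j x = S i k j x) (a b c : Fin (m + 1)) :
    ev3 S E a b c x = ev3 S E b a c x := by
  unfold ev3
  refine Finset.sum_congr rfl fun j _ => ?_
  congr 1
  exact ev2_symm (S := fun k i => S k i j) (fun k i => hS k i j) a b

lemma ev3_symm_right {S : Fin (m + 1) → Fin (m + 1) → Fin (m + 1) → Coord m → ℝ}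
    (hS : ∀ k i j, S k i j x = S k j i x) (a b c : Fin (m + 1)) :
    ev3 S E a b c x = ev3 S E a c b x := by
  exact ev2_symm (S := fun i j y => ∑ k, S k i j y * E a k)
    (fun i j => Finset.sum_congr rfl fun k _ => by rw [hS]) b c

lemma ev4_symm_pair {S : Fin (m + 1) → Fin (m + 1) → Fin (m + 1) → Fin (m + 1) → Coord m → ℝ}
    (hS : ∀ l k i j, S l k i j x = S i j l k x) (a b c d : Fin (m + 1)) :
    ev4 S E a b c d x = ev4 S E c d a b x := by
  have e : ∀ a b c d, ev4 S E a b c d x =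
      ∑ i, ∑ j, ∑ l, ∑ k, S l k i j x * (E a l * E b k * E c i * E d j) := by
    intro a b c d
    simp only [ev4, Finset.sum_mul]
    rw [Finset.sum_comm]
    refine Finset.sum_congr rfl fun i _ => Finset.sum_congr rfl fun j _ => ?_
    rw [Finset.sum_comm]
    exact Finset.sum_congr rfl fun l _ => Finset.sum_congr rfl fun k _ => by ring
  rw [e, e]
  calc _ = ∑ i, ∑ l, ∑ j, ∑ k, S l k i j x * (E a l * E b k * E c i * E d j) :=
        Finset.sum_congr rfl fun i _ => Finset.sum_comm
    _ = ∑ l, ∑ i, ∑ j, ∑ k, S l k i j x * (E a l * E b k * E c i * E d j) := Finset.sum_comm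
    _ = ∑ l, ∑ i, ∑ k, ∑ j, S l k i j x * (E a l * E b k * E c i * E d j) :=
        Finset.sum_congr rfl fun l _ => Finset.sum_congr rfl fun i _ => Finset.sum_comm
    _ = ∑ l, ∑ k, ∑ i, ∑ j, S l k i j x * (E a l * E b k * E c i * E d j) :=
        Finset.sum_congr rfl fun l _ => Finset.sum_comm
    _ = _ := Finset.sum_congr rfl fun l _ => Finset.sum_congr rfl fun k _ =>
        Finset.sum_congr rfl fun i _ => Finset.sum_congr rfl fun j _ => by rw [hS]; ring

/-- For a flat metric the third covariant derivatives of a function are symmetric. -/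
lemma third_symm_left (hr : 0 < r) (hg : IsFermiMetric r g) (hf : IsFlat r g) {u : Coord m → ℝ}
    (hu : ContDiffOn ℝ 4 u (halfBall m r)) (hx : x ∈ halfBall m r) (k i j : Fin (m + 1)) :
    cov2 r g (cov1 r g fun i => pd r i u) k i j x = cov2 r g (cov1 r g fun i => pd r i u) i k j x :=
  cov2_cov1_symm hr hg hf (fun i => contDiffOn_pd hr hu (by norm_num) i) hx k i j

lemma third_symm_right (hr : 0 < r) (hg : IsFermiMetric r g) {u : Coord m → ℝ}
    (hu : ContDiffOn ℝ 4 u (halfBall m r)) (hx : x ∈ halfBall m r) (k i j : Fin (m + 1)) :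
    cov2 r g (cov1 r g fun i => pd r i u) k i j x = cov2 r g (cov1 r g fun i => pd r i u) k j i x :=
  cov2_symm_right (fun _ hy i j => cov1_symm hr hg (hu.of_le (by norm_num)) hy i j) hx k i j

/-- For a flat metric the fourth covariant derivatives of a function are symmetric. -/
lemma fourth_symm_pair (hr : 0 < r) (hg : IsFermiMetric r g) (hf : IsFlat r g) {u : Coord m → ℝ}
    (hu : ContDiffOn ℝ 4 u (halfBall m r)) (hx : x ∈ halfBall m r) (l k i j : Fin (m + 1)) :
    cov3 r g (cov2 r g (cov1 r g fun i => pd r i u)) l k i j x =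
      cov3 r g (cov2 r g (cov1 r g fun i => pd r i u)) i j l k x := by
  have hu2 : ∀ i j, ContDiffOn ℝ 2 (cov1 r g (fun i => pd r i u) i j) (halfBall m r) :=
    contDiffOn_cov1 hr hg (l := 3) (by norm_num) (WithTop.coe_le_coe.2 le_top)
      (fun i => contDiffOn_pd hr hu (by norm_num) i)
  have s12 := fun l k i j => cov3_cov2_symm hr hg hf hu2 hx l k i j
  have s23 := fun l k i j => cov3_symm_left (r := r) (g := g)
    (fun y hy k i j => third_symm_left hr hg hf hu hy k i j) hx l k i j
  have s34 := fun l k i j => cov3_symm_right (r := r) (g := g)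
    (fun y hy k i j => third_symm_right hr hg hu hy k i j) hx l k i j
  rw [s23 l k i j, s12 l i k j, s34 i l k j, s23 i l j k]

end Symmetries

/-! ### Bounds in orthonormal frames -/

section Bounds

variable {m : ℕ} {r : ℝ} {g : Coord m → Matrix (Fin (m + 1)) (Fin (m + 1)) ℝ}

lemma IsOrtho.abs_apply_le {Λ : ℝ} (hΛ : ChartBound r g Λ) {x : Coord m} (hx : x ∈ halfBall m r)
    {E : Fin (m + 1) → Fin (m + 1) → ℝ} (hE : IsOrtho g x E) (a i : Fin (m + 1)) :
    |E a i| ≤ 1 + |Λ| := by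
  have h1 := hΛ.1 x hx (E a)
  have h2 := hE a a
  rw [if_pos rfl] at h2
  have h3 : ∑ i, ∑ j, g x i j * E a i * E a j = 1 := by
    rw [← h2]
    simp only [ev2, Finset.sum_mul]
    exact Finset.sum_comm
  rw [h3, mul_one] at h1
  have h4 : E a i ^ 2 ≤ Λ := (Finset.single_le_sum (f := fun i => E a i ^ 2)
    (fun _ _ => sq_nonneg _) (Finset.mem_univ i)).trans h1
  refine abs_le_of_sq_le_sq ?_ (by positivity)
  have := le_abs_self Λ
  nlinarith [abs_nonneg Λ]

lemma IsFermiMetric.exists_isOrtho (hg : IsFermiMetric r g) {x : Coord m}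
    (hx : x ∈ halfBall m r) : ∃ E : Fin (m + 1) → Fin (m + 1) → ℝ, IsOrtho g x E := by
  obtain ⟨E, l, hE, -⟩ := exists_diagonal_frame (hg.posDef x hx) (Matrix.isHermitian_one)
  exact ⟨E, isOrtho_of_mul_eq_one hE⟩

/-- First and second covariant derivatives of a function with `C²` bound are controlled in
orthonormal frames by the chart constant. -/
lemma exists_frame_bound (m : ℕ) (Λ b : ℝ) : ∃ C : ℝ, 0 ≤ C ∧
    ∀ (r : ℝ) (g : Coord m → Matrix (Fin (m + 1)) (Fin (m + 1)) ℝ) (φ : Coord m → ℝ),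
      IsFermiMetric r g → ChartBound r g Λ → C2Bound r b φ →
      ∀ x ∈ halfBall m r, ∀ E, IsOrtho g x E → ∀ a,
        |ev1 (fun i => pd r i φ) E a x| ≤ C ∧ |ev2 (cov1 r g fun i => pd r i φ) E a a x| ≤ C := by
  set L : ℝ := 1 + |Λ| with hL
  have hL0 : 0 ≤ L := by positivity
  set γ : ℝ := (1 / 2) * ((m + 1) * (((m + 1) * (L * L)) * (3 * |Λ|))) with hγ
  have hγ0 : 0 ≤ γ := by positivity
  set β : ℝ := |b| + (m + 1) * (γ * |b|) with hβ
  have hβ0 : 0 ≤ β := by positivity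
  have hsum : ∀ {v : Fin (m + 1) → ℝ} {c : ℝ}, (∀ i, |v i| ≤ c) → |∑ i, v i| ≤ (m + 1) * c := by
    intro v c h
    refine (Finset.abs_sum_le_sum_abs _ _).trans ((Finset.sum_le_sum fun i _ => h i).trans_eq ?_)
    simp
  refine ⟨(m + 1) * (|b| * L) + (m + 1) * ((m + 1) * (β * L) * L), by positivity, ?_⟩
  intro r g φ hg hΛ hφ x hx E hE a
  have hEb := fun a i => hE.abs_apply_le hΛ hx a i
  have hpd : ∀ i, |pd r i φ x| ≤ |b| := fun i => ((hφ x hx).2.1 i).trans (le_abs_self b)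
  have hpd2 : ∀ i j, |pd r i (pd r j φ) x| ≤ |b| := fun i j =>
    ((hφ x hx).2.2 i j).trans (le_abs_self b)
  have hinv : ∀ i j, |(g x)⁻¹ i j| ≤ (m + 1) * (L * L) := by
    intro i j
    rw [hE.inv_apply]
    refine hsum fun a => ?_
    rw [abs_mul]
    exact mul_le_mul (hEb a i) (hEb a j) (abs_nonneg _) hL0
  have hΓ : ∀ k i j, |christoffel r g k i j x| ≤ γ := by
    intro k i j
    unfold christoffel
    rw [abs_mul, abs_of_pos (show (0 : ℝ) < 1 / 2 by norm_num)]
    refine mul_le_mul_of_nonneg_left (hsum fun l => ?_) (by norm_num)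
    rw [abs_mul]
    refine mul_le_mul (hinv k l) ?_ (abs_nonneg _) (by positivity)
    have h1 := fun i j l => ((hΛ.2 i j x hx).2.1 l).trans (le_abs_self Λ)
    refine (abs_sub _ _).trans ((add_le_add (abs_add_le _ _) le_rfl).trans ?_)
    linarith [h1 j l i, h1 i l j, h1 i j l]
  have hcov : ∀ i j, |cov1 r g (fun i => pd r i φ) i j x| ≤ β := by
    intro i j
    unfold cov1
    refine (abs_sub _ _).trans (add_le_add (hpd2 i j) (hsum fun p => ?_))
    rw [abs_mul]
    exact mul_le_mul (hΓ p i j) (hpd p) (abs_nonneg _) hγ0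
  constructor
  · have : |ev1 (fun i => pd r i φ) E a x| ≤ (m + 1) * (|b| * L) := by
      refine hsum fun i => ?_
      rw [abs_mul]
      exact mul_le_mul (hpd i) (hEb a i) (abs_nonneg _) (abs_nonneg _)
    refine this.trans (le_add_of_nonneg_right (by positivity))
  · have : |ev2 (cov1 r g fun i => pd r i φ) E a a x| ≤ (m + 1) * ((m + 1) * (β * L) * L) := by
      refine hsum fun j => ?_
      rw [abs_mul]
      refine mul_le_mul (hsum fun i => ?_) (hEb a j) (abs_nonneg _) (by positivity)
      rw [abs_mul]
      exact mul_le_mul (hcov i j) (hEb a i) (abs_nonneg _) hβ0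
    refine this.trans (le_add_of_nonneg_left (by positivity))

end Bounds

/-! ### Derivative tests at a maximum -/

section Interior

/-- The second derivative test at a maximum, for a function whose derivative is assumed
differentiable only at the centre. -/
lemma second_deriv_test {φ φ' : ℝ → ℝ} {φ'' δ : ℝ} (hδ : 0 < δ)
    (h1 : ∀ t ∈ Ioo (-δ) δ, HasDerivWithinAt φ (φ' t) (Ioo (-δ) δ) t)
    (h2 : HasDerivWithinAt φ' φ'' (Ioo (-δ) δ) 0)
    (hmax : ∀ t ∈ Ioo (-δ) δ, φ t ≤ φ 0) : φ' 0 = 0 ∧ φ'' ≤ 0 := by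
  have hnhds : Ioo (-δ) δ ∈ 𝓝 (0 : ℝ) := Ioo_mem_nhds (by linarith) hδ
  have h0 : (0 : ℝ) ∈ Ioo (-δ) δ := ⟨by linarith, hδ⟩
  have hd : ∀ t ∈ Ioo (-δ) δ, HasDerivAt φ (φ' t) t := fun t ht =>
    (h1 t ht).hasDerivAt (Ioo_mem_nhds ht.1 ht.2)
  have hd2 : HasDerivAt φ' φ'' 0 := h2.hasDerivAt hnhds
  have hloc : IsLocalMax φ 0 := by
    filter_upwards [hnhds] with t ht using hmax t ht
  have hz : φ' 0 = 0 := hloc.hasDerivAt_eq_zero (hd 0 h0)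
  refine ⟨hz, ?_⟩
  -- otherwise the centre is also a local minimum, so that `φ` is locally constant
  by_contra hpos
  push Not at hpos
  have hev : deriv φ =ᶠ[𝓝 0] φ' := by
    filter_upwards [hnhds] with t ht using (hd t ht).deriv
  have hdd : deriv (deriv φ) 0 = φ'' := by rw [hev.deriv_eq, hd2.deriv]
  have hmin : IsLocalMin φ 0 := isLocalMin_of_deriv_deriv_pos (by rw [hdd]; exact hpos)
    (by rw [(hd 0 h0).deriv, hz]) (hd 0 h0).continuousAt
  have hconst : ∀ᶠ t in 𝓝 (0 : ℝ), φ t = φ 0 := by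
    filter_upwards [hloc, hmin] with t ht1 ht2 using le_antisymm ht1 ht2
  have hconst' : φ =ᶠ[𝓝 0] fun _ => φ 0 := hconst
  have h3 : deriv φ =ᶠ[𝓝 0] deriv fun _ => φ 0 := hconst'.deriv
  have h4 : deriv (deriv φ) 0 = 0 := by
    rw [h3.deriv_eq]; simp
  rw [hdd] at h4
  exact hpos.ne' h4

/-- First and second derivative test for a product `θ²G`. -/
lemma second_deriv_test_mul {θ θ' G G' : ℝ → ℝ} {θ'' G'' δ : ℝ} (hδ : 0 < δ)
    (hθ : ∀ t ∈ Ioo (-δ) δ, HasDerivWithinAt θ (θ' t) (Ioo (-δ) δ) t)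
    (hθ' : HasDerivWithinAt θ' θ'' (Ioo (-δ) δ) 0)
    (hG : ∀ t ∈ Ioo (-δ) δ, HasDerivWithinAt G (G' t) (Ioo (-δ) δ) t)
    (hG' : HasDerivWithinAt G' G'' (Ioo (-δ) δ) 0)
    (hmax : ∀ t ∈ Ioo (-δ) δ, θ t ^ 2 * G t ≤ θ 0 ^ 2 * G 0) :
    2 * θ 0 * θ' 0 * G 0 + θ 0 ^ 2 * G' 0 = 0 ∧
      (2 * θ' 0 ^ 2 + 2 * θ 0 * θ'') * G 0 + 4 * θ 0 * θ' 0 * G' 0 + θ 0 ^ 2 * G'' ≤ 0 := by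
  have h0 : (0 : ℝ) ∈ Ioo (-δ) δ := ⟨by linarith, hδ⟩
  have h := second_deriv_test (φ := fun t => θ t ^ 2 * G t)
    (φ' := fun t => 2 * (θ t * θ' t) * G t + θ t ^ 2 * G' t)
    (φ'' := (2 * (θ' 0 * θ' 0 + θ 0 * θ'') * G 0 + 2 * (θ 0 * θ' 0) * G' 0)
      + (2 * θ 0 * θ' 0 * G' 0 + θ 0 ^ 2 * G'')) hδ
    (fun t ht => (((hθ t ht).fun_pow 2).fun_mul (hG t ht)).congr_deriv (by push_cast; ring))
    (by
      have e1 := (((hθ 0 h0).fun_mul hθ').const_mul 2).fun_mul (hG 0 h0)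
      have e2 := ((hθ 0 h0).fun_pow 2).fun_mul hG'
      exact (e1.fun_add e2).congr_deriv (by push_cast; ring)) hmax
  constructor
  · have h1 : 2 * (θ 0 * θ' 0) * G 0 + θ 0 ^ 2 * G' 0 = 0 := h.1
    linarith
  · refine le_trans (le_of_eq ?_) h.2
    ring

end Interior

/-! ### The maximum principle in the interior -/

section InteriorMax

variable {m : ℕ} (r : ℝ) (g : Coord m → Matrix (Fin (m + 1)) (Fin (m + 1)) ℝ)

/-- The diagonal entry `V(E_a, E_a)` of the tensor `V = ∇²u + du ⊗ du` in the frame `E`. -/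
noncomputable def frameV (u : Coord m → ℝ) (E : Fin (m + 1) → Fin (m + 1) → ℝ)
    (a : Fin (m + 1)) (x : Coord m) : ℝ :=
  ev2 (cov1 r g fun i => pd r i u) E a a x + ev1 (fun i => pd r i u) E a x ^ 2

/-- The quantity `V(E_a, E_a) + tr V` to which the maximum principle is applied. -/
noncomputable def frameG (u : Coord m → ℝ) (E : Fin (m + 1) → Fin (m + 1) → ℝ)
    (a : Fin (m + 1)) (x : Coord m) : ℝ :=
  frameV r g u E a x + ∑ k, frameV r g u E k x

/-- The covariant derivative of `V(E_a, E_a)` in the direction `E_c`. -/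
noncomputable def frameV₁ (u : Coord m → ℝ) (E : Fin (m + 1) → Fin (m + 1) → ℝ)
    (c a : Fin (m + 1)) (x : Coord m) : ℝ :=
  ev3 (cov2 r g (cov1 r g fun i => pd r i u)) E c a a x
    + 2 * ev1 (fun i => pd r i u) E a x * ev2 (cov1 r g fun i => pd r i u) E c a x

/-- The second covariant derivative of `V(E_a, E_a)` in the direction `E_c`. -/
noncomputable def frameV₂ (u : Coord m → ℝ) (E : Fin (m + 1) → Fin (m + 1) → ℝ)
    (c a : Fin (m + 1)) (x : Coord m) : ℝ :=
  ev4 (cov3 r g (cov2 r g (cov1 r g fun i => pd r i u))) E c c a a x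
    + 2 * ev2 (cov1 r g fun i => pd r i u) E c a x ^ 2
    + 2 * ev1 (fun i => pd r i u) E a x
      * ev3 (cov2 r g (cov1 r g fun i => pd r i u)) E c c a x

variable {r g} {γ : ℝ → Coord m} {E : ℝ → Fin (m + 1) → Fin (m + 1) → ℝ} {c : Fin (m + 1)}
  {I : Set ℝ} {u : Coord m → ℝ}

/-- A parallel frame that is orthonormal at one time is orthonormal at all times. -/
lemma IsParallelFrame.isOrtho (hg : IsFermiMetric r g) (h : IsParallelFrame r g γ E c I)
    (hI : Convex ℝ I) {t₀ t : ℝ} (ht₀ : t₀ ∈ I) (ht : t ∈ I) (hE : IsOrtho g (γ t₀) (E t₀)) :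
    IsOrtho g (γ t) (E t) := fun a b => by
  rw [← hE a b]
  exact h.ev2_metric hg hI ht₀ ht a b

lemma differentiableOn_first (hr : 0 < r) (hu : ContDiffOn ℝ 4 u (halfBall m r)) (i : Fin (m + 1)) :
    DifferentiableOn ℝ (pd r i u) (halfBall m r) :=
  (contDiffOn_pd hr (k := 3) hu (by norm_num) i).differentiableOn (by norm_num)

lemma contDiffOn_second (hr : 0 < r) (hg : IsFermiMetric r g) (hu : ContDiffOn ℝ 4 u (halfBall m r))
    (i j : Fin (m + 1)) : ContDiffOn ℝ 2 (cov1 r g (fun i => pd r i u) i j) (halfBall m r) :=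
  contDiffOn_cov1 hr hg (l := 3) (by norm_num) (WithTop.coe_le_coe.2 le_top)
    (fun i => contDiffOn_pd hr hu (by norm_num) i) i j

lemma differentiableOn_second (hr : 0 < r) (hg : IsFermiMetric r g) (hu : ContDiffOn ℝ 4 u (halfBall m r))
    (i j : Fin (m + 1)) :
    DifferentiableOn ℝ (cov1 r g (fun i => pd r i u) i j) (halfBall m r) :=
  (contDiffOn_second hr hg hu i j).differentiableOn (by norm_num)

lemma differentiableOn_third (hr : 0 < r) (hg : IsFermiMetric r g) (hu : ContDiffOn ℝ 4 u (halfBall m r))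
    (k i j : Fin (m + 1)) :
    DifferentiableOn ℝ (cov2 r g (cov1 r g fun i => pd r i u) k i j) (halfBall m r) :=
  (contDiffOn_cov2 hr hg (k := 1) (l := 2) (by norm_num) (WithTop.coe_le_coe.2 le_top)
    (contDiffOn_second hr hg hu) k i j).differentiableOn (by norm_num)

lemma IsParallelFrame.hasDeriv_frameV (hr : 0 < r) (hg : IsFermiMetric r g)
    (hu : ContDiffOn ℝ 4 u (halfBall m r)) (h : IsParallelFrame r g γ E c I)
    (a : Fin (m + 1)) {t : ℝ} (ht : t ∈ I) :
    HasDerivWithinAt (fun s => frameV r g u (E s) a (γ s)) (frameV₁ r g u (E t) c a (γ t)) I t := by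
  have h2 := h.hasDeriv2 (differentiableOn_second hr hg hu) ht a a
  have h1 := h.hasDeriv1 (differentiableOn_first hr hu) ht a
  refine (h2.fun_add (h1.fun_pow 2)).congr_deriv ?_
  unfold frameV₁
  push_cast
  ring

lemma IsParallelFrame.hasDeriv_frameV₁ (hr : 0 < r) (hg : IsFermiMetric r g)
    (hu : ContDiffOn ℝ 4 u (halfBall m r)) (h : IsParallelFrame r g γ E c I)
    (a : Fin (m + 1)) {t : ℝ} (ht : t ∈ I) :
    HasDerivWithinAt (fun s => frameV₁ r g u (E s) c a (γ s))
      (frameV₂ r g u (E t) c a (γ t)) I t := by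
  have h3 := h.hasDeriv3 (differentiableOn_third hr hg hu) ht c a a
  have h2 := h.hasDeriv2 (differentiableOn_second hr hg hu) ht c a
  have h1 := h.hasDeriv1 (differentiableOn_first hr hu) ht a
  refine (h3.fun_add ((h1.const_mul 2).fun_mul h2)).congr_deriv ?_
  unfold frameV₂
  ring

lemma IsParallelFrame.hasDeriv_gradSq (hr : 0 < r)
    (hu : ContDiffOn ℝ 4 u (halfBall m r)) (h : IsParallelFrame r g γ E c I)
    {t : ℝ} (ht : t ∈ I) :
    HasDerivWithinAt (fun s => 1 / 2 * ∑ l, ev1 (fun i => pd r i u) (E s) l (γ s) ^ 2)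
      (∑ l, ev1 (fun i => pd r i u) (E t) l (γ t)
        * ev2 (cov1 r g fun i => pd r i u) (E t) c l (γ t)) I t := by
  have h1 := fun l => (h.hasDeriv1 (differentiableOn_first hr hu) ht l).fun_pow 2
  refine ((HasDerivWithinAt.fun_sum (u := Finset.univ) fun l _ => h1 l).const_mul
    (1 / 2)).congr_deriv ?_
  rw [Finset.mul_sum]
  refine Finset.sum_congr rfl fun l _ => ?_
  push_cast
  ring

lemma IsParallelFrame.hasDeriv_gradSq₁ (hr : 0 < r) (hg : IsFermiMetric r g)
    (hu : ContDiffOn ℝ 4 u (halfBall m r)) (h : IsParallelFrame r g γ E c I)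
    {t : ℝ} (ht : t ∈ I) :
    HasDerivWithinAt (fun s => ∑ l, ev1 (fun i => pd r i u) (E s) l (γ s)
        * ev2 (cov1 r g fun i => pd r i u) (E s) c l (γ s))
      (∑ l, (ev2 (cov1 r g fun i => pd r i u) (E t) c l (γ t) ^ 2
        + ev1 (fun i => pd r i u) (E t) l (γ t)
          * ev3 (cov2 r g (cov1 r g fun i => pd r i u)) (E t) c c l (γ t))) I t := by
  have h1 := fun l => (h.hasDeriv1 (differentiableOn_first hr hu) ht l).fun_mul
    (h.hasDeriv2 (differentiableOn_second hr hg hu) ht c l)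
  refine (HasDerivWithinAt.fun_sum (u := Finset.univ) fun l _ => h1 l).congr_deriv ?_
  exact Finset.sum_congr rfl fun l _ => by ring

lemma IsParallelFrame.hasDeriv_rhs {f : Coord m → ℝ} (hf : ContDiffOn ℝ 2 f (halfBall m r))
    (hu : ContDiffOn ℝ 4 u (halfBall m r)) (h : IsParallelFrame r g γ E c I)
    {t : ℝ} (ht : t ∈ I) :
    HasDerivWithinAt (fun s => f (γ s) * Real.exp (-2 * u (γ s)))
      (Real.exp (-2 * u (γ t)) * (ev1 (fun i => pd r i f) (E t) c (γ t)
        - 2 * f (γ t) * ev1 (fun i => pd r i u) (E t) c (γ t))) I t := by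
  have h1 := h.hasDeriv0 (hf.differentiableOn (by norm_num)) ht
  have h2 := ((h.hasDeriv0 (hu.differentiableOn (by norm_num)) ht).const_mul (-2)).exp
  refine (h1.fun_mul h2).congr_deriv ?_
  ring

lemma IsParallelFrame.hasDeriv_rhs₁ (hr : 0 < r) {f : Coord m → ℝ} (hf : ContDiffOn ℝ 2 f (halfBall m r))
    (hu : ContDiffOn ℝ 4 u (halfBall m r)) (h : IsParallelFrame r g γ E c I)
    {t : ℝ} (ht : t ∈ I) :
    HasDerivWithinAt (fun s => Real.exp (-2 * u (γ s)) * (ev1 (fun i => pd r i f) (E s) c (γ s)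
        - 2 * f (γ s) * ev1 (fun i => pd r i u) (E s) c (γ s)))
      (Real.exp (-2 * u (γ t)) * (ev2 (cov1 r g fun i => pd r i f) (E t) c c (γ t)
        - 4 * ev1 (fun i => pd r i f) (E t) c (γ t) * ev1 (fun i => pd r i u) (E t) c (γ t)
        - 2 * f (γ t) * ev2 (cov1 r g fun i => pd r i u) (E t) c c (γ t)
        + 4 * f (γ t) * ev1 (fun i => pd r i u) (E t) c (γ t) ^ 2)) I t := by
  have h1 := h.hasDeriv0 (hf.differentiableOn (by norm_num)) ht
  have h1' := h.hasDeriv1 (S := fun i => pd r i f) (fun i =>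
    (contDiffOn_pd hr (k := 1) hf (by norm_num) i).differentiableOn (by norm_num)) ht c
  have h2 := ((h.hasDeriv0 (hu.differentiableOn (by norm_num)) ht).const_mul (-2)).exp
  have h2' := h.hasDeriv1 (differentiableOn_first hr hu) ht c
  refine (h2.fun_mul (h1'.fun_sub ((h1.const_mul 2).fun_mul h2'))).congr_deriv ?_
  ring

/-- The equation differentiated twice along a geodesic. Comparison with the linearization at the
centre replaces differentiation of `F` composed with the eigenvalues. -/
lemma IsSolution.linearized (hr : 0 < r) (hg : IsFermiMetric r g)
    {Γ : Set (Fin (m + 1) → ℝ)} {F : (Fin (m + 1) → ℝ) → ℝ} {ε μhat : ℝ} {μ f : Coord m → ℝ}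
    (hΓ : IsAdmissibleCone Γ) (hF : IsAdmissibleFun ε Γ F) (hu : IsSolution r g Γ F μ μhat f u)
    (hf : ContDiffOn ℝ 2 f (halfBall m r)) {x₀ : Coord m} (h0 : 0 < x₀ (Fin.last m))
    (h1 : ∑ i, x₀ i ^ 2 < r ^ 2) {E₀ : Matrix (Fin (m + 1)) (Fin (m + 1)) ℝ}
    {l₀ : Fin (m + 1) → ℝ} (hE₀ : E₀ * g x₀ * E₀.transpose = 1)
    (hd : E₀ * schoutenHat r g u x₀ * E₀.transpose = Matrix.diagonal l₀) (c : Fin (m + 1)) :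
    (∑ i, dF F i l₀ * (frameV₁ r g u E₀ c i x₀ - ∑ l, ev1 (fun i => pd r i u) E₀ l x₀
        * ev2 (cov1 r g fun i => pd r i u) E₀ c l x₀) =
      Real.exp (-2 * u x₀) * (ev1 (fun i => pd r i f) E₀ c x₀
        - 2 * f x₀ * ev1 (fun i => pd r i u) E₀ c x₀)) ∧
    Real.exp (-2 * u x₀) * (ev2 (cov1 r g fun i => pd r i f) E₀ c c x₀
        - 4 * ev1 (fun i => pd r i f) E₀ c x₀ * ev1 (fun i => pd r i u) E₀ c x₀
        - 2 * f x₀ * ev2 (cov1 r g fun i => pd r i u) E₀ c c x₀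
        + 4 * f x₀ * ev1 (fun i => pd r i u) E₀ c x₀ ^ 2) ≤
      ∑ i, dF F i l₀ * (frameV₂ r g u E₀ c i x₀
        - ∑ l, (ev2 (cov1 r g fun i => pd r i u) E₀ c l x₀ ^ 2
          + ev1 (fun i => pd r i u) E₀ l x₀
            * ev3 (cov2 r g (cov1 r g fun i => pd r i u)) E₀ c c l x₀)) := by
  have hxB : x₀ ∈ halfBall m r := ⟨h0.le, h1.le⟩
  obtain ⟨hl₀, hFl₀⟩ := hu.diag_mem hΓ hF hxB hE₀ hd
  obtain ⟨γ, E, δ, hδ, hγ0, hE0, hfr⟩ := exists_parallelFrame_interior hr hg h0 h1 E₀ c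
  have h00 : (0 : ℝ) ∈ Ioo (-δ) δ := ⟨by linarith, hδ⟩
  have hO₀ : IsOrtho g (γ 0) (E 0) := by rw [hγ0, hE0]; exact isOrtho_of_mul_eq_one hE₀
  have hW : ∀ t ∈ Ioo (-δ) δ, ∑ i, dF F i l₀ * ev2 (fun i j y => schoutenHat r g u y i j)
      (E t) i i (γ t) = ∑ i, dF F i l₀ * (frameV r g u (E t) i (γ t)
        - 1 / 2 * ∑ l, ev1 (fun i => pd r i u) (E t) l (γ t) ^ 2) := by
    intro t ht
    refine Finset.sum_congr rfl fun i _ => ?_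
    rw [(hfr.isOrtho hg (convex_Ioo _ _) h00 ht hO₀).ev2_schoutenHat u i i]
    simp only [frameV, if_true]
    ring
  have hψ0 : f (γ 0) * Real.exp (-2 * u (γ 0)) = ∑ i, dF F i l₀ * (frameV r g u (E 0) i (γ 0)
        - 1 / 2 * ∑ l, ev1 (fun i => pd r i u) (E 0) l (γ 0) ^ 2) := by
    rw [← hW 0 h00, hγ0, ← hFl₀, ← hF.euler hΓ hl₀, hE0]
    refine Finset.sum_congr rfl fun i _ => ?_
    have e := ev2_eq_matrix (fun i j y => schoutenHat r g u y i j) E₀ i i x₀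
    rw [e]
    have e2 : (Matrix.of fun i j => schoutenHat r g u x₀ i j) = schoutenHat r g u x₀ := rfl
    rw [e2, hd, Matrix.diagonal_apply_eq]
  -- `f e^{-2u}` minus the linearization is nonpositive along the geodesic and vanishes at time `0`
  have key := second_deriv_test hδ
    (φ := fun t => f (γ t) * Real.exp (-2 * u (γ t)) - ∑ i, dF F i l₀ *
      (frameV r g u (E t) i (γ t) - 1 / 2 * ∑ l, ev1 (fun i => pd r i u) (E t) l (γ t) ^ 2))
    (fun t ht => (hfr.hasDeriv_rhs hf hu.smooth ht).fun_sub
      (HasDerivWithinAt.fun_sum (u := Finset.univ) fun i _ =>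
        ((hfr.hasDeriv_frameV hr hg hu.smooth i ht).fun_sub
          (hfr.hasDeriv_gradSq hr hu.smooth ht)).const_mul (dF F i l₀)))
    ((hfr.hasDeriv_rhs₁ hr hf hu.smooth h00).fun_sub
      (HasDerivWithinAt.fun_sum (u := Finset.univ) fun i _ =>
        ((hfr.hasDeriv_frameV₁ hr hg hu.smooth i h00).fun_sub
          (hfr.hasDeriv_gradSq₁ hr hg hu.smooth h00)).const_mul (dF F i l₀)))
    (fun t ht => by
      rw [hψ0, sub_self, sub_nonpos, ← hW t ht]
      exact hu.le_sum_frame hr hg hΓ hF hl₀ (hfr.maps ht)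
        (hfr.isOrtho hg (convex_Ioo _ _) h00 ht hO₀))
  rw [hγ0, hE0] at key
  exact ⟨(sub_eq_zero.1 key.1).symm, sub_nonpos.1 key.2⟩

end InteriorMax

/-! ### The estimate at an interior maximum point -/

section InteriorEstimate

variable {m : ℕ} {r : ℝ} {g : Coord m → Matrix (Fin (m + 1)) (Fin (m + 1)) ℝ}

/-- The conditions at an interior maximum of `θ² G` over all points and orthonormal frames. -/
lemma frameG_second_deriv_test (hr : 0 < r) (hg : IsFermiMetric r g) {u θ : Coord m → ℝ}
    (hu : ContDiffOn ℝ 4 u (halfBall m r)) (hθ : ContDiffOn ℝ 2 θ (halfBall m r))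
    {x₀ : Coord m} (h0 : 0 < x₀ (Fin.last m)) (h1 : ∑ i, x₀ i ^ 2 < r ^ 2)
    {E₀ : Fin (m + 1) → Fin (m + 1) → ℝ} (hE₀ : IsOrtho g x₀ E₀) (a : Fin (m + 1))
    (hmax : ∀ x ∈ halfBall m r, ∀ E, IsOrtho g x E →
      θ x ^ 2 * frameG r g u E a x ≤ θ x₀ ^ 2 * frameG r g u E₀ a x₀) (c : Fin (m + 1)) :
    2 * θ x₀ * ev1 (fun i => pd r i θ) E₀ c x₀ * frameG r g u E₀ a x₀ + θ x₀ ^ 2 *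
      (frameV₁ r g u E₀ c a x₀ + ∑ k, frameV₁ r g u E₀ c k x₀) = 0 ∧
    (2 * ev1 (fun i => pd r i θ) E₀ c x₀ ^ 2
        + 2 * θ x₀ * ev2 (cov1 r g fun i => pd r i θ) E₀ c c x₀) * frameG r g u E₀ a x₀
      + 4 * θ x₀ * ev1 (fun i => pd r i θ) E₀ c x₀ *
        (frameV₁ r g u E₀ c a x₀ + ∑ k, frameV₁ r g u E₀ c k x₀)
      + θ x₀ ^ 2 * (frameV₂ r g u E₀ c a x₀ + ∑ k, frameV₂ r g u E₀ c k x₀) ≤ 0 := by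
  obtain ⟨γ, E, δ, hδ, hγ0, hE0, hfr⟩ := exists_parallelFrame_interior hr hg h0 h1 E₀ c
  have h00 : (0 : ℝ) ∈ Ioo (-δ) δ := ⟨by linarith, hδ⟩
  have hO₀ : IsOrtho g (γ 0) (E 0) := by rw [hγ0, hE0]; exact hE₀
  have hθ1 : ∀ i, DifferentiableOn ℝ (pd r i θ) (halfBall m r) := fun i =>
    (contDiffOn_pd hr (k := 1) hθ (by norm_num) i).differentiableOn (by norm_num)
  have key := second_deriv_test_mul hδ
    (fun t ht => hfr.hasDeriv0 (hθ.differentiableOn (by norm_num)) ht)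
    (hfr.hasDeriv1 (S := fun i => pd r i θ) hθ1 h00 c)
    (fun t ht => (hfr.hasDeriv_frameV hr hg hu a ht).fun_add
      (HasDerivWithinAt.fun_sum (u := Finset.univ) fun k _ => hfr.hasDeriv_frameV hr hg hu k ht))
    ((hfr.hasDeriv_frameV₁ hr hg hu a h00).fun_add
      (HasDerivWithinAt.fun_sum (u := Finset.univ) fun k _ => hfr.hasDeriv_frameV₁ hr hg hu k h00))
    (fun t ht => by
      have := hmax (γ t) (hfr.maps ht) (E t) (hfr.isOrtho hg (convex_Ioo _ _) h00 ht hO₀)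
      rw [← hγ0, ← hE0] at this
      exact this)
  rw [hγ0, hE0] at key
  exact key

/-- The eigenvalues of `W` in terms of a diagonalizing orthonormal frame. -/
lemma diag_eq_frameV {u : Coord m → ℝ} {x : Coord m} {E : Matrix (Fin (m + 1)) (Fin (m + 1)) ℝ}
    {l : Fin (m + 1) → ℝ} (hE : E * g x * E.transpose = 1)
    (hd : E * schoutenHat r g u x * E.transpose = Matrix.diagonal l) (k : Fin (m + 1)) :
    l k = frameV r g u E k x - 1 / 2 * ∑ l, ev1 (fun i => pd r i u) E l x ^ 2 := by
  have e := ev2_eq_matrix (fun i j y => schoutenHat r g u y i j) E k k x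
  have e2 : (Matrix.of fun i j => schoutenHat r g u x i j) = schoutenHat r g u x := rfl
  rw [e2, hd, Matrix.diagonal_apply_eq,
    (isOrtho_of_mul_eq_one hE).ev2_schoutenHat u k k] at e
  rw [← e]
  simp only [frameV, if_true]
  ring

/-- The bound for `θ² G` at an interior maximum. -/
lemma exists_interior_estimate (hm : 2 ≤ m) (Λ K b : ℝ) : ∃ C : ℝ, 0 ≤ C ∧
    ∀ (r : ℝ) (g : Coord m → Matrix (Fin (m + 1)) (Fin (m + 1)) ℝ)
      (Γ : Set (Fin (m + 1) → ℝ)) (F : (Fin (m + 1) → ℝ) → ℝ) (ε μhat : ℝ) (μ f u θ : Coord m → ℝ),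
      0 < r → IsFermiMetric r g → IsFlat r g → ChartBound r g Λ →
      IsAdmissibleCone Γ → IsAdmissibleFun ε Γ F → ContDiffOn ℝ 2 f (halfBall m r) →
      C2Bound r K f → IsSolution r g Γ F μ μhat f u → ContDiffOn ℝ 2 θ (halfBall m r) →
      C2Bound r b θ →
      ∀ (x₀ : Coord m) (E₀ : Matrix (Fin (m + 1)) (Fin (m + 1)) ℝ) (l₀ : Fin (m + 1) → ℝ)
        (a : Fin (m + 1)) (s : ℝ),
        0 < x₀ (Fin.last m) → ∑ i, x₀ i ^ 2 < r ^ 2 → E₀ * g x₀ * E₀.transpose = 1 →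
        E₀ * schoutenHat r g u x₀ * E₀.transpose = Matrix.diagonal l₀ →
        (∀ k, frameV r g u E₀ k x₀ ≤ frameV r g u E₀ a x₀) →
        (∀ x ∈ halfBall m r, ∀ E, IsOrtho g x E →
          θ x ^ 2 * frameG r g u E a x ≤ θ x₀ ^ 2 * frameG r g u E₀ a x₀) →
        0 < θ x₀ → Real.exp (-2 * u x₀) ≤ s →
        θ x₀ ^ 2 * frameG r g u E₀ a x₀ ≤ C * (1 + s) := by
  obtain ⟨Cθ, hCθ0, hCθ⟩ := exists_frame_bound m Λ b
  obtain ⟨Cf, hCf0, hCf⟩ := exists_frame_bound m Λ K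
  obtain ⟨C, hC0, hC⟩ := interior_bound (N := m + 1) (by omega) (Cθ + |b|) (Cf + |K|)
  refine ⟨C, hC0, ?_⟩
  intro r g Γ F ε μhat μ f u θ hr hg hflat hΛ hΓ hF hf hfK hu hθ hθb x₀ E₀ l₀ a s h0 h1 hE₀ hd
    hmaxV hmax hθ0 hs
  have hxB : x₀ ∈ halfBall m r := ⟨h0.le, h1.le⟩
  have hO := isOrtho_of_mul_eq_one hE₀
  obtain ⟨hl₀, -⟩ := hu.diag_mem hΓ hF hxB hE₀ hd
  have hlW := diag_eq_frameV hE₀ hd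
  have htest := frameG_second_deriv_test hr hg hu.smooth hθ h0 h1 hO a hmax
  have hlin := hu.linearized hr hg hΓ hF hf h0 h1 hE₀ hd
  have hu2 : ContDiffOn ℝ 2 u (halfBall m r) := hu.smooth.of_le (by norm_num)
  have hsq : ∀ i j, ev2 (cov1 r g fun i => pd r i u) E₀ i j x₀
      = ev2 (cov1 r g fun i => pd r i u) E₀ j i x₀ :=
    ev2_symm (fun i j => cov1_symm hr hg hu2 hxB i j)
  have hsT := ev3_symm_left (E := E₀) (x := x₀)
    (S := cov2 r g (cov1 r g fun i => pd r i u))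
    (fun k i j => third_symm_left hr hg hflat hu.smooth hxB k i j)
  have hsT' := ev3_symm_right (E := E₀) (x := x₀)
    (S := cov2 r g (cov1 r g fun i => pd r i u))
    (fun k i j => third_symm_right hr hg hu.smooth hxB k i j)
  have hsQ := ev4_symm_pair (E := E₀) (x := x₀)
    (S := cov3 r g (cov2 r g (cov1 r g fun i => pd r i u)))
    (fun l k i j => fourth_symm_pair hr hg hflat hu.smooth hxB l k i j)
  refine hC (fun i => dF F i l₀) (fun k => ev1 (fun i => pd r i u) E₀ k x₀)
    (fun k => ev1 (fun i => pd r i θ) E₀ k x₀)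
    (fun k => ev2 (cov1 r g fun i => pd r i θ) E₀ k k x₀)
    (fun k => ev1 (fun i => pd r i f) E₀ k x₀)
    (fun k => ev2 (cov1 r g fun i => pd r i f) E₀ k k x₀)
    (fun k l => ev2 (cov1 r g fun i => pd r i u) E₀ k l x₀)
    (fun k c => frameV₁ r g u E₀ c k x₀) (fun k c => frameV₂ r g u E₀ c k x₀) a (θ x₀) (f x₀)
    (Real.exp (-2 * u x₀)) s _ (fun c => (hF.mono l₀ hl₀ c).le) (hF.one_le_sum hΓ hl₀) hθ0 rfl ?_
    hmaxV ?_ ?_ ?_ ?_ ?_ ?_ (Real.exp_pos _).le hs (fun c => (htest c).1) (fun c => (htest c).2) ?_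
  · refine (hΓ.sum_pos hl₀).trans_eq (Finset.sum_congr rfl fun k _ => ?_)
    rw [hlW k]
    rfl
  · exact (((hθb x₀ hxB).1.trans (le_abs_self b))).trans (le_add_of_nonneg_left hCθ0)
  · exact fun c => (hCθ r g θ hg hΛ hθb x₀ hxB E₀ hO c).1.trans
      (le_add_of_nonneg_right (abs_nonneg b))
  · exact fun c => (hCθ r g θ hg hΛ hθb x₀ hxB E₀ hO c).2.trans
      (le_add_of_nonneg_right (abs_nonneg b))
  · exact (((hfK x₀ hxB).1.trans (le_abs_self K))).trans (le_add_of_nonneg_left hCf0)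
  · exact fun c => (hCf r g f hg hΛ hfK x₀ hxB E₀ hO c).1.trans
      (le_add_of_nonneg_right (abs_nonneg K))
  · exact fun c => (hCf r g f hg hΛ hfK x₀ hxB E₀ hO c).2.trans
      (le_add_of_nonneg_right (abs_nonneg K))
  · intro k
    have h := linearized_bound (F := fun i => dF F i l₀)
      (p := fun k => ev1 (fun i => pd r i u) E₀ k x₀)
      (q := fun k l => ev2 (cov1 r g fun i => pd r i u) E₀ k l x₀)
      (T := fun k i j => ev3 (cov2 r g (cov1 r g fun i => pd r i u)) E₀ k i j x₀)
      (Q := fun c i => ev4 (cov3 r g (cov2 r g (cov1 r g fun i => pd r i u))) E₀ c c i i x₀)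
      (k := k) hsq hsT hsT' (fun c i => hsQ c c i i) (hlin k).1 (hlin k).2
    refine le_trans (le_of_eq ?_) h
    simp only [frameV₁]
    ring

end InteriorEstimate

/-! ### The maximum principle at the boundary -/

section BoundaryMax

variable {m : ℕ} {r : ℝ} {g : Coord m → Matrix (Fin (m + 1)) (Fin (m + 1)) ℝ}

lemma nonpos_of_hasDerivWithinAt_Icc {φ : ℝ → ℝ} {φ' δ : ℝ} (hδ : 0 < δ)
    (h : HasDerivWithinAt φ φ' (Icc 0 δ) 0) (hmax : ∀ t ∈ Icc 0 δ, φ t ≤ φ 0) : φ' ≤ 0 := by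
  have hloc : IsLocalMaxOn φ (Icc 0 δ) 0 := by
    filter_upwards [self_mem_nhdsWithin] with t ht using hmax t ht
  have hy : δ ∈ posTangentConeAt (Icc 0 δ) (0 : ℝ) := by
    refine mem_posTangentConeAt_of_segment_subset ?_
    rw [zero_add, segment_eq_Icc hδ.le]
  have := hloc.hasFDerivWithinAt_nonpos h.hasFDerivWithinAt hy
  have h2 : δ * φ' ≤ 0 := by simpa using this
  by_contra hcon
  exact absurd (mul_pos hδ (not_le.1 hcon)) (not_lt.2 h2)

variable {Γ : Set (Fin (m + 1) → ℝ)} {F : (Fin (m + 1) → ℝ) → ℝ} {ε μhat : ℝ}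
  {μ f u : Coord m → ℝ} {x₀ : Coord m}

/-- The equation differentiated once, in the direction of the inner normal. -/
lemma IsSolution.linearized_boundary (hr : 0 < r) (hg : IsFermiMetric r g)
    (hΓ : IsAdmissibleCone Γ) (hF : IsAdmissibleFun ε Γ F) (hu : IsSolution r g Γ F μ μhat f u)
    (hf : ContDiffOn ℝ 2 f (halfBall m r)) (h0 : x₀ (Fin.last m) = 0)
    (h1 : ∑ i, x₀ i ^ 2 < r ^ 2) {E₀ : Matrix (Fin (m + 1)) (Fin (m + 1)) ℝ}
    {l₀ : Fin (m + 1) → ℝ} (hE₀ : E₀ * g x₀ * E₀.transpose = 1)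
    (hd : E₀ * schoutenHat r g u x₀ * E₀.transpose = Matrix.diagonal l₀)
    (hEn : E₀ (Fin.last m) = Pi.single (Fin.last m) 1) :
    Real.exp (-2 * u x₀) * (ev1 (fun i => pd r i f) E₀ (Fin.last m) x₀
        - 2 * f x₀ * ev1 (fun i => pd r i u) E₀ (Fin.last m) x₀) ≤
      ∑ i, dF F i l₀ * (frameV₁ r g u E₀ (Fin.last m) i x₀
        - ∑ l, ev1 (fun i => pd r i u) E₀ l x₀
        * ev2 (cov1 r g fun i => pd r i u) E₀ (Fin.last m) l x₀) := by
  have hxB : x₀ ∈ halfBall m r := mem_halfBall_of_bdy h0 h1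
  obtain ⟨hl₀, hFl₀⟩ := hu.diag_mem hΓ hF hxB hE₀ hd
  obtain ⟨γ, E, δ, hδ, hγ0, hE0, hfr⟩ := exists_parallelFrame_boundary hr hg h0 h1 E₀ hEn
  have h00 : (0 : ℝ) ∈ Icc 0 δ := ⟨le_rfl, hδ.le⟩
  have hO₀ : IsOrtho g (γ 0) (E 0) := by rw [hγ0, hE0]; exact isOrtho_of_mul_eq_one hE₀
  have hψ0 : f (γ 0) * Real.exp (-2 * u (γ 0)) = ∑ i, dF F i l₀ * (frameV r g u (E 0) i (γ 0)
        - 1 / 2 * ∑ l, ev1 (fun i => pd r i u) (E 0) l (γ 0) ^ 2) := by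
    rw [hγ0, ← hFl₀, ← hF.euler hΓ hl₀, hE0]
    exact Finset.sum_congr rfl fun i _ => by rw [← diag_eq_frameV hE₀ hd i]
  have key := nonpos_of_hasDerivWithinAt_Icc hδ
    (φ := fun t => f (γ t) * Real.exp (-2 * u (γ t)) - ∑ i, dF F i l₀ *
      (frameV r g u (E t) i (γ t) - 1 / 2 * ∑ l, ev1 (fun i => pd r i u) (E t) l (γ t) ^ 2))
    ((hfr.hasDeriv_rhs hf hu.smooth h00).fun_sub
      (HasDerivWithinAt.fun_sum (u := Finset.univ) fun i _ =>
        ((hfr.hasDeriv_frameV hr hg hu.smooth i h00).fun_sub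
          (hfr.hasDeriv_gradSq hr hu.smooth h00)).const_mul (dF F i l₀)))
    (fun t ht => by
      rw [hψ0, sub_self, sub_nonpos]
      have hOt := hfr.isOrtho hg (convex_Icc _ _) h00 ht hO₀
      refine (hu.le_sum_frame hr hg hΓ hF hl₀ (hfr.maps ht) hOt).trans_eq ?_
      refine Finset.sum_congr rfl fun i _ => ?_
      rw [hOt.ev2_schoutenHat u i i]
      simp only [frameV, if_true]
      ring)
  rw [hγ0, hE0] at key
  exact sub_nonpos.1 key

/-- The condition at a boundary maximum of `θ² G`. -/
lemma frameG_deriv_test_boundary (hr : 0 < r) (hg : IsFermiMetric r g) {θ : Coord m → ℝ}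
    (hu : ContDiffOn ℝ 4 u (halfBall m r)) (hθ : ContDiffOn ℝ 2 θ (halfBall m r))
    (h0 : x₀ (Fin.last m) = 0) (h1 : ∑ i, x₀ i ^ 2 < r ^ 2)
    {E₀ : Fin (m + 1) → Fin (m + 1) → ℝ} (hE₀ : IsOrtho g x₀ E₀)
    (hEn : E₀ (Fin.last m) = Pi.single (Fin.last m) 1) (a : Fin (m + 1))
    (hmax : ∀ x ∈ halfBall m r, ∀ E, IsOrtho g x E →
      θ x ^ 2 * frameG r g u E a x ≤ θ x₀ ^ 2 * frameG r g u E₀ a x₀) :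
    2 * θ x₀ * pd r (Fin.last m) θ x₀ * frameG r g u E₀ a x₀ + θ x₀ ^ 2 *
      (frameV₁ r g u E₀ (Fin.last m) a x₀ + ∑ k, frameV₁ r g u E₀ (Fin.last m) k x₀) ≤ 0 := by
  obtain ⟨γ, E, δ, hδ, hγ0, hE0, hfr⟩ := exists_parallelFrame_boundary hr hg h0 h1 E₀ hEn
  have h00 : (0 : ℝ) ∈ Icc 0 δ := ⟨le_rfl, hδ.le⟩
  have hO₀ : IsOrtho g (γ 0) (E 0) := by rw [hγ0, hE0]; exact hE₀
  have h2 := ((hfr.hasDeriv0 (hθ.differentiableOn (by norm_num)) h00).fun_pow 2).fun_mul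
    ((hfr.hasDeriv_frameV hr hg hu a h00).fun_add
      (HasDerivWithinAt.fun_sum (u := Finset.univ) fun k _ => hfr.hasDeriv_frameV hr hg hu k h00))
  have key := nonpos_of_hasDerivWithinAt_Icc hδ h2 (fun t ht => by
      have := hmax (γ t) (hfr.maps ht) (E t) (hfr.isOrtho hg (convex_Icc _ _) h00 ht hO₀)
      rw [← hγ0, ← hE0] at this
      exact this)
  rw [hγ0, hE0] at key
  refine le_trans (le_of_eq ?_) key
  have : ev1 (fun k => pd r k θ) E₀ (Fin.last m) x₀ = pd r (Fin.last m) θ x₀ := by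
    simp [ev1, hEn, Pi.single_apply]
  rw [this]
  simp only [frameG]
  push_cast
  ring

/-- The principal curvatures of the boundary are controlled by the chart constant. -/
lemma IsUmbilic.abs_le (hm : 2 ≤ m) (hg : IsFermiMetric r g) (hum : IsUmbilic r g μ) {Λ : ℝ}
    (hΛ : ChartBound r g Λ) (h0 : x₀ (Fin.last m) = 0) (h1 : ∑ i, x₀ i ^ 2 < r ^ 2) :
    |μ x₀| ≤ Λ ^ 2 := by
  have hxB := mem_halfBall_of_bdy h0 h1
  set a : Fin m := ⟨0, by omega⟩
  have e := hum.christoffel_last hg (mem_flatBdy_of_bdy h0 h1) a a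
  rw [hg.christoffel_last hxB] at e
  have hd := (hΛ.2 a.castSucc a.castSucc x₀ hxB).2.1 (Fin.last m)
  have hone := hΛ.1 x₀ hxB (Pi.single a.castSucc 1)
  have e1 : ∑ i, (Pi.single a.castSucc (1 : ℝ) : Fin (m + 1) → ℝ) i ^ 2 = 1 := by
    rw [Finset.sum_eq_single a.castSucc] <;> simp +contextual
  have e2 : ∑ i, ∑ j, g x₀ i j * (Pi.single a.castSucc (1 : ℝ) : Fin (m + 1) → ℝ) i
      * (Pi.single a.castSucc (1 : ℝ) : Fin (m + 1) → ℝ) j = g x₀ a.castSucc a.castSucc := by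
    simp [Pi.single_apply]
  rw [e1, e2] at hone
  have hgpos : 0 < g x₀ a.castSucc a.castSucc := (hg.posDef x₀ hxB).diag_pos
  have hΛ0 : 0 ≤ Λ := (abs_nonneg _).trans hd
  have h3 : |μ x₀| * g x₀ a.castSucc a.castSucc ≤ Λ := by
    rw [← abs_of_pos hgpos, ← abs_mul, ← e, abs_mul]
    have : |(-(1 / 2) : ℝ)| = 1 / 2 := by norm_num
    rw [this]
    linarith
  calc |μ x₀| ≤ |μ x₀| * (Λ * g x₀ a.castSucc a.castSucc) :=
        le_mul_of_one_le_right (abs_nonneg _) hone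
    _ = Λ * (|μ x₀| * g x₀ a.castSucc a.castSucc) := by ring
    _ ≤ Λ * Λ := mul_le_mul_of_nonneg_left h3 hΛ0
    _ = Λ ^ 2 := by ring

/-- If `θ² G` is maximal at a boundary point then the logarithmic normal derivative `A` of `θ` there
is bounded; hence a cut-off with larger `A` excludes boundary maxima. When `μhat = 0` condition (A)
is not needed. -/
lemma exists_boundary_estimate (hm : 2 ≤ m) {ε : ℝ} (hε : 0 < ε) (Λ K νmax : ℝ) {f₀ ρ : ℝ}
    (hf₀ : 0 < f₀) (hρ : 0 ≤ ρ) : ∃ C : ℝ, 0 ≤ C ∧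
    ∀ (r : ℝ) (g : Coord m → Matrix (Fin (m + 1)) (Fin (m + 1)) ℝ)
      (Γ : Set (Fin (m + 1) → ℝ)) (F : (Fin (m + 1) → ℝ) → ℝ) (μhat : ℝ) (μ f u θ : Coord m → ℝ),
      0 < r → IsFermiMetric r g → IsFlat r g → IsUmbilic r g μ → ChartBound r g Λ →
      IsAdmissibleCone Γ → IsAdmissibleFun ε Γ F → IsDatum r K f₀ f →
      IsSolution r g Γ F μ μhat f u → 0 ≤ μhat → (μhat = 0 ∨ ConditionA ρ Γ F) →
      ContDiffOn ℝ 2 θ (halfBall m r) →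
      ∀ (x₀ : Coord m) (E₀ : Matrix (Fin (m + 1)) (Fin (m + 1)) ℝ) (l₀ : Fin (m + 1) → ℝ)
        (a : Fin (m + 1)) (A : ℝ),
        x₀ (Fin.last m) = 0 → ∑ i, x₀ i ^ 2 < r ^ 2 → μhat * Real.exp (-u x₀) ≤ νmax →
        E₀ * g x₀ * E₀.transpose = 1 →
        E₀ * schoutenHat r g u x₀ * E₀.transpose = Matrix.diagonal l₀ →
        E₀ (Fin.last m) = Pi.single (Fin.last m) 1 →
        (∀ a : Fin m, E₀ a.castSucc (Fin.last m) = 0) →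
        (∀ k, frameV r g u E₀ k x₀ ≤ frameV r g u E₀ a x₀) →
        (∀ x ∈ halfBall m r, ∀ E, IsOrtho g x E →
          θ x ^ 2 * frameG r g u E a x ≤ θ x₀ ^ 2 * frameG r g u E₀ a x₀) →
        0 < θ x₀ → pd r (Fin.last m) θ x₀ = A * θ x₀ → 2 * A ≤ C := by
  obtain ⟨C, hC0, hC⟩ := boundary_bound (N := m + 1) (by omega) ε (Λ ^ 2) νmax K f₀ ρ hε hf₀ hρ
  refine ⟨C, hC0, ?_⟩
  intro r g Γ F μhat μ f u θ hr hg hflat hum hΛ hΓ hF hf hu hμhat hA hθ x₀ E₀ l₀ a A h0 h1 hν hE₀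
    hd hEn hEa hmaxV hmax hθ0 hθn
  have hxB := mem_halfBall_of_bdy h0 h1
  have hxF := mem_flatBdy_of_bdy h0 h1
  have hO := isOrtho_of_mul_eq_one hE₀
  obtain ⟨hl₀, hFl₀⟩ := hu.diag_mem hΓ hF hxB hE₀ hd
  have hlW := diag_eq_frameV hE₀ hd
  have htest := frameG_deriv_test_boundary hr hg hu.smooth hθ h0 h1 hO hEn a hmax
  have hlin := hu.linearized_boundary hr hg hΓ hF hf.smooth h0 h1 hE₀ hd hEn
  have hu2 : ContDiffOn ℝ 2 u (halfBall m r) := hu.smooth.of_le (by norm_num)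
  set p : Fin (m + 1) → ℝ := fun k => ev1 (fun i => pd r i u) E₀ k x₀ with hp
  set q : Fin (m + 1) → Fin (m + 1) → ℝ := fun k l =>
    ev2 (cov1 r g fun i => pd r i u) E₀ k l x₀ with hq
  set w' : Fin (m + 1) → ℝ := fun k => frameV₁ r g u E₀ (Fin.last m) k x₀
    - ∑ l, p l * q (Fin.last m) l with hw'
  have hev1 : ∀ v : Coord m → ℝ, ev1 (fun k => pd r k v) E₀ (Fin.last m) x₀
      = pd r (Fin.last m) v x₀ := by
    intro v
    simp [ev1, hEn, Pi.single_apply]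
  have hpn : p (Fin.last m) = μhat * Real.exp (-u x₀) - μ x₀ := by
    simp only [hp, hev1]
    linarith [hu.bdy x₀ hxF]
  have hEa' : ∀ k, k ≠ Fin.last m → E₀ k (Fin.last m) = 0 := by
    intro k
    refine Fin.lastCases (fun h => absurd rfl h) (fun b _ => hEa b) k
  have hqn : ∀ k, k ≠ Fin.last m → q (Fin.last m) k = -p (Fin.last m) * p k := by
    intro k hk
    have e1 : q (Fin.last m) k = ∑ j, cov1 r g (fun i => pd r i u) (Fin.last m) j x₀ * E₀ k j := by
      simp [hq, ev2, hEn, Pi.single_apply]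
    rw [e1]
    simp only [hp, hev1]
    unfold ev1
    rw [Fin.sum_univ_castSucc, Fin.sum_univ_castSucc, hEa' k hk, mul_zero, mul_zero, add_zero,
      add_zero, Finset.mul_sum]
    refine Finset.sum_congr rfl fun b _ => ?_
    rw [cov1_symm hr hg hu2 hxB, hu.cov1_mixed hm hr hg hflat hum h0 h1]
    ring
  have hsum : ∑ l, p l * q (Fin.last m) l = p (Fin.last m) * q (Fin.last m) (Fin.last m)
      - p (Fin.last m) * (∑ l, p l ^ 2 - p (Fin.last m) ^ 2) := by
    rw [Fin.sum_univ_castSucc, Fin.sum_univ_castSucc (f := fun l => p l ^ 2), add_sub_cancel_right,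
      Finset.mul_sum, add_comm, sub_eq_add_neg, ← Finset.sum_neg_distrib]
    congr 1
    refine Finset.sum_congr rfl fun b _ => ?_
    rw [hqn _ (Fin.castSucc_lt_last b).ne]
    ring
  -- the normal derivative of the tangential entries of `W`
  have hw'α : ∀ k, k ≠ Fin.last m → w' k = (2 * μ x₀ - μhat * Real.exp (-u x₀)) * l₀ k
      - μhat * Real.exp (-u x₀) * l₀ (Fin.last m) := by
    intro k hk
    have hT := hu.ev3_mixed hm hr hg hflat hum h0 h1 hO hEn (hEa' k hk)
    have hsT := ev3_symm_left (E := E₀) (x := x₀)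
      (S := cov2 r g (cov1 r g fun i => pd r i u))
      (fun k i j => third_symm_left hr hg hflat hu.smooth hxB k i j) k (Fin.last m) k
    rw [hsT] at hT
    have hqk := hqn k hk
    simp only [hw', hsum, frameV₁, hT, hlW, frameV]
    change μhat * Real.exp (-u x₀) * p k ^ 2 + (μ x₀ - p (Fin.last m)) * q k k
      - μ x₀ * (p (Fin.last m) ^ 2 + q (Fin.last m) (Fin.last m))
      + 2 * p k * q (Fin.last m) k - _ = _ * (q k k + p k ^ 2 - 1 / 2 * ∑ l, p l ^ 2)
        - _ * (q (Fin.last m) (Fin.last m) + p (Fin.last m) ^ 2 - 1 / 2 * ∑ l, p l ^ 2)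
    rw [hqk, hpn]
    ring
  have hG : frameG r g u E₀ a x₀ = q a a + p a ^ 2 + ∑ k, (q k k + p k ^ 2) := rfl
  have hFsum : ∑ k, dF F k l₀ * l₀ k = Real.exp (-2 * u x₀) * f x₀ := by
    rw [hF.euler hΓ hl₀, hFl₀, mul_comm]
  have hB := hC (fun i => dF F i l₀) p l₀ w' q a (Fin.last m) (μ x₀) (μhat * Real.exp (-u x₀))
    (Real.exp (-2 * u x₀)) (f x₀) (pd r (Fin.last m) f x₀) (frameG r g u E₀ a x₀)
    (fun c => hF.mono l₀ hl₀ c) hG hlW (hΓ.sum_pos hl₀) hmaxV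
    (hum.abs_le hm hg hΛ h0 h1) (mul_nonneg hμhat (Real.exp_pos _).le) hν hpn hqn
    (Real.exp_pos _) (hf.lower x₀ hxB) ((hf.bound x₀ hxB).2.1 _) hw'α
    (by
      have := hlin
      rw [hev1, hev1] at this
      simpa only [hp, hev1] using this) hFsum
    (by
      rw [hF.euler hΓ hl₀, ← sigma_one]
      exact hF.lower l₀ hl₀ _)
    (hA.imp (fun h => by rw [h, zero_mul]) (fun h => h l₀ hl₀ (Fin.last m)))
  obtain ⟨hG0, -⟩ := size_bounds (N := m + 1) (by omega) hG
    ((hΓ.sum_pos hl₀).trans_eq (Finset.sum_congr rfl fun k _ => by rw [hlW k]; rfl)) hmaxV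
  -- the terms subtracted in `w'` come from the trace part `½|du|² g` of `V - W`
  have hder : w' a + ∑ k, w' k + ((m + 1 : ℕ) + 1) * ∑ k, p k * q (Fin.last m) k =
      frameV₁ r g u E₀ (Fin.last m) a x₀ + ∑ k, frameV₁ r g u E₀ (Fin.last m) k x₀ := by
    simp only [hw', Finset.sum_sub_distrib, Finset.sum_const, Finset.card_univ, Fintype.card_fin,
      nsmul_eq_mul]
    push_cast
    ring
  rw [hder] at hB
  rw [hθn] at htest
  have h2 : θ x₀ ^ 2 * frameG r g u E₀ a x₀ * (2 * A - C) ≤ 0 := by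
    have := mul_le_mul_of_nonneg_left hB (sq_nonneg (θ x₀))
    linarith
  by_contra hcon
  have h3 : 0 < θ x₀ ^ 2 * frameG r g u E₀ a x₀ * (2 * A - C) :=
    mul_pos (mul_pos (pow_pos hθ0 2) hG0) (by linarith)
  linarith

end BoundaryMax

/-! ### Maximizing over points and orthonormal frames -/

section Maximum

variable {m : ℕ} {r : ℝ} {g : Coord m → Matrix (Fin (m + 1)) (Fin (m + 1)) ℝ}

/-- The bundle of orthonormal frames over the half ball is compact. -/
lemma isCompact_orthoFrames (hr : 0 < r) (hg : IsFermiMetric r g) {Λ : ℝ}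
    (hΛ : ChartBound r g Λ) :
    IsCompact {z : Coord m × (Fin (m + 1) → Fin (m + 1) → ℝ) |
      z.1 ∈ halfBall m r ∧ IsOrtho g z.1 z.2} := by
  set Q : Set (Coord m × (Fin (m + 1) → Fin (m + 1) → ℝ)) :=
    halfBall m r ×ˢ Metric.closedBall 0 (1 + |Λ|) with hQ
  have hQc : IsCompact Q := (isCompact_halfBall hr).prod (isCompact_closedBall _ _)
  set Φ : Coord m × (Fin (m + 1) → Fin (m + 1) → ℝ) → (Fin (m + 1) → Fin (m + 1) → ℝ) :=
    fun z a b => ev2 (fun i j y => g y i j) z.2 a b z.1 with hΦ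
  have hΦc : ContinuousOn Φ Q := by
    refine continuousOn_pi.2 fun a => continuousOn_pi.2 fun b => ?_
    refine continuousOn_finsetSum _ fun j _ => ContinuousOn.mul
      (continuousOn_finsetSum _ fun i _ => ContinuousOn.mul ?_ ?_) ?_
    · exact (hg.smooth i j).continuousOn.comp continuousOn_fst fun z hz => hz.1
    · exact Continuous.continuousOn (by fun_prop)
    · exact Continuous.continuousOn (by fun_prop)
  have hcl := hΦc.preimage_isClosed_of_isClosed hQc.isClosed
    (isClosed_singleton (x := fun a b : Fin (m + 1) => if a = b then (1 : ℝ) else 0))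
  convert hQc.of_isClosed_subset hcl inter_subset_left using 1
  ext ⟨x, E⟩
  constructor
  · rintro ⟨hx, hE⟩
    refine ⟨⟨hx, ?_⟩, ?_⟩
    · rw [mem_closedBall_zero_iff, pi_norm_le_iff_of_nonneg (by positivity)]
      intro a
      rw [pi_norm_le_iff_of_nonneg (by positivity)]
      exact fun i => hE.abs_apply_le hΛ hx a i
    · exact funext fun a => funext fun b => hE a b
  · rintro ⟨⟨hx, -⟩, hE⟩
    exact ⟨hx, fun a b => congrFun (congrFun hE a) b⟩

/-- The quantity `G` in any orthonormal frame is bounded by its value in a frame of eigenvectors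
of `W`, with respect to the largest eigenvalue. -/
lemma frameG_le {u : Coord m → ℝ} {x : Coord m} {E₀ : Matrix (Fin (m + 1)) (Fin (m + 1)) ℝ}
    {l₀ : Fin (m + 1) → ℝ} (hE₀ : E₀ * g x * E₀.transpose = 1)
    (hd : E₀ * schoutenHat r g u x * E₀.transpose = Matrix.diagonal l₀) {a : Fin (m + 1)}
    (ha : ∀ k, l₀ k ≤ l₀ a) {E : Fin (m + 1) → Fin (m + 1) → ℝ} (hE : IsOrtho g x E)
    (b : Fin (m + 1)) : frameG r g u E b x ≤ frameG r g u E₀ a x := by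
  have hO := isOrtho_of_mul_eq_one hE₀
  -- `R` is the orthogonal matrix that takes the frame `E₀` to `E`
  set R : Matrix (Fin (m + 1)) (Fin (m + 1)) ℝ := Matrix.of E * g x * E₀.transpose with hR
  have hinv : E₀.transpose * E₀ * g x = 1 := by
    rw [Matrix.mul_assoc, ← mul_eq_one_comm]; exact hE₀
  have hinv' : g x * (E₀.transpose * E₀) = 1 := mul_eq_one_comm.1 hinv
  have hER : Matrix.of E = R * E₀ := by
    rw [hR, Matrix.mul_assoc, Matrix.mul_assoc, hinv', Matrix.mul_one]
  have hRR : R * R.transpose = 1 := by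
    have h := hE.mul_eq_one
    rw [hER, Matrix.transpose_mul] at h
    rw [← h]
    calc R * R.transpose = R * (E₀ * g x * E₀.transpose) * R.transpose := by
          rw [hE₀, Matrix.mul_one]
      _ = _ := by simp only [Matrix.mul_assoc]
  have hRR' : R.transpose * R = 1 := mul_eq_one_comm.1 hRR
  have hW : ∀ k, ev2 (fun i j y => schoutenHat r g u y i j) E k k x = ∑ l, R k l ^ 2 * l₀ l := by
    intro k
    have e := ev2_eq_matrix (fun i j y => schoutenHat r g u y i j) (Matrix.of E) k k x
    have e2 : (Matrix.of fun i j => schoutenHat r g u x i j) = schoutenHat r g u x := rfl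
    have e3 : R * E₀ * schoutenHat r g u x * (R * E₀).transpose =
        R * Matrix.diagonal l₀ * R.transpose := by
      rw [← hd, Matrix.transpose_mul]
      simp only [Matrix.mul_assoc]
    rw [e2, hER, e3] at e
    refine Eq.trans ?_ (e.trans ?_)
    · rw [← hER]; rfl
    · rw [Matrix.mul_apply]
      refine Finset.sum_congr rfl fun l _ => ?_
      rw [Matrix.mul_diagonal, Matrix.transpose_apply]
      ring
  have hV : ∀ k, frameV r g u E k x = ∑ l, R k l ^ 2 * l₀ l + 1 / 2 * gradSq r g u x := by
    intro k
    rw [← hW k, hE.ev2_schoutenHat, ← hE.gradSq_eq]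
    simp only [frameV, if_true]
    ring
  have hV₀ : ∀ k, frameV r g u E₀ k x = l₀ k + 1 / 2 * gradSq r g u x := by
    intro k
    rw [diag_eq_frameV hE₀ hd k, ← hO.gradSq_eq]
    ring
  have hrow : ∀ k, ∑ l, R k l ^ 2 = 1 := by
    intro k
    have := congrFun (congrFun hRR k) k
    rw [Matrix.mul_apply, Matrix.one_apply_eq] at this
    rw [← this]
    exact Finset.sum_congr rfl fun l _ => by rw [Matrix.transpose_apply, pow_two]
  have hcol : ∀ l, ∑ k, R k l ^ 2 = 1 := by
    intro l
    have := congrFun (congrFun hRR' l) l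
    rw [Matrix.mul_apply, Matrix.one_apply_eq] at this
    rw [← this]
    exact Finset.sum_congr rfl fun k _ => by rw [Matrix.transpose_apply, pow_two]
  have htr : ∑ k, ∑ l, R k l ^ 2 * l₀ l = ∑ l, l₀ l := by
    rw [Finset.sum_comm]
    refine Finset.sum_congr rfl fun l _ => ?_
    rw [← Finset.sum_mul, hcol, one_mul]
  have hb : ∑ l, R b l ^ 2 * l₀ l ≤ l₀ a := by
    calc ∑ l, R b l ^ 2 * l₀ l ≤ ∑ l, R b l ^ 2 * l₀ a :=
          Finset.sum_le_sum fun l _ => mul_le_mul_of_nonneg_left (ha l) (sq_nonneg _)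
      _ = l₀ a := by rw [← Finset.sum_mul, hrow, one_mul]
  unfold frameG
  simp only [hV, hV₀, Finset.sum_add_distrib, htr]
  linarith

/-- The maximum of `θ² G` over all points and orthonormal frames is attained. -/
lemma exists_max_frameG (hr : 0 < r) (hg : IsFermiMetric r g) {Λ : ℝ} (hΛ : ChartBound r g Λ)
    {u θ : Coord m → ℝ} (hu : ContDiffOn ℝ 4 u (halfBall m r))
    (hθ : ContinuousOn θ (halfBall m r)) :
    ∃ x₀ ∈ halfBall m r, ∃ E₀, IsOrtho g x₀ E₀ ∧ ∃ a₀, ∀ x ∈ halfBall m r, ∀ E, IsOrtho g x E →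
      ∀ a, θ x ^ 2 * frameG r g u E a x ≤ θ x₀ ^ 2 * frameG r g u E₀ a₀ x₀ := by
  set S := {z : Coord m × (Fin (m + 1) → Fin (m + 1) → ℝ) |
      z.1 ∈ halfBall m r ∧ IsOrtho g z.1 z.2} with hS
  have hSc : IsCompact S := isCompact_orthoFrames hr hg hΛ
  have hSne : S.Nonempty := by
    have h0 : (0 : Coord m) ∈ halfBall m r := by
      simp [halfBall, sq_nonneg]
    obtain ⟨E, hE⟩ := hg.exists_isOrtho h0
    exact ⟨(0, E), h0, hE⟩
  have hfst : ∀ {v : Coord m → ℝ}, ContinuousOn v (halfBall m r) →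
      ContinuousOn (fun z : Coord m × (Fin (m + 1) → Fin (m + 1) → ℝ) => v z.1) S :=
    fun hv => hv.comp continuousOn_fst fun z hz => hz.1
  have hE : ∀ a i, ContinuousOn
      (fun z : Coord m × (Fin (m + 1) → Fin (m + 1) → ℝ) => z.2 a i) S := fun a i =>
    Continuous.continuousOn (by fun_prop)
  have hV : ∀ a, ContinuousOn (fun z : Coord m × (Fin (m + 1) → Fin (m + 1) → ℝ) =>
      frameV r g u z.2 a z.1) S := by
    intro a
    refine ContinuousOn.add ?_ (ContinuousOn.pow ?_ 2)
    · exact continuousOn_finsetSum _ fun j _ => ContinuousOn.mul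
        (continuousOn_finsetSum _ fun i _ => ContinuousOn.mul
          (hfst (contDiffOn_second hr hg hu i j).continuousOn) (hE a i)) (hE a j)
    · exact continuousOn_finsetSum _ fun i _ => ContinuousOn.mul
        (hfst (differentiableOn_first hr hu i).continuousOn) (hE a i)
  have hH : ∀ a, ContinuousOn (fun z : Coord m × (Fin (m + 1) → Fin (m + 1) → ℝ) =>
      θ z.1 ^ 2 * frameG r g u z.2 a z.1) S := fun a =>
    ((hfst hθ).pow 2).mul ((hV a).add (continuousOn_finsetSum _ fun k _ => hV k))
  choose z hzS hz using fun a => hSc.exists_isMaxOn hSne (hH a)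
  obtain ⟨a₀, ha₀⟩ := Finite.exists_max fun a => θ (z a).1 ^ 2 * frameG r g u (z a).2 a (z a).1
  refine ⟨(z a₀).1, (hzS a₀).1, (z a₀).2, (hzS a₀).2, a₀, fun x hx E hE a => ?_⟩
  exact (isMaxOn_iff.1 (hz a) (x, E) ⟨hx, hE⟩).trans (ha₀ a)

lemma exists_C2Bound (hr : 0 < r) {v : Coord m → ℝ} (hv : ContDiffOn ℝ 2 v (halfBall m r)) :
    ∃ b, C2Bound r b v := by
  have hc := isCompact_halfBall (m := m) hr
  have h1 : ∀ i, ContDiffOn ℝ 1 (pd r i v) (halfBall m r) := fun i =>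
    contDiffOn_pd hr hv (by norm_num) i
  have h2 : ∀ i j, ContDiffOn ℝ 0 (pd r i (pd r j v)) (halfBall m r) := fun i j =>
    contDiffOn_pd hr (h1 j) (by norm_num) i
  obtain ⟨b0, hb0⟩ := hc.exists_bound_of_continuousOn hv.continuousOn
  choose b1 hb1 using fun i => hc.exists_bound_of_continuousOn (h1 i).continuousOn
  choose b2 hb2 using fun i j => hc.exists_bound_of_continuousOn (h2 i j).continuousOn
  have n1 : 0 ≤ ∑ i, |b1 i| := Finset.sum_nonneg fun _ _ => abs_nonneg _
  have n2 : 0 ≤ ∑ i, ∑ j, |b2 i j| :=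
    Finset.sum_nonneg fun _ _ => Finset.sum_nonneg fun _ _ => abs_nonneg _
  refine ⟨|b0| + ∑ i, |b1 i| + ∑ i, ∑ j, |b2 i j|, fun x hx => ⟨?_, fun i => ?_, fun i j => ?_⟩⟩
  · have := (hb0 x hx).trans (le_abs_self b0)
    rw [Real.norm_eq_abs] at this
    linarith
  · have := (hb1 i x hx).trans (le_abs_self _)
    rw [Real.norm_eq_abs] at this
    have h3 := Finset.single_le_sum (f := fun i => |b1 i|) (fun _ _ => abs_nonneg _)
      (Finset.mem_univ i)
    linarith [abs_nonneg b0]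
  · have := (hb2 i j x hx).trans (le_abs_self _)
    rw [Real.norm_eq_abs] at this
    have h3 := Finset.single_le_sum (f := fun j => |b2 i j|) (fun _ _ => abs_nonneg _)
      (Finset.mem_univ j)
    have h4 := Finset.single_le_sum (f := fun i => ∑ j, |b2 i j|)
      (fun _ _ => Finset.sum_nonneg fun _ _ => abs_nonneg _) (Finset.mem_univ i)
    linarith [abs_nonneg b0]

/-- The cut-off function; its logarithmic normal derivative on the flat boundary is `A`. -/
noncomputable def cutoff (r A : ℝ) (x : Coord m) : ℝ :=
  (r ^ 2 - ∑ i, x i ^ 2) * Real.exp (A * x (Fin.last m))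

lemma contDiff_cutoff (r A : ℝ) : ContDiff ℝ 2 (cutoff r A : Coord m → ℝ) := by
  unfold cutoff
  fun_prop

lemma pd_cutoff (hr : 0 < r) (A : ℝ) {x : Coord m} (hx : x ∈ halfBall m r)
    (h0 : x (Fin.last m) = 0) : pd r (Fin.last m) (cutoff r A) x = A * cutoff r A x := by
  have hc : ∀ i : Fin (m + 1), DifferentiableOn ℝ (fun y : Coord m => y i) (halfBall m r) :=
    fun i => ((contDiff_coord i).differentiable (by simp)).differentiableOn
  have hsq : ∀ i : Fin (m + 1), DifferentiableOn ℝ (fun y : Coord m => y i * y i) (halfBall m r) :=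
    fun i => (hc i).fun_mul (hc i)
  have e : (cutoff r A : Coord m → ℝ) = fun y =>
      (r ^ 2 - ∑ i, y i * y i) * Real.exp (A * y (Fin.last m)) := by
    funext y
    simp only [cutoff, pow_two]
  have hA : DifferentiableOn ℝ (fun y : Coord m => A * y (Fin.last m)) (halfBall m r) :=
    (hc _).const_mul A
  have hs : DifferentiableOn ℝ (fun y : Coord m => ∑ i, y i * y i) (halfBall m r) :=
    DifferentiableOn.fun_sum fun i _ => hsq i
  rw [e, pd_mul hr hx ((differentiableOn_const _).fun_sub hs) hA.exp,
    pd_sub hr hx (differentiableOn_const _) hs, pd_const, pd_sum hr hx (fun i _ => hsq i),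
    pd_exp hr hx hA, pd_const_mul hr hx A (hc _), pd_coord hr hx]
  have : ∑ i, pd r (Fin.last m) (fun y : Coord m => y i * y i) x = 0 := by
    refine Finset.sum_eq_zero fun i _ => ?_
    rw [pd_mul hr hx (hc i) (hc i), pd_coord hr hx]
    by_cases hi : Fin.last m = i
    · subst hi; simp [h0]
    · simp [hi]
  rw [this]
  simp
  ring

end Maximum

/-! ### The local estimate -/

section Estimate

variable {m : ℕ} {r : ℝ} {g : Coord m → Matrix (Fin (m + 1)) (Fin (m + 1)) ℝ}

/-- In a frame of eigenvectors of `W`, the gradient and the Hessian are controlled by `G`. -/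
lemma gradSq_add_hessNorm_le (hm : 2 ≤ m) {Γ : Set (Fin (m + 1) → ℝ)} (hΓ : IsAdmissibleCone Γ)
    {u : Coord m → ℝ} {x : Coord m} {E : Matrix (Fin (m + 1)) (Fin (m + 1)) ℝ}
    {l : Fin (m + 1) → ℝ} (hl : l ∈ Γ) (hE : E * g x * E.transpose = 1)
    (hd : E * schoutenHat r g u x * E.transpose = Matrix.diagonal l) {a : Fin (m + 1)}
    (ha : ∀ k, l k ≤ l a) :
    0 < frameG r g u E a x ∧ gradSq r g u x + hessNorm r g u x ≤
      (2 + (m + 1) * (m + 3)) * frameG r g u E a x := by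
  have hO := isOrtho_of_mul_eq_one hE
  have hlW := diag_eq_frameV hE hd
  set p : Fin (m + 1) → ℝ := fun k => ev1 (fun i => pd r i u) E k x with hp
  set q : Fin (m + 1) → Fin (m + 1) → ℝ := fun k l =>
    ev2 (cov1 r g fun i => pd r i u) E k l x with hq
  set G := frameG r g u E a x with hG
  obtain ⟨hG0, hP, hv, -, -⟩ := size_bounds (N := m + 1) (p := p) (q := q) (a := a) (G := G)
    (by omega) rfl
    ((hΓ.sum_pos hl).trans_eq (Finset.sum_congr rfl fun k _ => by rw [hlW k]; rfl))
    (fun k => by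
      have := ha k
      rw [hlW, hlW] at this
      exact (sub_le_sub_iff_right _).1 this)
  refine ⟨hG0, ?_⟩
  push_cast at hv
  have hpk : ∀ k, p k ^ 2 ≤ 2 * G := fun k =>
    (Finset.single_le_sum (f := fun k => p k ^ 2) (fun _ _ => sq_nonneg _)
      (Finset.mem_univ k)).trans hP
  have hoff : ∀ k l, k ≠ l → q k l = -(p k * p l) := by
    intro k l hkl
    have e := ev2_eq_matrix (fun i j y => schoutenHat r g u y i j) E k l x
    have e2 : (Matrix.of fun i j => schoutenHat r g u x i j) = schoutenHat r g u x := rfl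
    rw [e2, hd, Matrix.diagonal_apply_ne _ hkl, hO.ev2_schoutenHat u k l, if_neg hkl] at e
    have e3 : q k l + p k * p l - 1 / 2 * (∑ k, p k ^ 2) * 0 = 0 := e
    linarith
  have hqb : ∀ k l, |q k l| ≤ (m + 3) * G := by
    intro k l
    have hmG : 0 ≤ (m : ℝ) * G := by positivity
    by_cases hkl : k = l
    · subst hkl
      have h1 := abs_le.1 (hv k)
      have h2 := hpk k
      have h3 := sq_nonneg (p k)
      rw [abs_le]
      constructor <;> linarith
    · rw [hoff k l hkl, abs_neg, abs_le]
      have h1 := hpk k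
      have h2 := hpk l
      constructor
      · linarith [sq_nonneg (p k + p l)]
      · linarith [sq_nonneg (p k - p l)]
  have hgrad : gradSq r g u x ≤ 2 * G := by
    rw [hO.gradSq_eq]; exact hP
  have hhess : hessNorm r g u x ≤ (m + 1) * (m + 3) * G := by
    rw [hO.hessNorm_eq]
    refine Real.sqrt_le_iff.2 ⟨by positivity, ?_⟩
    calc ∑ a, ∑ b, q a b ^ 2 ≤ ∑ _a : Fin (m + 1), ∑ _b : Fin (m + 1), ((m + 3) * G) ^ 2 := by
          refine Finset.sum_le_sum fun a _ => Finset.sum_le_sum fun b _ => ?_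
          rw [← sq_abs]
          gcongr
          exact hqb a b
      _ = ((m + 1) * (m + 3) * G) ^ 2 := by
          simp only [Finset.sum_const, Finset.card_univ, Fintype.card_fin, nsmul_eq_mul]
          push_cast
          ring
  linarith

/-- On the boundary the normal direction is an eigenvector of `W`. -/
lemma IsSolution.schoutenHat_mixed (hm : 2 ≤ m) (hr : 0 < r) (hg : IsFermiMetric r g)
    (hf : IsFlat r g) {μ f u : Coord m → ℝ} {μhat : ℝ} (hum : IsUmbilic r g μ)
    {Γ : Set (Fin (m + 1) → ℝ)} {F : (Fin (m + 1) → ℝ) → ℝ}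
    (hu : IsSolution r g Γ F μ μhat f u) {x : Coord m} (h0 : x (Fin.last m) = 0)
    (h1 : ∑ i, x i ^ 2 < r ^ 2) (a : Fin m) :
    schoutenHat r g u x a.castSucc (Fin.last m) = 0 := by
  have e : schoutenHat r g u x a.castSucc (Fin.last m) =
      (cov1 r g (fun i => pd r i u) a.castSucc (Fin.last m) x
      + pd r a.castSucc u x * pd r (Fin.last m) u x)
      - ((1 / 2) * gradSq r g u x) * g x a.castSucc (Fin.last m) := by
    simp [schoutenHat, covHess, cov1]
  rw [e, hu.cov1_mixed hm hr hg hf hum h0 h1, hg.mixed x (mem_halfBall_of_bdy h0 h1)]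
  ring

/-- The local estimate, for an upper bound `νmax` of `μhat e^{-u}` on the flat boundary and an
upper bound `s` of `e^{-2u}`. -/
theorem exists_local_estimate (hm : 2 ≤ m) (hr : 0 < r) {ε : ℝ} (hε : 0 < ε) (Λ K νmax : ℝ)
    {f₀ ρ : ℝ} (hf₀ : 0 < f₀) (hρ : 0 ≤ ρ) : ∃ C : ℝ, 0 ≤ C ∧
    ∀ (g : Coord m → Matrix (Fin (m + 1)) (Fin (m + 1)) ℝ)
      (Γ : Set (Fin (m + 1) → ℝ)) (F : (Fin (m + 1) → ℝ) → ℝ) (μhat s : ℝ) (μ f u : Coord m → ℝ),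
      IsFermiMetric r g → IsFlat r g → IsUmbilic r g μ → ChartBound r g Λ →
      IsAdmissibleCone Γ → IsAdmissibleFun ε Γ F → IsDatum r K f₀ f →
      IsSolution r g Γ F μ μhat f u → 0 ≤ μhat → (μhat = 0 ∨ ConditionA ρ Γ F) →
      (∀ x ∈ flatBdy m r, μhat * Real.exp (-u x) ≤ νmax) →
      (∀ x ∈ halfBall m r, Real.exp (-2 * u x) ≤ s) →
      ∀ x ∈ halfBall m (r / 2), gradSq r g u x + hessNorm r g u x ≤ C * (1 + s) := by
  obtain ⟨CB, hCB0, hCB⟩ := exists_boundary_estimate hm hε Λ K νmax hf₀ hρ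
  -- this value of `A` exceeds the bound that a boundary maximum would impose
  set A : ℝ := CB + 1 with hA
  have hθC : ContDiffOn ℝ 2 (cutoff r A : Coord m → ℝ) (halfBall m r) :=
    (contDiff_cutoff r A).contDiffOn
  obtain ⟨b, hb⟩ := exists_C2Bound hr hθC
  obtain ⟨CI, hCI0, hCI⟩ := exists_interior_estimate hm Λ K b
  refine ⟨(2 + (m + 1) * (m + 3)) * (CI / (3 * r ^ 2 / 4) ^ 2), by positivity, ?_⟩
  intro g Γ F μhat s μ f u hg hflat hum hΛ hΓ hF hf hu hμhat hcA hν hs x hx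
  have hu2 : ContDiffOn ℝ 2 u (halfBall m r) := hu.smooth.of_le (by norm_num)
  have hdiag : ∀ y ∈ halfBall m r, ∃ (E : Matrix (Fin (m + 1)) (Fin (m + 1)) ℝ)
      (l : Fin (m + 1) → ℝ), E * g y * E.transpose = 1 ∧
        E * schoutenHat r g u y * E.transpose = Matrix.diagonal l := fun y hy =>
    exists_diagonal_frame (hg.posDef y hy) (schoutenHat_isHermitian hr hg hu2 hy)
  obtain ⟨x₀, hx₀, E₁, hE₁, a₁, hmax⟩ := exists_max_frameG hr hg hΛ hu.smooth hθC.continuousOn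
  -- the maximum is positive, hence not on the sphere
  have hx₀r : ∑ i, x₀ i ^ 2 < r ^ 2 := by
    refine lt_of_le_of_ne hx₀.2 fun heq => ?_
    have h0 : (0 : Coord m) ∈ halfBall m r := by simp [halfBall, sq_nonneg]
    obtain ⟨E, l, hE, hd⟩ := hdiag 0 h0
    obtain ⟨a, ha⟩ := Finite.exists_max l
    have hG := (gradSq_add_hessNorm_le hm hΓ (hu.diag_mem hΓ hF h0 hE hd).1 hE hd ha).1
    have h1 := hmax 0 h0 E (isOrtho_of_mul_eq_one hE) a
    have h2 : (cutoff r A x₀ : ℝ) = 0 := by simp [cutoff, heq]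
    have h3 : (cutoff r A (0 : Coord m) : ℝ) = r ^ 2 := by simp [cutoff]
    rw [h2, h3] at h1
    have : 0 < (r ^ 2) ^ 2 * frameG r g u E a 0 := by positivity
    linarith
  have hθ0 : 0 < cutoff r A x₀ := mul_pos (by linarith) (Real.exp_pos _)
  -- at the maximum point any frame of eigenvectors of `W` may be used
  have htransfer : ∀ (E₀ : Matrix (Fin (m + 1)) (Fin (m + 1)) ℝ) (l₀ : Fin (m + 1) → ℝ)
      (a : Fin (m + 1)), E₀ * g x₀ * E₀.transpose = 1 →
      E₀ * schoutenHat r g u x₀ * E₀.transpose = Matrix.diagonal l₀ → (∀ k, l₀ k ≤ l₀ a) →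
      (∀ k, frameV r g u E₀ k x₀ ≤ frameV r g u E₀ a x₀) ∧
      ∀ y ∈ halfBall m r, ∀ E, IsOrtho g y E → ∀ c,
        cutoff r A y ^ 2 * frameG r g u E c y ≤ cutoff r A x₀ ^ 2 * frameG r g u E₀ a x₀ := by
    intro E₀ l₀ a hE₀ hd₀ ha
    refine ⟨fun k => ?_, fun y hy E hE c => ?_⟩
    · have := ha k
      rw [diag_eq_frameV hE₀ hd₀, diag_eq_frameV hE₀ hd₀] at this
      exact (sub_le_sub_iff_right _).1 this
    · exact (hmax y hy E hE c).trans (mul_le_mul_of_nonneg_left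
        (frameG_le hE₀ hd₀ ha hE₁ a₁) (sq_nonneg _))
  have hbound : ∀ y ∈ halfBall m r, ∀ E, IsOrtho g y E → ∀ c,
      cutoff r A y ^ 2 * frameG r g u E c y ≤ CI * (1 + s) := by
    rcases hx₀.1.eq_or_lt with h0 | h0
    · exfalso
      obtain ⟨E₀, l₀, hE₀, hd₀, hEn, hEa⟩ := exists_diagonal_frame_last (hg.posDef x₀ hx₀)
        (schoutenHat_isHermitian hr hg hu2 hx₀) (hg.normal x₀ hx₀) (hg.mixed x₀ hx₀)
        (hu.schoutenHat_mixed hm hr hg hflat hum h0.symm hx₀r)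
      obtain ⟨a, ha⟩ := Finite.exists_max l₀
      obtain ⟨t1, t2⟩ := htransfer E₀ l₀ a hE₀ hd₀ ha
      have := hCB r g Γ F μhat μ f u (cutoff r A) hr hg hflat hum hΛ hΓ hF hf hu hμhat hcA hθC
        x₀ E₀ l₀ a A h0.symm hx₀r (hν x₀ (mem_flatBdy_of_bdy h0.symm hx₀r)) hE₀ hd₀ hEn hEa t1
        (fun y hy E hE => t2 y hy E hE a) hθ0 (pd_cutoff hr A hx₀ h0.symm)
      linarith
    · obtain ⟨E₀, l₀, hE₀, hd₀⟩ := hdiag x₀ hx₀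
      obtain ⟨a, ha⟩ := Finite.exists_max l₀
      obtain ⟨t1, t2⟩ := htransfer E₀ l₀ a hE₀ hd₀ ha
      have := hCI r g Γ F ε μhat μ f u (cutoff r A) hr hg hflat hΛ hΓ hF hf.smooth hf.bound hu hθC
        hb x₀ E₀ l₀ a s h0 hx₀r hE₀ hd₀ t1 (fun y hy E hE => t2 y hy E hE a) hθ0 (hs x₀ hx₀)
      exact fun y hy E hE c => (t2 y hy E hE c).trans this
  have hxr : ∑ i, x i ^ 2 ≤ r ^ 2 / 4 := hx.2.trans_eq (by ring)
  have hxB : x ∈ halfBall m r := ⟨hx.1, hxr.trans (by linarith [sq_nonneg r])⟩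
  have hθx : 3 * r ^ 2 / 4 ≤ cutoff r A x := by
    have h1 : 1 ≤ Real.exp (A * x (Fin.last m)) :=
      Real.one_le_exp (mul_nonneg (by linarith) hx.1)
    calc 3 * r ^ 2 / 4 ≤ r ^ 2 - ∑ i, x i ^ 2 := by linarith
      _ ≤ _ := le_mul_of_one_le_right (by linarith [sq_nonneg r]) h1
  obtain ⟨E, l, hE, hd⟩ := hdiag x hxB
  obtain ⟨a, ha⟩ := Finite.exists_max l
  obtain ⟨hG0, hle⟩ := gradSq_add_hessNorm_le hm hΓ (hu.diag_mem hΓ hF hxB hE hd).1 hE hd ha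
  have h1 := hbound x hxB E (isOrtho_of_mul_eq_one hE) a
  have h2 : (3 * r ^ 2 / 4) ^ 2 * frameG r g u E a x ≤ CI * (1 + s) := by
    refine le_trans (mul_le_mul_of_nonneg_right ?_ hG0.le) h1
    gcongr
  have h3 : frameG r g u E a x ≤ CI / (3 * r ^ 2 / 4) ^ 2 * (1 + s) := by
    rw [div_mul_eq_mul_div, le_div_iff₀ (by positivity), mul_comm]
    exact h2
  refine hle.trans ((mul_le_mul_of_nonneg_left h3 (by positivity)).trans_eq (by ring))

end Estimate

end FermiBdy

theorem theorem3 (m : ℕ) (hm : 2 ≤ m) (r : ℝ) (hr : 0 < r) (ε : ℝ) (hε : 0 < ε)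
    (μ : Coord m → ℝ) (Λ K f₀ : ℝ) (hf₀ : 0 < f₀) :
    (∃ C : ℝ, ∀ (g : Coord m → Matrix (Fin (m + 1)) (Fin (m + 1)) ℝ)
        (Γ : Set (Fin (m + 1) → ℝ)) (F : (Fin (m + 1) → ℝ) → ℝ) (f u : Coord m → ℝ),
      IsFermiMetric r g → IsFlat r g → IsUmbilic r g μ → ChartBound r g Λ →
      IsAdmissibleCone Γ → IsAdmissibleFun ε Γ F →
      IsDatum r K f₀ f → IsSolution r g Γ F μ 0 f u →
      ∀ x ∈ halfBall m (r / 2),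
        gradSq r g u x + hessNorm r g u x
          ≤ C * (1 + sSup ((fun y => Real.exp (-2 * u y)) '' halfBall m r))) ∧
    (∀ ρ : ℝ, 0 < ρ → ∀ μhat : ℝ, 0 < μhat → ∀ u₀ : ℝ,
      ∃ C : ℝ, ∀ (g : Coord m → Matrix (Fin (m + 1)) (Fin (m + 1)) ℝ)
        (Γ : Set (Fin (m + 1) → ℝ)) (F : (Fin (m + 1) → ℝ) → ℝ) (f u : Coord m → ℝ),
      IsFermiMetric r g → IsFlat r g → IsUmbilic r g μ → ChartBound r g Λ →
      IsAdmissibleCone Γ → IsAdmissibleFun ε Γ F →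
      ConditionA ρ Γ F → Γ ⊆ posCone (m + 1) 2 →
      IsDatum r K f₀ f → IsSolution r g Γ F μ μhat f u →
      (∀ y ∈ halfBall m r, u₀ ≤ u y) →
      ∀ x ∈ halfBall m (r / 2),
        gradSq r g u x + hessNorm r g u x ≤ C) := by
  constructor
  · obtain ⟨C, -, hC⟩ := exists_local_estimate hm hr hε Λ K 0 hf₀ (ρ := 0) le_rfl
    refine ⟨C, fun g Γ F f u hg hflat hum hΛ hΓ hF hf hu => ?_⟩
    have hbdd : BddAbove ((fun y => Real.exp (-2 * u y)) '' halfBall m r) := by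
      refine (isCompact_halfBall hr).bddAbove_image ?_
      exact (hu.smooth.continuousOn.const_mul (-2)).rexp
    exact hC g Γ F 0 _ μ f u hg hflat hum hΛ hΓ hF hf hu le_rfl (Or.inl rfl)
      (fun x _ => by rw [zero_mul]) (fun x hx => le_csSup hbdd ⟨x, hx, rfl⟩)
  · intro ρ hρ μhat hμhat u₀
    obtain ⟨C, -, hC⟩ := exists_local_estimate hm hr hε Λ K (μhat * Real.exp (-u₀)) hf₀ hρ.le
    refine ⟨C * (1 + Real.exp (-2 * u₀)), fun g Γ F f u hg hflat hum hΛ hΓ hF hA _ hf hu hlow => ?_⟩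
    refine hC g Γ F μhat _ μ f u hg hflat hum hΛ hΓ hF hf hu hμhat.le (Or.inr hA)
      (fun x hx => ?_) (fun x hx => ?_)
    · have := hlow x ⟨hx.1.ge, hx.2⟩
      gcongr
    · have := hlow x hx
      exact Real.exp_le_exp.2 (by linarith)
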